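/- **Setting.** Let $n\ge1$, let $\Theta\subset\mathbb R^n$ be compact and connected with $0$ in its interior, and let $H$, $\mathcal H$ be complex separable Hilbert spaces, $H$ being a dense, compactly embedded subset of $\mathcal H$. Sesquilinear forms are linear in the first and antilinear in the second argument, and $\mathfrak b[u]:=\mathfrak b(u,u)$. For $\theta\in\Theta$ let $a_\theta,b_\theta$ be non-negative sesquilinear forms on $H$ such that $(\cdot,\cdot)_\theta:=a_\theta+b_\theta$ (with norms $\|\cdot\|_\theta$) are uniformly equivalent inner products on $H$, defining its Hilbert space structure, and let $d_\theta$ be uniformly equivalent inner products on $\mathcal H$, defining its Hilbert space structure, with $d_\theta[u]\le b_\theta[u]$ for $u\in H$. Assume $|a_{\theta_1}(u,\tilde u)-a_{\theta_2}(u,\tilde u)|\le L_a|\theta_1-\theta_2|\,\|u\|_{\theta_1}\|\tilde u\|_{\theta_1}$. Put $V_\theta:=\{v\in H: a_\theta[v]=0\}$ and $W_\theta:=\{w\in H:(w,v)_\theta=0\ \forall v\in V_\theta\}$. Assume: * (H1) for every $\theta\in\Theta$ there is $\nu_\theta>0$ with $a_\theta[w]\ge\nu_\theta\|w\|_\theta^2$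 for $w\in W_\theta$; * (H2) there are a closed subspace $V_\star$ of $H$ and $L_\star\ge0$ such that, with $V^\star_\theta:=V_\theta$ for $\theta\ne0$ and $V^\star_0:=V_\star$, $\inf_{v_2\in V^\star_{\theta_2}}\|v_1-v_2\|_{\theta_2}\le L_\star|\theta_1-\theta_2|\,\|v_1\|_{\theta_1}$ for all $\theta_1,\theta_2\in\Theta$, $v_1\in V^\star_{\theta_1}$; further, $Z$ is a closed subspace with $V_0=V_\star\dotplus Z$ (direct sum) and $|(v,z)_0|\le K_Z\|v\|_0\|z\|_0$ for $v\in V_\star$, $z\in Z$, where $0\le K_Z<1$; * (H3) there is $\gamma>0$ with $a_\theta[w]\ge\gamma|\theta|^2\|w\|_\theta^2$ for $w\in W_\theta$, $\theta\in\Theta$; * (H4) there are bounded sesquilinear maps $a_0':V_0\times H\to\mathbb C^n$ and $a_0'':V_0\times V_0\to\mathbb C^{n\times n}$ with $|a_\theta(v,u)-a_0'(v,u)\cdot\theta|\le K_{a'}|\theta|^2\|v\|_0\|u\|_0$ and $|a_\theta(v,\tilde v)-a_0''(v,\tilde v)\theta\cdot\theta|\le K_{a''}|\theta|^3\|v\|_0\|\tilde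 v\|_0$ for $v,\tilde v\in V_0$, $u\in H$, $\theta\in\Theta$; * (H5) $|b_\theta(v,\tilde v)-b_0(v,\tilde v)|\le L_b|\theta|\,\|v\|_0\|\tilde v\|_\theta$ for $v,\tilde v\in V_0$, $\theta\in\Theta$; * (H6) there are bijections $\mathcal E_\theta:V_\star\to V_\theta^\star$, $\theta\in\Theta$, with $b_\theta(\mathcal E_\theta v,\mathcal E_\theta\tilde v)=b_0(v,\tilde v)$ and $|b_\theta(\mathcal E_\theta v,z)-b_0(v,z)|\le K_b|\theta|\,\|v\|_0\|z\|_0$ for $v,\tilde v\in V_\star$, $z\in Z$, which extend to bijections of $\mathcal H$ such that $d_\theta(\mathcal E_\theta u,\mathcal E_\theta\tilde u)=d_0(u,\tilde u)$, $\mathcal E_0=I$ and $d_{\theta_1}[\mathcal E_{\theta_1}u-\mathcal E_{\theta_2}u]^{1/2}\le K_e|\theta_1-\theta_2|\,d_0[u]^{1/2}$ for $u,\tilde u\in\mathcal H$. **Operators.** All operators below are those generated by the stated closed form on the stated form domain; $\operatorname{Sp}$ is the spectrum; $\overline U$ is the closure of $U$ in $\mathcal H$. * $\mathcal L_{\varepsilon,\theta}$,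 in $(\mathcal H,d_\theta)$: form $\varepsilon^{-2}a_\theta+b_\theta$, form domain $H$. * $\mathbf B_0$, in $(\overline{V_0},d_0)$: form $b_0$, form domain $V_0$. $\mathbf B_\star$, in $(\overline{V_\star},d_0)$: form $b_0$, form domain $V_\star$. Their eigenvalues, in ascending order with multiplicity, are $\lambda_0^{(k)}$ and $\lambda_\star^{(k)}$, $k\ge1$. * For $v\in V_0$ let $N^jv\in W_0$ solve $a_0(N^jv,w)=-a'_{0,j}(v,w)$ for all $w\in W_0$, and put $a^{\rm h}_{jk}(v,\tilde v):=a''_{0,jk}(v,\tilde v)-a_0(N^jv,N^k\tilde v)$ and $a^{\rm h}_\xi:=\sum_{j,k}a^{\rm h}_{jk}\xi_j\xi_k$. $\mathbb L_\xi$ ($\xi\in\mathbb R^n$), in $(\overline{V_0},d_0)$: form $a^{\rm h}_\xi(z,\tilde z)+b_0(v+z,\tilde v+\tilde z)$ for $v+z,\tilde v+\tilde z\in V_\star\dotplus Z$. * The bivariate operator $\mathcal L$, in $L^2(\mathbb R^n;(\overline{V_0},d_0))$: form $$\int_{\mathbb R^n}\sum_{j,k}a^{\rm h}_{jk}(\partial_ju,\partial_k\tilde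 u)\,dx+\int_{\mathbb R^n}b_0(u+v,\tilde u+\tilde v)\,dx,$$ form domain $H^1(\mathbb R^n;(Z,b_0))\dotplus L^2(\mathbb R^n;(V_\star,b_0))$. **Theorem.** 1. $\operatorname{Sp}\mathcal L=\overline{\bigcup_{\xi\in\mathbb R^n}\operatorname{Sp}\mathbb L_\xi}$, and $\lambda_0^{(k)}\le\lambda_\star^{(k)}$ for $1\le k\le\dim V_\star$. If $\dim V_\star=\infty$, then $\operatorname{Sp}\mathcal L=\bigcup_{k=1}^\infty[\lambda_0^{(k)},\lambda_\star^{(k)}]$. If $N:=\dim V_\star<\infty$ and $Z\ne\{0\}$, then $\operatorname{Sp}\mathcal L=\bigcup_{k=1}^N[\lambda_0^{(k)},\lambda_\star^{(k)}]\cup[\lambda_0^{(N+1)},\infty)$. 2. Suppose $Z$ is chosen so that $b_0(z,v)=d_0(z,v)$ for all $z\in Z$, $v\in V_\star$. For real $\lambda\notin\operatorname{Sp}\mathbf B_\star$ and $z\in Z$ let $v_\lambda(z)\in V_\star$ be the unique solution of $b_0(v,\tilde v)-\lambda d_0(v,\tilde v)=(\lambda-1)d_0(z,\tilde v)$ for all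 $\tilde v\in V_\star$, and let $\beta_\lambda(z,\tilde z):=-b_0(z,\tilde z)+\lambda d_0(z,\tilde z)+(\lambda-1)d_0(v_\lambda(z),\tilde z)$. Then $$\operatorname{Sp}\mathcal L=\{\lambda\in\mathbb R\setminus\operatorname{Sp}\mathbf B_\star:\ \beta_\lambda[z]\ge0\text{ for some }0\ne z\in Z\}\cup\operatorname{Sp}\mathbf B_\star.$$ 3. For $X,Y\subset\mathbb R$ let $\operatorname{dist}(X,Y):=\sup_{x\in X}\operatorname{dist}(x,Y)$, with $\operatorname{dist}(\emptyset,Y)=\operatorname{dist}(X,\emptyset)=0$, and $\operatorname{dist}_{[a,b]}(X,Y):=\max\{\operatorname{dist}([a,b]\cap X,Y),\operatorname{dist}([a,b]\cap Y,X)\}$. There are a constant $C$ and constants $0\le C_b\le C(1+b^2)$, $b\in\mathbb R$, such that for all $a,b\in\mathbb R$ and all $0<\varepsilon<1$ $$\operatorname{dist}_{[a,b]}\Big(\overline{\bigcup_{\theta\in\Theta}\operatorname{Sp}\mathcal L_{\varepsilon,\theta}},\ \operatorname{Sp}\mathcal L\Big)\le C_b\,\varepsilon,$$ and, whenever $(a,b)\cap\operatorname{Sp}\mathcal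 L=\emptyset$ and $2C_b\varepsilon<b-a$, the interval $[a+C_b\varepsilon,\,b-C_b\varepsilon]$ does not meet $\overline{\bigcup_{\theta\in\Theta}\operatorname{Sp}\mathcal L_{\varepsilon,\theta}}$. -/

import Mathlib

open MeasureTheory Set Topology
open scoped ENNReal LineDeriv SchwartzMap ComplexOrder

noncomputable section

/-! ## Sesquilinear forms, operators generated by forms, spectra

Forms are linear in the first and antilinear in the second argument. -/

/-- Bounded sesquilinear forms on a normed space. -/
abbrev BForm (Y : Type*) [NormedAddCommGroup Y] [NormedSpace ℂ Y] : Type _ :=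
  Y →L[ℂ] Y →L⋆[ℂ] ℂ

/-- Sesquilinear forms on a complex vector space. -/
abbrev SForm (Y : Type*) [AddCommGroup Y] [Module ℂ Y] : Type _ :=
  Y →ₗ[ℂ] Y →ₗ⋆[ℂ] ℂ

/-- Forget the boundedness of a form. -/
def BForm.toSForm {Y : Type*} [NormedAddCommGroup Y] [NormedSpace ℂ Y] (q : BForm Y) : SForm Y :=
  LinearMap.mk₂'ₛₗ (RingHom.id ℂ) (starRingEnd ℂ) (fun u v => q u v)
    (by simp) (by simp) (by simp) (by simp)

/-- A bounded form is jointly continuous. -/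
theorem BForm.continuous_uncurry {Y : Type*} [NormedAddCommGroup Y] [NormedSpace ℂ Y]
    (q : BForm Y) : Continuous fun p : Y × Y => q p.1 p.2 := by
  refine continuous_iff_continuousAt.2 fun x => ?_
  have h1 : Filter.Tendsto (fun p : Y × Y => q (p.1 - x.1) p.2) (𝓝 x) (𝓝 0) := by
    refine squeeze_zero_norm (a := fun p : Y × Y => ‖q‖ * ‖p.1 - x.1‖ * ‖p.2‖)
      (fun p => q.le_opNorm₂ _ _) ?_
    have hc : Continuous fun p : Y × Y => ‖q‖ * ‖p.1 - x.1‖ * ‖p.2‖ := by fun_prop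
    simpa using hc.tendsto x
  have h2 : Filter.Tendsto (fun p : Y × Y => q x.1 p.2) (𝓝 x) (𝓝 (q x.1 x.2)) :=
    ((q x.1).continuous.comp continuous_snd).tendsto x
  simpa [ContinuousAt] using h1.add h2

/-- The form `q (f u, g v)` on `E`. -/
def SForm.pull {E F : Type*} [AddCommGroup E] [Module ℂ E] [AddCommGroup F] [Module ℂ F]
    (q : SForm F) (f g : E →ₗ[ℂ] F) : SForm E :=
  LinearMap.mk₂'ₛₗ (RingHom.id ℂ) (starRingEnd ℂ) (fun u v => q (f u) (g v))
    (by simp) (by simp) (by simp) (by simp)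

/-- The inner product of a Hilbert space as a form (linear in the first argument). -/
def innerForm (Y : Type*) [NormedAddCommGroup Y] [InnerProductSpace ℂ Y] : BForm Y :=
  (innerSL ℂ).flip

/-- The graph of the operator generated in `Y` (with inner product `d`) by a form `q` with form
domain `E`, where `E` is embedded in `Y` by `j`: a pair `(u, g)` belongs to it iff `u` lies in the
form domain and `q (u, w) = d (g, w)` for all `w` in the form domain. -/
def formGraph {E Y : Type*} [AddCommGroup E] [Module ℂ E] [NormedAddCommGroup Y] [NormedSpace ℂ Y]
    (d : BForm Y) (j : E →ₗ[ℂ] Y) (q : SForm E) : Submodule ℂ (Y × Y) where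
  carrier := {p | ∃ e : E, j e = p.1 ∧ ∀ w : E, q e w = d p.2 (j w)}
  add_mem' := by
    rintro p p' ⟨e, he, hq⟩ ⟨e', he', hq'⟩
    exact ⟨e + e', by simp [he, he'], fun w => by simp [hq, hq']⟩
  zero_mem' := ⟨0, by simp, fun w => by simp⟩
  smul_mem' := by
    rintro c p ⟨e, he, hq⟩
    exact ⟨c • e, by simp [he], fun w => by simp [hq]⟩

/-- The operator generated in `(Y, d)` by the form `q` with (dense) form domain `j : E → Y`. -/
def formOperator {E Y : Type*} [AddCommGroup E] [Module ℂ E] [NormedAddCommGroup Y]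
    [NormedSpace ℂ Y] (d : BForm Y) (j : E →ₗ[ℂ] Y) (q : SForm E) : Y →ₗ.[ℂ] Y :=
  (formGraph d j q).toLinearPMap

/-- The resolvent set of an unbounded operator: `T - lam` is a bijection of the domain onto the
space, with a bounded inverse. -/
def resolventSetOf {Y : Type*} [NormedAddCommGroup Y] [NormedSpace ℂ Y] (T : Y →ₗ.[ℂ] Y) : Set ℂ :=
  {lam | ∃ R : Y →L[ℂ] Y,
    (∀ g : Y, ∃ h : R g ∈ T.domain, T ⟨R g, h⟩ - lam • R g = g) ∧
    ∀ u : T.domain, R (T u - lam • (u : Y)) = u}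

/-- The spectrum of an unbounded operator. -/
def Sp {Y : Type*} [NormedAddCommGroup Y] [NormedSpace ℂ Y] (T : Y →ₗ.[ℂ] Y) : Set ℂ :=
  (resolventSetOf T)ᶜ

/-- The space of solutions of `T u = lam u`. -/
def eigenspaceOf {Y : Type*} [NormedAddCommGroup Y] [NormedSpace ℂ Y] (T : Y →ₗ.[ℂ] Y) (lam : ℂ) :
    Submodule ℂ Y :=
  (LinearMap.ker (T.toFun - lam • T.domain.subtype)).map T.domain.subtype

/-- The `k`-th (`k = 1, 2, …`) real eigenvalue in ascending order, counted with multiplicity: the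
least `r` for which the eigenvalues up to `r` have total multiplicity at least `k`. -/
def nthEigenvalue {Y : Type*} [NormedAddCommGroup Y] [NormedSpace ℂ Y] (T : Y →ₗ.[ℂ] Y) (k : ℕ) :
    ℝ :=
  sInf {r : ℝ | (k : Cardinal) ≤ Module.rank ℂ ↥(⨆ s ∈ Set.Iic r, eigenspaceOf T (s : ℂ))}

/-- The form `∫ q (f x, g x) dx` on `L²` of a vector-valued function space. -/
def l2Form {n : ℕ} {Y : Type*} [NormedAddCommGroup Y] [NormedSpace ℂ Y] (q : BForm Y) :
    SForm (Lp Y 2 (volume : Measure (EuclideanSpace ℝ (Fin n)))) :=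
  have key : ∀ f g : Lp Y 2 (volume : Measure (EuclideanSpace ℝ (Fin n))),
      Integrable (fun x => q (f x) (g x)) volume := fun f g => by
    have hf := Lp.memLp f
    have hg := Lp.memLp g
    have hfg : Integrable (fun x => ‖f x‖ * ‖g x‖) volume := hf.norm.integrable_mul hg.norm
    refine (hfg.const_mul ‖q‖).mono' ?_ ?_
    · exact q.continuous_uncurry.comp_aestronglyMeasurable (hf.1.prodMk hg.1)
    · filter_upwards with x
      calc ‖q (f x) (g x)‖ ≤ ‖q‖ * ‖f x‖ * ‖g x‖ := q.le_opNorm₂ _ _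
        _ = ‖q‖ * (‖f x‖ * ‖g x‖) := by ring
  LinearMap.mk₂'ₛₗ (RingHom.id ℂ) (starRingEnd ℂ) (fun f g => ∫ x, q (f x) (g x))
    (fun f f' g => by
      rw [← integral_add (key f g) (key f' g)]
      refine integral_congr_ae ?_
      filter_upwards [Lp.coeFn_add f f'] with x hx
      rw [hx]
      simp)
    (fun c f g => by
      rw [← integral_smul]
      refine integral_congr_ae ?_
      filter_upwards [Lp.coeFn_smul c f] with x hx
      rw [hx]
      simp)
    (fun f g g' => by
      rw [← integral_add (key f g) (key f g')]
      refine integral_congr_ae ?_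
      filter_upwards [Lp.coeFn_add g g'] with x hx
      rw [hx]
      simp)
    (fun c f g => by
      rw [← integral_smul]
      refine integral_congr_ae ?_
      filter_upwards [Lp.coeFn_smul c g] with x hx
      rw [hx]
      simp)

/-! ## Distances between closed sets on an interval -/

/-- The non-symmetric distance `sup_{x ∈ A} dist (x, B)`, equal to `0` if `A` or `B` is empty. -/
def oneSidedDist (A B : Set ℂ) : ℝ≥0∞ :=
  ⨆ x ∈ A, ENNReal.ofReal (Metric.infDist x B)

/-- The real interval `[s, t]` in the complex plane. -/
def realIcc (s t : ℝ) : Set ℂ := Complex.ofReal '' Set.Icc s t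

/-- `max (dist ([s,t] ∩ A, B), dist ([s,t] ∩ B, A))`. -/
def distOn (s t : ℝ) (A B : Set ℂ) : ℝ≥0∞ :=
  max (oneSidedDist (realIcc s t ∩ A) B) (oneSidedDist (realIcc s t ∩ B) A)

/-! ## The abstract family of problems -/

/-- The family of forms `a_θ`, `b_θ` on `H` and of inner products `d_θ` on `X`, `θ ∈ Θ`, with the
standing assumptions. The inner products `a_θ + b_θ` on `H` being uniformly equivalent, and likewise
the `d_θ` on `X`, the Hilbert structures of `H` and `X` are taken to be those at `θ = 0`. -/
structure Setting (n : ℕ) (H X : Type*) [NormedAddCommGroup H] [InnerProductSpace ℂ H]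
    [NormedAddCommGroup X] [InnerProductSpace ℂ X] where
  /-- the parameter set -/
  Θ : Set (EuclideanSpace ℝ (Fin n))
  /-- the singular form -/
  a : Θ → BForm H
  /-- the regular form -/
  b : Θ → BForm H
  /-- the inner products of the ambient space -/
  d : Θ → BForm X
  /-- the embedding of `H` in `X` -/
  J : H →L[ℂ] X
  isCompact_Θ : IsCompact Θ
  zero_mem : (0 : EuclideanSpace ℝ (Fin n)) ∈ Θ
  a_nonneg : ∀ θ u, 0 ≤ a θ u u
  b_nonneg : ∀ θ u, 0 ≤ b θ u u
  d_nonneg : ∀ θ u, 0 ≤ d θ u u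
  inner_H : ∀ u v, a ⟨0, zero_mem⟩ u v + b ⟨0, zero_mem⟩ u v = innerForm H u v
  inner_X : ∀ u v, d ⟨0, zero_mem⟩ u v = innerForm X u v
  equiv_H : ∃ K : ℝ, 0 < K ∧ ∀ θ₁ θ₂ u,
    √(a θ₁ u u + b θ₁ u u).re ≤ K * √(a θ₂ u u + b θ₂ u u).re
  lipschitz_a : ∃ La : ℝ, 0 < La ∧ ∀ (θ₁ θ₂ : Θ) (u v : H),
    ‖a θ₁ u v - a θ₂ u v‖ ≤ La * ‖(θ₁ : EuclideanSpace ℝ (Fin n)) - θ₂‖ *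
      √(a θ₁ u u + b θ₁ u u).re * √(a θ₁ v v + b θ₁ v v).re
  equiv_X : ∃ Kd : ℝ, 0 < Kd ∧ ∀ θ₁ θ₂ u, (d θ₁ u u).re ≤ Kd * (d θ₂ u u).re
  J_injective : Function.Injective J
  J_dense : DenseRange J
  J_compact : IsCompactOperator J
  d_le_b : ∀ θ u, (d θ (J u) (J u)).re ≤ (b θ u u).re

namespace Setting

variable {n : ℕ} {H X : Type*} [NormedAddCommGroup H] [InnerProductSpace ℂ H]
  [NormedAddCommGroup X] [InnerProductSpace ℂ X]

/-- The point `θ = 0`. -/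
def o (S : Setting n H X) : S.Θ := ⟨0, S.zero_mem⟩

/-- The norm `‖u‖_θ`. -/
def nrm (S : Setting n H X) (θ : S.Θ) (u : H) : ℝ := √(S.a θ u u + S.b θ u u).re

/-- The kernel `V_θ = {v | a_θ[v] = 0}`. -/
def V (S : Setting n H X) (θ : S.Θ) : Submodule ℂ H where
  carrier := {v | S.a θ v v = 0}
  add_mem' := by
    intro u v hu hv
    simp only [Set.mem_ofPred_eq] at hu hv ⊢
    have h1 := S.a_nonneg θ (u + v)
    have h2 := S.a_nonneg θ (u - v)
    have h3 : S.a θ (u + v) (u + v) + S.a θ (u - v) (u - v) = 0 := by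
      simp only [map_add, map_sub, add_apply, sub_apply,
        hu, hv]
      ring
    exact le_antisymm (by rw [← h3]; exact le_add_of_nonneg_right h2) h1
  zero_mem' := by simp
  smul_mem' := by
    intro c v hv
    simp only [Set.mem_ofPred_eq] at hv ⊢
    simp [hv]

/-- The orthogonal complement `W_θ` of `V_θ` with respect to `a_θ + b_θ`. -/
def W (S : Setting n H X) (θ : S.Θ) : Submodule ℂ H where
  carrier := {w | ∀ v ∈ S.V θ, S.a θ w v + S.b θ w v = 0}
  add_mem' := by
    intro w w' hw hw' v hv
    have h1 := hw v hv
    have h2 := hw' v hv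
    simp only [map_add, add_apply]
    linear_combination h1 + h2
  zero_mem' := by intro v _; simp
  smul_mem' := by
    intro c w hw v hv
    have h1 := hw v hv
    simp only [map_smul, smul_apply, smul_eq_mul]
    linear_combination c * h1

/-- The operator `𝓛_{ε,θ}` in `(X, d_θ)`, generated by `ε⁻² a_θ + b_θ` with form domain `H`. -/
def opL (S : Setting n H X) (ε : ℝ) (θ : S.Θ) : X →ₗ.[ℂ] X :=
  formOperator (S.d θ) S.J.toLinearMap (((ε ^ 2)⁻¹ : ℂ) • S.a θ + S.b θ).toSForm

/-- The closure of the collective spectrum of the operators `𝓛_{ε,θ}`, `θ ∈ Θ`. -/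
def collectiveSp (S : Setting n H X) (ε : ℝ) : Set ℂ := closure (⋃ θ : S.Θ, Sp (S.opL ε θ))

/-- The pointwise gap condition. -/
def GapCondition (S : Setting n H X) : Prop :=
  ∀ θ : S.Θ, ∃ ν : ℝ, 0 < ν ∧ ∀ w ∈ S.W θ, ν * S.nrm θ w ^ 2 ≤ (S.a θ w w).re

/-- The gap degenerates at most quadratically at `θ = 0`. -/
def QuadraticGap (S : Setting n H X) : Prop :=
  ∃ γ : ℝ, 0 < γ ∧ ∀ θ : S.Θ, ∀ w ∈ S.W θ,
    γ * ‖(θ : EuclideanSpace ℝ (Fin n))‖ ^ 2 * S.nrm θ w ^ 2 ≤ (S.a θ w w).re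

/-- `Θ` is connected, and `b_θ` is Lipschitz continuous at `θ = 0` on `V_0`. -/
def LipschitzB (S : Setting n H X) : Prop :=
  IsConnected S.Θ ∧ ∃ Lb : ℝ, 0 ≤ Lb ∧ ∀ θ : S.Θ, ∀ v ∈ S.V S.o, ∀ w ∈ S.V S.o,
    ‖S.b θ v w - S.b S.o v w‖ ≤
      Lb * ‖(θ : EuclideanSpace ℝ (Fin n))‖ * S.nrm S.o v * S.nrm θ w

/-- The limit space `V_⋆` and a defect subspace `Z`: closed subspaces of `H` with
`V_0 = V_⋆ ∔ Z`, the direct sum being transversal. -/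
structure Splitting (S : Setting n H X) where
  /-- the space `V_⋆` -/
  Vs : Submodule ℂ H
  /-- the defect subspace -/
  Z : Submodule ℂ H
  isClosed_Vs : IsClosed (Vs : Set H)
  isClosed_Z : IsClosed (Z : Set H)
  sup_eq : Vs ⊔ Z = S.V S.o
  disjoint : Disjoint Vs Z
  transversal : ∃ KZ : ℝ, 0 ≤ KZ ∧ KZ < 1 ∧ ∀ v ∈ Vs, ∀ z ∈ Z,
    ‖S.a S.o v z + S.b S.o v z‖ ≤ KZ * S.nrm S.o v * S.nrm S.o z

namespace Splitting

variable {S : Setting n H X} (P : S.Splitting)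

open Classical in
/-- `V^⋆_θ`, equal to `V_θ` for `θ ≠ 0` and to `V_⋆` for `θ = 0`. -/
def Vstar (P : S.Splitting) (θ : S.Θ) : Submodule ℂ H := if θ = S.o then P.Vs else S.V θ

/-- `V_θ` has a removable singularity at `θ = 0`: `V^⋆_θ` is Lipschitz continuous. -/
def RemovableSingularity (P : S.Splitting) : Prop :=
  ∃ Ls : ℝ, 0 ≤ Ls ∧ ∀ θ₁ θ₂ : S.Θ, ∀ v₁ ∈ P.Vstar θ₁,
    ⨅ v₂ : P.Vstar θ₂, S.nrm θ₂ (v₁ - v₂) ≤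
      Ls * ‖(θ₁ : EuclideanSpace ℝ (Fin n)) - θ₂‖ * S.nrm θ₁ v₁

/-- There are bijections `𝓔_θ : V_⋆ → V^⋆_θ` that carry `b_0` to `b_θ`, almost preserve the
coupling with `Z`, and extend to bijections of `X` that carry `d_0` to `d_θ`, depend Lipschitz
continuously on `θ` and equal the identity at `θ = 0`. -/
def TransferCondition (P : S.Splitting) : Prop :=
  ∃ (e : ∀ θ : S.Θ, P.Vs ≃ₗ[ℂ] P.Vstar θ) (E : S.Θ → X ≃ₗ[ℂ] X),
    (∀ (θ : S.Θ) (v w : P.Vs), S.b θ (e θ v) (e θ w) = S.b S.o v w) ∧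
    (∃ Kb : ℝ, 0 ≤ Kb ∧ ∀ θ : S.Θ, ∀ v : P.Vs, ∀ z ∈ P.Z,
      ‖S.b θ (e θ v) z - S.b S.o v z‖ ≤
        Kb * ‖(θ : EuclideanSpace ℝ (Fin n))‖ * S.nrm S.o v * S.nrm S.o z) ∧
    (∀ (θ : S.Θ) (v : P.Vs), E θ (S.J v) = S.J (e θ v)) ∧
    (∀ θ u w, S.d θ (E θ u) (E θ w) = S.d S.o u w) ∧
    (∀ u, E S.o u = u) ∧
    (∃ Ke : ℝ, 0 ≤ Ke ∧ ∀ (θ₁ θ₂ : S.Θ) (u : X),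
      √(S.d θ₁ (E θ₁ u - E θ₂ u) (E θ₁ u - E θ₂ u)).re ≤
        Ke * ‖(θ₁ : EuclideanSpace ℝ (Fin n)) - θ₂‖ * √(S.d S.o u u).re)

/-- The inclusion of `Z` in `V_0`. -/
def inclZ : P.Z →L[ℂ] S.V S.o :=
  P.Z.subtypeL.codRestrict (S.V S.o) fun z => P.sup_eq ▸ Submodule.mem_sup_right z.2

/-- The inclusion of `V_⋆` in `V_0`. -/
def inclVs : P.Vs →L[ℂ] S.V S.o :=
  P.Vs.subtypeL.codRestrict (S.V S.o) fun v => P.sup_eq ▸ Submodule.mem_sup_left v.2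

end Splitting

/-- The closure of the image in `X` of a subspace of `H`; a Hilbert space with inner product
`d_0`. -/
def clos (S : Setting n H X) (U : Submodule ℂ H) : Submodule ℂ X :=
  (U.map S.J.toLinearMap).topologicalClosure

/-- The embedding of a subspace of `H` in its closure in `X`. -/
def emb (S : Setting n H X) (U : Submodule ℂ H) : U →L[ℂ] S.clos U :=
  (S.J.comp U.subtypeL).codRestrict (S.clos U) fun u =>
    Submodule.le_topologicalClosure _ (Submodule.mem_map_of_mem u.2)

/-- The form `b_0` on a subspace of `H`. -/
def b0 (S : Setting n H X) (U : Submodule ℂ H) : BForm U :=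
  (S.b S.o).bilinearComp U.subtypeL U.subtypeL

/-- The operator generated in the closure `(Ū, d_0)` by `b_0` with form domain `U`. For `U = V_0`
this is `𝐁_0`, for `U = V_⋆` it is `𝐁_⋆`. -/
def opB (S : Setting n H X) (U : Submodule ℂ H) : S.clos U →ₗ.[ℂ] S.clos U :=
  formOperator (innerForm (S.clos U)) (S.emb U).toLinearMap (S.b0 U).toSForm

/-- `0` is an interior point of `Θ`, and `a_θ` has a first order expansion `a'_0` on
`V_0 × H` and a second order expansion `a''_0` on `V_0 × V_0` at `θ = 0`. -/
structure Expansion (S : Setting n H X) where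
  /-- the components of the vector-valued form `a'_0` -/
  a1 : Fin n → S.V S.o →L[ℂ] H →L⋆[ℂ] ℂ
  /-- the entries of the matrix-valued form `a''_0` -/
  a2 : Fin n → Fin n → BForm (S.V S.o)
  zero_mem_interior : (0 : EuclideanSpace ℝ (Fin n)) ∈ interior S.Θ
  first_order : ∃ K₁ : ℝ, 0 ≤ K₁ ∧ ∀ (θ : S.Θ) (v : S.V S.o) (u : H),
    ‖S.a θ v u - ∑ j, a1 j v u * ((θ : EuclideanSpace ℝ (Fin n)) j : ℂ)‖ ≤
      K₁ * ‖(θ : EuclideanSpace ℝ (Fin n))‖ ^ 2 * S.nrm S.o v * S.nrm S.o u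
  second_order : ∃ K₂ : ℝ, 0 ≤ K₂ ∧ ∀ (θ : S.Θ) (v w : S.V S.o),
    ‖S.a θ v w - ∑ j, ∑ k, a2 j k v w * ((θ : EuclideanSpace ℝ (Fin n)) j : ℂ) *
        ((θ : EuclideanSpace ℝ (Fin n)) k : ℂ)‖ ≤
      K₂ * ‖(θ : EuclideanSpace ℝ (Fin n))‖ ^ 3 * S.nrm S.o v * S.nrm S.o w

namespace Expansion

variable {S : Setting n H X} (A : S.Expansion) (P : S.Splitting)

open Classical in
/-- The solution operator `N^j : V_0 → W_0` of the linearised cell problem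
`a_0(N^j v, w) = -a'_{0,j}(v, w)` for all `w ∈ W_0`. (By the gap condition at `θ = 0` it exists and
is unique.) -/
def N (j : Fin n) : S.V S.o →L[ℂ] H :=
  if h : ∃ N : S.V S.o →L[ℂ] H, ∀ v, N v ∈ S.W S.o ∧
      ∀ w ∈ S.W S.o, S.a S.o (N v) w = -A.a1 j v w
  then h.choose else 0

/-- The coefficients `a^h_{jk}(v, w) = a''_{0,jk}(v, w) - a_0(N^j v, N^k w)` of the homogenised
form on `V_0`. -/
def ah (j k : Fin n) : BForm (S.V S.o) :=
  A.a2 j k - (S.a S.o).bilinearComp (A.N j) (A.N k)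

/-- The coefficients `a^h_{jk}` restricted to `Z`. -/
def ahZ (j k : Fin n) : BForm P.Z := (A.ah j k).bilinearComp P.inclZ P.inclZ

/-- The form `𝕊_ξ(v + z, v' + z') = a^h_ξ(z, z') + b_0(v + z, v' + z')` on `V_0 = V_⋆ ∔ Z`, written
on pairs `(v, z)`; here `a^h_ξ = ∑_{j,k} a^h_{jk} ξ_j ξ_k`. -/
def formS (ξ : EuclideanSpace ℝ (Fin n)) : BForm (P.Vs × P.Z) :=
  (∑ j, ∑ k, ((ξ j : ℂ) * (ξ k : ℂ)) • A.ahZ P j k).bilinearComp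
      (ContinuousLinearMap.snd ℂ P.Vs P.Z) (ContinuousLinearMap.snd ℂ P.Vs P.Z) +
    (S.b0 (S.V S.o)).bilinearComp (P.inclVs.coprod P.inclZ) (P.inclVs.coprod P.inclZ)

/-- The operator `𝕃_ξ` generated by `𝕊_ξ` in the closure of `V_0` with inner product `d_0`. -/
def opLxi (ξ : EuclideanSpace ℝ (Fin n)) : S.clos (S.V S.o) →ₗ.[ℂ] S.clos (S.V S.o) :=
  formOperator (innerForm (S.clos (S.V S.o)))
    ((S.emb (S.V S.o)).comp (P.inclVs.coprod P.inclZ)).toLinearMap (A.formS P ξ).toSForm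

end Expansion

namespace Splitting

variable {S : Setting n H X} (P : S.Splitting)

/-- Vector-valued `L²(ℝⁿ; Y)`. -/
abbrev L2 (n : ℕ) (Y : Type*) [NormedAddCommGroup Y] : Type _ :=
  Lp Y 2 (volume : Measure (EuclideanSpace ℝ (Fin n)))

/-- `Z`-valued `L²` functions as `H`-valued tempered distributions. -/
def distr [CompleteSpace H] : L2 n P.Z →ₗ[ℂ] 𝓢'(EuclideanSpace ℝ (Fin n), H) :=
  (Lp.toTemperedDistributionCLM H (volume : Measure (EuclideanSpace ℝ (Fin n))) 2).toLinearMap ∘ₗ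
    (P.Z.subtypeL.compLpL 2 volume).toLinearMap

/-- The form domain `H¹(ℝⁿ; Z) ∔ L²(ℝⁿ; V_⋆)`: triples `(u, ∇u, v)` with `u ∈ L²(ℝⁿ; Z)` having
the generalised derivatives `∂_j u = (∇u)_j ∈ L²(ℝⁿ; Z)` and with `v ∈ L²(ℝⁿ; V_⋆)`. (The second
entry is determined by the first.) The norm of `Z` and `V_⋆` inherited from `H` is that of `b_0`. -/
def bivariateDomain [CompleteSpace H] :
    Submodule ℂ (L2 n P.Z × (Fin n → L2 n P.Z) × L2 n P.Vs) where
  carrier := {p | ∀ j, ∂_{(EuclideanSpace.single j (1 : ℝ) : EuclideanSpace ℝ (Fin n))}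
    (P.distr p.1) = P.distr (p.2.1 j)}
  add_mem' := by
    intro p p' hp hp' j
    simp only [Prod.fst_add, Prod.snd_add, Pi.add_apply, map_add, LineDeriv.lineDerivOp_add, hp j,
      hp' j]
  zero_mem' := by
    intro j
    simp
  smul_mem' := by
    intro c p hp j
    simp only [Prod.smul_fst, Prod.smul_snd, Pi.smul_apply, map_smul, LineDeriv.lineDerivOp_smul,
      hp j]

/-- The function `u + v ∈ L²(ℝⁿ; V_0)` belonging to an element `(u, ∇u, v)` of the form domain. -/
def sumMap [CompleteSpace H] : P.bivariateDomain →ₗ[ℂ] L2 n (S.V S.o) :=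
  ((P.inclZ.compLpL 2 volume).toLinearMap ∘ₗ LinearMap.fst ℂ _ _ +
    (P.inclVs.compLpL 2 volume).toLinearMap ∘ₗ LinearMap.snd ℂ _ _ ∘ₗ LinearMap.snd ℂ _ _) ∘ₗ
    P.bivariateDomain.subtype

/-- The `j`-th component of `∇u`. -/
def gradMap [CompleteSpace H] (j : Fin n) : P.bivariateDomain →ₗ[ℂ] L2 n P.Z :=
  LinearMap.proj j ∘ₗ LinearMap.fst ℂ _ _ ∘ₗ LinearMap.snd ℂ _ _ ∘ₗ P.bivariateDomain.subtype

end Splitting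

namespace Expansion

variable {S : Setting n H X} (A : S.Expansion) (P : S.Splitting)

/-- The bivariate form `Q(u + v, u' + v') = ∫ ∑_{j,k} a^h_{jk}(∂_j u, ∂_k u') dx +
∫ b_0(u + v, u' + v') dx`. -/
def formQ [CompleteSpace H] : SForm P.bivariateDomain :=
  ∑ j, ∑ k, SForm.pull (l2Form (A.ahZ P j k)) (P.gradMap j) (P.gradMap k) +
    SForm.pull (l2Form (S.b0 (S.V S.o))) P.sumMap P.sumMap

/-- The bivariate operator `𝓛` generated by `Q` in `L²(ℝⁿ; (V̄_0, d_0))`. -/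
def bivariateOp [CompleteSpace H] :
    Splitting.L2 n (S.clos (S.V S.o)) →ₗ.[ℂ] Splitting.L2 n (S.clos (S.V S.o)) :=
  formOperator (innerForm _)
    (((S.emb (S.V S.o)).compLpL 2 volume).toLinearMap ∘ₗ P.sumMap) (A.formQ P)

end Expansion

namespace Splitting

variable {S : Setting n H X} (P : S.Splitting)

open Classical in
/-- `v_lam(z) = (lam - 1) (𝐁_⋆ - lam)⁻¹ 𝓟 z`: the solution `v ∈ V_⋆` of
`b_0(v, w) - lam d_0(v, w) = (lam - 1) d_0(z, w)` for all `w ∈ V_⋆`, which exists and is unique for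
`lam ∉ Sp 𝐁_⋆`. -/
def vLam (lam : ℝ) (z : P.Z) : H :=
  if h : ∃ v ∈ P.Vs, ∀ w ∈ P.Vs, S.b S.o v w - (lam : ℂ) * S.d S.o (S.J v) (S.J w) =
      ((lam : ℂ) - 1) * S.d S.o (S.J z) (S.J w)
  then h.choose else 0

/-- The form `β_lam(z, z') = -b_0(z, z') + lam d_0(z, z') + (lam - 1) d_0(v_lam(z), z')`. -/
def betaForm (lam : ℝ) (z z' : P.Z) : ℂ :=
  -S.b S.o z z' + (lam : ℂ) * S.d S.o (S.J z) (S.J z') +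
    ((lam : ℂ) - 1) * S.d S.o (S.J (P.vLam lam z)) (S.J z')

/-- The normalisation `b_0(z, v) = d_0(z, v)` of the choice of `Z`. -/
def Normalised : Prop :=
  ∀ z ∈ P.Z, ∀ v ∈ P.Vs, S.b S.o z v = S.d S.o (S.J z) (S.J v)

end Splitting

end Setting

end

noncomputable section

set_option linter.unusedSectionVars false

/-! ## Coercive forms, their solution operators and the spectrum of the generated operators -/

/-! Every operator is studied through its bounded inverse. A coercive Hermitian form generates an
operator whose inverse is bounded and self-adjoint (`BForm.mem_formGraph_iff`,
`BForm.isSelfAdjoint_inv`), and its spectrum consists of the reciprocals of the nonzero spectrum of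
that inverse (`sp_toLinearPMap_eq`). For a compactly embedded form domain the spectrum consists of
eigenvalues, and their counting function obeys the min-max principle (`BForm.le_specCount_iff`).

Fibres. The Fourier transform turns the inverse of the bivariate operator into multiplication by the
norm-continuous family of inverses of `𝕃_ξ`, so its spectrum is the closed union of the fibre
spectra (`FibreBound.sp_bivariateOp`). The homogenised form is the quadratic limit of `a_θ` on the
corrected vectors `z + N_θ z`. Its coercivity on `Z`, of order `|ξ|²`, is inherited from `a_θ`,
because near `θ = 0` the space `H` still splits along `V^⋆_θ`, `Z` and `W_0`, and the gap
degenerates at most quadratically (`exists_a_lower`, `exists_ahForm_lower`).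

Bands. The fibre form dominates `b_0` on `V_0` and equals it on `V_⋆`. Hence the counting function
of `𝕃_ξ` lies between those of `𝐁_⋆` and `𝐁_0`. It equals the latter at `ξ = 0`, and for large `ξ`
it is at most the former at a slightly higher level. In a gap it cannot change with `ξ`, by
continuity and connectedness. So a real number is in the spectrum iff the two counting functions are
separated there (`FibreBound.mem_sp_iff`), which is the band formula.

The form `β`. Off the spectrum of `𝐁_⋆` the form `b_0 - λ d_0` on `V_0` is block-diagonalised by
completing `z` to `v_λ(z) + z`, and `-β_λ` is the resulting Schur complement. The counts of `𝐁_⋆`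
and `𝐁_0` therefore differ iff `β_λ` is non-negative at some nonzero `z`
(`Splitting.count_lt_count_iff`).

Convergence. The transfer maps move all `𝓛_{ε,θ}` into one Hilbert space. There the inverse of
`𝓛_{ε,θ}` is within `O(ε)` of that of `𝕃_ξ` with `ξ = θ/ε`, uniformly in `θ`
(`FibreBound.exists_resolvent_estimate`). The solution `v + z` of the fibre problem yields the trial
vector `e_θ v + z + N_θ z` near `θ = 0`, and `e_θ v` away from it, where `z` is itself small; the
residual is measured in the energy norm. Conversely, every fibre inverse is near that of some
`𝓛_{ε,θ}` (`exists_fibre_near_opL`). Self-adjointness turns norm estimates into distances of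
spectra, and inversion contributes the factor growing like `b²`. -/

open InnerProductSpace in
/-- The operator `A` with `⟪w, A u⟫ = q u w`. -/
def BForm.repr {E : Type*} [NormedAddCommGroup E] [InnerProductSpace ℂ E] [CompleteSpace E]
    (q : BForm E) : E →L[ℂ] E :=
  ContinuousLinearMap.adjoint (continuousLinearMapOfBilin q.flip)

theorem BForm.inner_repr {E : Type*} [NormedAddCommGroup E] [InnerProductSpace ℂ E]
    [CompleteSpace E] (q : BForm E) (u w : E) : inner ℂ w (q.repr u) = q u w := by
  rw [BForm.repr, ContinuousLinearMap.adjoint_inner_right,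
    InnerProductSpace.continuousLinearMapOfBilin_apply]
  rfl

/-- Hermitian coercive forms. -/
structure BForm.IsCoerciveHermitian {E : Type*} [NormedAddCommGroup E] [NormedSpace ℂ E]
    (q : BForm E) : Prop where
  herm : ∀ u w, q u w = starRingEnd ℂ (q w u)
  coercive : ∃ c : ℝ, 0 < c ∧ ∀ u, c * ‖u‖ ^ 2 ≤ (q u u).re

theorem mem_formGraph {E Y : Type*} [AddCommGroup E] [Module ℂ E] [NormedAddCommGroup Y]
    [NormedSpace ℂ Y] {d : BForm Y} {j : E →ₗ[ℂ] Y} {q : SForm E} {p : Y × Y} :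
    p ∈ formGraph d j q ↔ ∃ e : E, j e = p.1 ∧ ∀ w : E, q e w = d p.2 (j w) := Iff.rfl

/-- The form `⟪j w, j u⟫` on `E`. -/
def pullInner {E Y : Type*} [NormedAddCommGroup E] [NormedSpace ℂ E]
    [NormedAddCommGroup Y] [InnerProductSpace ℂ Y] (j : E →L[ℂ] Y) : BForm E :=
  (innerForm Y).bilinearComp j j

theorem pullInner_apply {E Y : Type*} [NormedAddCommGroup E] [NormedSpace ℂ E]
    [NormedAddCommGroup Y] [InnerProductSpace ℂ Y] (j : E →L[ℂ] Y) (u w : E) :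
    pullInner j u w = inner ℂ (j w) (j u) := rfl

theorem pullInner_self {E Y : Type*} [NormedAddCommGroup E] [NormedSpace ℂ E]
    [NormedAddCommGroup Y] [InnerProductSpace ℂ Y] (j : E →L[ℂ] Y) (u : E) :
    pullInner j u u = ((‖j u‖ ^ 2 : ℝ) : ℂ) := by
  rw [pullInner_apply, inner_self_eq_norm_sq_to_K]
  simp

/-- The eigenspace `{e | q e w = lam k e w for all w}` of a pencil of forms. -/
def pencilEigenspace {E : Type*} [NormedAddCommGroup E] [NormedSpace ℂ E] (q k : BForm E)
    (lam : ℂ) : Submodule ℂ E where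
  carrier := {e | ∀ w, q e w = lam * k e w}
  add_mem' := by
    intro u v hu hv w
    simp only [map_add, add_apply, hu w, hv w]
    ring
  zero_mem' := by intro w; simp
  smul_mem' := by
    intro c u hu w
    simp only [map_smul, smul_apply, hu w, smul_eq_mul]
    ring

namespace BForm

variable {E Y : Type*} [NormedAddCommGroup E] [InnerProductSpace ℂ E] [CompleteSpace E]
  [NormedAddCommGroup Y] [InnerProductSpace ℂ Y] [CompleteSpace Y]

/-- The operator `g ↦ u` solving `q u w = ⟪j w, g⟫` for all `w`. -/
def sol (q : BForm E) (j : E →L[ℂ] Y) : Y →L[ℂ] E :=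
  Ring.inverse q.repr ∘L ContinuousLinearMap.adjoint j

/-- The bounded inverse `j ∘ sol` of the operator generated by the form. -/
def inv (q : BForm E) (j : E →L[ℂ] Y) : Y →L[ℂ] Y := j ∘L q.sol j

variable {q : BForm E} (hq : q.IsCoerciveHermitian) (j : E →L[ℂ] Y)
include hq

/-- Lax–Milgram: coercivity keeps the quadratic form of `q.repr` away from zero, which forces
invertibility. -/
theorem isUnit_repr : IsUnit q.repr := by
  obtain ⟨c, hc, h⟩ := hq.coercive
  refine ContinuousLinearMap.isUnit_of_forall_le_norm_inner_map q.repr (c := ⟨c, hc.le⟩) hc ?_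
  intro x
  have h1 : c * ‖x‖ ^ 2 ≤ ‖q x x‖ := (h x).trans (Complex.re_le_norm _)
  rw [← q.inner_repr, norm_inner_symm] at h1
  rw [mul_comm]
  exact h1

theorem im_self (u : E) : (q u u).im = 0 := by
  have := hq.herm u u
  exact Complex.conj_eq_iff_im.1 this.symm

theorem self_eq_re (u : E) : q u u = ((q u u).re : ℂ) := by
  apply Complex.ext <;> simp [im_self hq]

theorem sol_spec (g : Y) (w : E) : q (q.sol j g) w = inner ℂ (j w) g := by
  have h1 : q.repr (q.sol j g) = ContinuousLinearMap.adjoint j g := by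
    have := Ring.mul_inverse_cancel _ (isUnit_repr hq)
    calc q.repr (q.sol j g)
        = (q.repr * Ring.inverse q.repr) (ContinuousLinearMap.adjoint j g) := rfl
      _ = _ := by rw [this]; rfl
  rw [← q.inner_repr, h1, ContinuousLinearMap.adjoint_inner_right]

theorem eq_zero_of_forall {u : E} (h : ∀ w, q u w = 0) : u = 0 := by
  obtain ⟨c, hc, hcu⟩ := hq.coercive
  have h1 := hcu u
  rw [h u] at h1
  simp only [Complex.zero_re] at h1
  have h2 : ‖u‖ ^ 2 ≤ 0 := by
    by_contra! h3
    nlinarith [mul_pos hc h3]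
  have h3 : ‖u‖ = 0 := by nlinarith [norm_nonneg u]
  simpa using h3

theorem eq_sol_iff (u : E) (g : Y) : u = q.sol j g ↔ ∀ w, q u w = inner ℂ (j w) g := by
  constructor
  · rintro rfl w
    exact sol_spec hq j g w
  · intro h
    rw [← sub_eq_zero]
    refine eq_zero_of_forall hq fun w => ?_
    simp [h w, sol_spec hq j g w]

/-- By unique solvability, the graph of the generated operator is the graph of the bounded operator
`q.inv j` with its entries exchanged. -/
theorem mem_formGraph_iff (p : Y × Y) :
    p ∈ formGraph (innerForm Y) j.toLinearMap q.toSForm ↔ p.1 = q.inv j p.2 := by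
  rw [mem_formGraph]
  constructor
  · rintro ⟨e, he, h⟩
    have : e = q.sol j p.2 := (eq_sol_iff hq j _ _).2 h
    rw [← he, this]
    rfl
  · intro h
    exact ⟨q.sol j p.2, h.symm, fun w => sol_spec hq j _ w⟩

/-- The energy identity: test the equation of one solution with the other. Symmetry and injectivity
of the inverse both rest on it. -/
theorem inner_inv (g h : Y) : inner ℂ g (q.inv j h) = q (q.sol j h) (q.sol j g) := by
  have h1 := sol_spec hq j g (q.sol j h)
  rw [hq.herm, h1, inner_conj_symm]
  rfl

theorem isSelfAdjoint_inv : IsSelfAdjoint (q.inv j) := by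
  rw [ContinuousLinearMap.isSelfAdjoint_iff_isSymmetric]
  intro x y
  change inner ℂ (q.inv j x) y = inner ℂ x (q.inv j y)
  rw [inner_inv hq, ← inner_conj_symm, inner_inv hq, ← hq.herm]

/-- A datum in the kernel has a solution of zero energy, hence a zero solution, so it is orthogonal
to the dense range of `j`. -/
theorem inv_injective (hd : DenseRange j) : Function.Injective (q.inv j) := by
  rw [injective_iff_map_eq_zero]
  intro g hg
  have h1 : q.sol j g = 0 := by
    obtain ⟨c, hc, hcu⟩ := hq.coercive
    have h2 := inner_inv hq j g g
    rw [hg, inner_zero_right] at h2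
    have h3 := hcu (q.sol j g)
    rw [← h2, Complex.zero_re] at h3
    have h4 : ‖q.sol j g‖ ^ 2 ≤ 0 := by
      by_contra! h5
      nlinarith [mul_pos hc h5]
    have h5 : ‖q.sol j g‖ = 0 := by nlinarith [norm_nonneg (q.sol j g)]
    simpa using h5
  have h2 : ∀ y : Y, inner ℂ y g = 0 := by
    intro y
    refine hd.induction_on (p := fun y => inner ℂ y g = 0) y ?_ ?_
    · exact isClosed_eq (by fun_prop) continuous_const
    · intro w
      rw [← sol_spec hq j g w, h1]
      simp
  exact inner_self_eq_zero.1 (h2 g)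

end BForm

/-- The spectrum of an operator whose graph is the inverse graph of a bounded injective operator. -/
theorem sp_toLinearPMap_eq {Y : Type*} [NormedAddCommGroup Y] [NormedSpace ℂ Y]
    {G : Submodule ℂ (Y × Y)} {T : Y →L[ℂ] Y} (hG : ∀ p, p ∈ G ↔ p.1 = T p.2)
    (hT : Function.Injective T) :
    Sp G.toLinearPMap = {lam : ℂ | lam ≠ 0 ∧ lam⁻¹ ∈ spectrum ℂ T} := by
  have hval : ∀ p ∈ G, p.1 = 0 → p.2 = 0 := by
    intro p hp h0
    rw [hG, h0] at hp
    exact hT (by rw [← hp, map_zero])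
  have hdom : ∀ u, u ∈ G.toLinearPMap.domain ↔ ∃ g, u = T g := by
    intro u
    rw [Submodule.toLinearPMap_domain, Submodule.mem_map]
    constructor
    · rintro ⟨p, hp, rfl⟩
      exact ⟨p.2, (hG p).1 hp⟩
    · rintro ⟨g, hg⟩
      exact ⟨(u, g), (hG _).2 hg, rfl⟩
  have happ : ∀ (u : G.toLinearPMap.domain), (u : Y) = T (G.toLinearPMap u) := by
    intro u
    have h1 : ((u : Y), G.toLinearPMap u) ∈ G.toLinearPMap.graph := LinearPMap.mem_graph _ u
    rw [Submodule.toLinearPMap_graph_eq G hval] at h1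
    exact (hG _).1 h1
  have happ' : ∀ (g : Y) (h : T g ∈ G.toLinearPMap.domain), G.toLinearPMap ⟨T g, h⟩ = g := by
    intro g h
    exact (hT (happ ⟨T g, h⟩)).symm
  have hunit : ∀ lam : ℂ, lam ≠ 0 → (lam ∈ resolventSetOf G.toLinearPMap ↔
      IsUnit (1 - lam • T)) := by
    intro lam _
    constructor
    · rintro ⟨R, hR1, hR2⟩
      have hTB : ∀ g, T (g + lam • R g) = R g := by
        intro g
        obtain ⟨h, h'⟩ := hR1 g
        have h2 := happ ⟨R g, h⟩
        rw [sub_eq_iff_eq_add] at h'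
        rw [h'] at h2
        exact h2.symm
      -- If `R` is the resolvent of the inverse of `T` at `lam`, then formally `1 + lam R = T⁻¹ R =
      -- (1 - lam T)⁻¹`. Conversely, `T (1 - lam T)⁻¹` is the resolvent.
      have e1 : (1 - lam • T) * (1 + lam • R) = 1 := by
        ext g
        change (g + lam • R g) - lam • T (g + lam • R g) = g
        rw [hTB g]
        abel
      have e2 : (1 + lam • R) * (1 - lam • T) = 1 := by
        ext g
        have h3 : T g ∈ G.toLinearPMap.domain := (hdom _).2 ⟨g, rfl⟩
        have h2 : R (g - lam • T g) = T g := by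
          have := hR2 ⟨T g, h3⟩
          rwa [happ'] at this
        change (g - lam • T g) + lam • R (g - lam • T g) = g
        rw [h2]
        abel
      exact ⟨⟨_, _, e1, e2⟩, rfl⟩
    · rintro ⟨⟨A, B, e1, e2⟩, rfl : A = _⟩
      refine ⟨T * B, fun g => ?_, fun u => ?_⟩
      · have h3 : T (B g) ∈ G.toLinearPMap.domain := (hdom _).2 ⟨B g, rfl⟩
        refine ⟨h3, ?_⟩
        have h5 : B g - lam • T (B g) = g := DFunLike.congr_fun e1 g
        change G.toLinearPMap ⟨T (B g), h3⟩ - lam • T (B g) = g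
        rw [happ' (B g) h3, h5]
      · have h4 := happ u
        have h5 : B (G.toLinearPMap u - lam • T (G.toLinearPMap u)) = G.toLinearPMap u :=
          DFunLike.congr_fun e2 (G.toLinearPMap u)
        change T (B (G.toLinearPMap u - lam • (u : Y))) = u
        rw [← h4] at h5
        rw [h5, ← h4]
  ext lam
  by_cases h0 : lam = 0
  · subst h0
    simp only [mem_ofPred_eq, ne_eq, not_true_eq_false, false_and, iff_false]
    rw [Sp, notMem_compl_iff]
    -- Zero always belongs to the resolvent set, with resolvent `T` itself.
    refine ⟨T, fun g => ⟨(hdom _).2 ⟨g, rfl⟩, ?_⟩, fun u => ?_⟩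
    · rw [happ']
      simp
    · rw [zero_smul, sub_zero, ← happ]
  · rw [Sp, mem_compl_iff, hunit lam h0, mem_ofPred_eq, spectrum.mem_iff]
    have h1 : algebraMap ℂ (Y →L[ℂ] Y) lam⁻¹ - T = (Units.mk0 lam h0)⁻¹ • (1 - lam • T) := by
      ext g
      simp only [Units.smul_def, Units.val_inv_eq_inv_val, Units.val_mk0, smul_sub, smul_smul,
        inv_mul_cancel₀ h0, one_smul, Algebra.algebraMap_eq_smul_one]
    rw [h1, isUnit_smul_iff]
    simp [h0]

/-! ## Resolvents of self-adjoint operators -/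

section Resolvent

variable {Y : Type*} [NormedAddCommGroup Y] [InnerProductSpace ℂ Y] [CompleteSpace Y]

/-- The resolvent of a self-adjoint operator at distance at least `δ` from the spectrum. -/
theorem IsSelfAdjoint.exists_resolvent_norm_le {B : Y →L[ℂ] Y} (hB : IsSelfAdjoint B) {δ : ℝ}
    (hδ : 0 < δ) {μ : ℂ} (h : ∀ ν ∈ spectrum ℂ B, δ ≤ ‖ν - μ‖) :
    ∃ R : Y →L[ℂ] Y, ‖R‖ ≤ δ⁻¹ ∧ R * (B - algebraMap ℂ _ μ) = 1 ∧
      (B - algebraMap ℂ _ μ) * R = 1 := by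
  have hn : IsStarNormal B := hB.isStarNormal
  have hne : ∀ ν ∈ spectrum ℂ B, ν - μ ≠ 0 := fun ν hν h0 => by
    have := h ν hν
    rw [h0, norm_zero] at this
    linarith
  have hc : ContinuousOn (fun ν : ℂ => (ν - μ)⁻¹) (spectrum ℂ B) :=
    ContinuousOn.inv₀ (by fun_prop) hne
  have hBμ : cfc (fun ν : ℂ => ν - μ) B = B - algebraMap ℂ _ μ := by
    rw [cfc_sub (fun ν : ℂ => ν) (fun _ => μ) B, cfc_id' ℂ B, cfc_const μ B]
  refine ⟨cfc (fun ν : ℂ => (ν - μ)⁻¹) B, ?_, ?_, ?_⟩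
  · refine norm_cfc_le (by positivity) fun ν hν => ?_
    rw [norm_inv]
    exact inv_anti₀ hδ (h ν hν)
  · rw [← hBμ, ← cfc_mul _ _ B hc, ← cfc_const_one ℂ B]
    exact cfc_congr fun ν hν => inv_mul_cancel₀ (hne ν hν)
  · rw [← hBμ, ← cfc_mul _ _ B (by fun_prop) hc, ← cfc_const_one ℂ B]
    exact cfc_congr fun ν hν => mul_inv_cancel₀ (hne ν hν)

theorem IsSelfAdjoint.mul_norm_le_of_dist_spectrum {B : Y →L[ℂ] Y} (hB : IsSelfAdjoint B) {δ : ℝ}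
    (hδ : 0 < δ) {μ : ℂ} (h : ∀ ν ∈ spectrum ℂ B, δ ≤ ‖ν - μ‖) (x : Y) :
    δ * ‖x‖ ≤ ‖B x - μ • x‖ := by
  obtain ⟨R, hR, h1, -⟩ := hB.exists_resolvent_norm_le hδ h
  have h2 : R (B x - μ • x) = x := by
    have := DFunLike.congr_fun h1 x
    simpa [Algebra.algebraMap_eq_smul_one] using this
  have h3 := R.le_of_opNorm_le hR (B x - μ • x)
  rw [h2] at h3
  calc δ * ‖x‖ ≤ δ * (δ⁻¹ * ‖B x - μ • x‖) := by gcongr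
    _ = _ := by field_simp

/-- An approximate eigenvector forces a point of the spectrum nearby. -/
theorem IsSelfAdjoint.exists_mem_spectrum_of_norm_le {B : Y →L[ℂ] Y} (hB : IsSelfAdjoint B) {δ : ℝ}
    {μ : ℂ} {x : Y} (hx : x ≠ 0) (h : ‖B x - μ • x‖ ≤ δ * ‖x‖) :
    ∃ ν ∈ spectrum ℂ B, ‖ν - μ‖ ≤ δ := by
  by_contra! hcon
  have hδ0 : 0 ≤ δ := by
    by_contra! h0
    have h1 := norm_nonneg (B x - μ • x)
    have h2 := norm_pos_iff.2 hx
    nlinarith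
  have : Nontrivial Y := ⟨x, 0, hx⟩
  -- Compactness of the spectrum gives a nearest point, whose distance strictly exceeds `δ`; the
  -- strictness also covers `δ = 0`.
  obtain ⟨ν₀, hν₀, hmin⟩ := (spectrum.isCompact B (𝕜 := ℂ)).exists_isMinOn
    (spectrum.nonempty B) (f := fun ν => ‖ν - μ‖) (by fun_prop)
  have h1 := hcon ν₀ hν₀
  have h2 := hB.mul_norm_le_of_dist_spectrum (δ := ‖ν₀ - μ‖) (lt_of_le_of_lt hδ0 h1)
    (fun ν hν => hmin hν) x
  have h3 := norm_pos_iff.2 hx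
  nlinarith

end Resolvent

/-! ## Eigenvalues of a compact pencil -/

/-- The span of the eigenspaces with eigenvalue at most `r`. -/
def pencilSpan {E : Type*} [NormedAddCommGroup E] [NormedSpace ℂ E] (q k : BForm E) (r : ℝ) :
    Submodule ℂ E := ⨆ s ∈ Set.Iic r, pencilEigenspace q k (s : ℂ)

/-- The number of eigenvalues not exceeding `r`. -/
def specCount {E : Type*} [NormedAddCommGroup E] [NormedSpace ℂ E] (q k : BForm E) (r : ℝ) : ℕ :=
  Module.finrank ℂ (pencilSpan q k r)

theorem pencilSpan_mono {E : Type*} [NormedAddCommGroup E] [NormedSpace ℂ E] (q k : BForm E)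
    {r s : ℝ} (h : r ≤ s) : pencilSpan q k r ≤ pencilSpan q k s :=
  biSup_mono fun _ ht => le_trans ht h

theorem pencilEigenspace_le_pencilSpan {E : Type*} [NormedAddCommGroup E] [NormedSpace ℂ E]
    (q k : BForm E) {r s : ℝ} (h : s ≤ r) : pencilEigenspace q k (s : ℂ) ≤ pencilSpan q k r :=
  le_biSup (fun s : ℝ => pencilEigenspace q k (s : ℂ)) h

theorem pencilSpan_eq_of_forall {E : Type*} [NormedAddCommGroup E] [NormedSpace ℂ E]
    (q k : BForm E) {r s : ℝ} (h : r ≤ s)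
    (hn : ∀ t ∈ Set.Ioc r s, pencilEigenspace q k (t : ℂ) = ⊥) :
    pencilSpan q k s = pencilSpan q k r := by
  refine le_antisymm (iSup₂_le fun t ht => ?_) (pencilSpan_mono q k h)
  rcases le_or_gt t r with h1 | h1
  · exact pencilEigenspace_le_pencilSpan q k h1
  · rw [hn t ⟨h1, ht⟩]
    exact bot_le

/-- Eigenspaces of the operator belonging to a graph. -/
theorem mem_eigenspaceOf_toLinearPMap {Y : Type*} [NormedAddCommGroup Y] [NormedSpace ℂ Y]
    {G : Submodule ℂ (Y × Y)} (hG : ∀ p ∈ G, p.1 = 0 → p.2 = 0) {lam : ℂ} {x : Y} :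
    x ∈ eigenspaceOf G.toLinearPMap lam ↔ (x, lam • x) ∈ G := by
  rw [eigenspaceOf, Submodule.mem_map]
  conv_rhs => rw [← Submodule.toLinearPMap_graph_eq G hG]
  rw [LinearPMap.mem_graph_iff]
  constructor
  · rintro ⟨u, hu, rfl⟩
    rw [LinearMap.mem_ker, LinearMap.sub_apply, sub_eq_zero] at hu
    exact ⟨u, rfl, hu⟩
  · rintro ⟨u, rfl, hu⟩
    refine ⟨u, ?_, rfl⟩
    rw [LinearMap.mem_ker, LinearMap.sub_apply, sub_eq_zero]
    exact hu

namespace BForm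

variable {E Y : Type*} [NormedAddCommGroup E] [InnerProductSpace ℂ E] [CompleteSpace E]
  [NormedAddCommGroup Y] [InnerProductSpace ℂ Y] [CompleteSpace Y]

variable {q : BForm E} (hq : q.IsCoerciveHermitian) {j : E →L[ℂ] Y}
include hq

theorem eq_zero_of_re_le {u : E} (h : (q u u).re ≤ 0) : u = 0 := by
  obtain ⟨c, hc, hcu⟩ := hq.coercive
  have h1 := hcu u
  have h2 : ‖u‖ ^ 2 ≤ 0 := by
    by_contra! h3
    nlinarith [mul_pos hc h3]
  have h3 : ‖u‖ = 0 := by nlinarith [norm_nonneg u]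
  simpa using h3

/-- An eigenvector `y` of the inverse lies in the range of `j`, and `lam • q.sol j y` is its
preimage in the form domain. Eigenvectors thus pass between `Y` and `E`. -/
theorem inv_apply_eq_smul_iff {lam : ℂ} (h0 : lam ≠ 0) (y : Y) :
    q.inv j y = lam⁻¹ • y ↔ ∃ e ∈ pencilEigenspace q (pullInner j) lam, j e = y := by
  constructor
  · intro h
    refine ⟨lam • q.sol j y, fun w => ?_, ?_⟩
    · have h1 : j (lam • q.sol j y) = y := by
        rw [map_smul]
        change lam • q.inv j y = y
        rw [h, smul_smul, mul_inv_cancel₀ h0, one_smul]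
      rw [pullInner_apply, h1, map_smul, smul_apply, sol_spec hq, smul_eq_mul]
    · rw [map_smul]
      change lam • q.inv j y = y
      rw [h, smul_smul, mul_inv_cancel₀ h0, one_smul]
  · rintro ⟨e, he, rfl⟩
    have h1 : lam⁻¹ • e = q.sol j (j e) := by
      rw [eq_sol_iff hq]
      intro w
      rw [map_smul, smul_apply, he w, pullInner_apply, smul_eq_mul, ← mul_assoc,
        inv_mul_cancel₀ h0, one_mul]
    change j (q.sol j (j e)) = _
    rw [← h1, map_smul]

/-- Testing the eigenvalue equation with `e` shows that `lam` is the Rayleigh quotient of `e`, whose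
numerator is positive. -/
theorem exists_pos_of_mem_pencilEigenspace {lam : ℂ} {e : E} (he0 : e ≠ 0)
    (he : e ∈ pencilEigenspace q (pullInner j) lam) : j e ≠ 0 ∧ ∃ r : ℝ, 0 < r ∧ lam = r := by
  have h1 : 0 < (q e e).re := by
    by_contra! h
    exact he0 (eq_zero_of_re_le hq h)
  have h2 := he e
  rw [pullInner_self, self_eq_re hq] at h2
  have h3 : j e ≠ 0 := by
    intro h
    rw [h] at h2
    simp at h2
    rw [h2] at h1
    exact lt_irrefl _ h1
  have h4 : 0 < ‖j e‖ ^ 2 := by positivity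
  refine ⟨h3, (q e e).re / ‖j e‖ ^ 2, by positivity, ?_⟩
  push_cast
  push_cast at h2
  have h5 : ((‖j e‖ : ℂ)) ^ 2 ≠ 0 := by exact_mod_cast h4.ne'
  rw [eq_div_iff h5, h2]

theorem pencilEigenspace_zero : pencilEigenspace q (pullInner j) 0 = ⊥ := by
  rw [Submodule.eq_bot_iff]
  intro e he
  by_contra h
  obtain ⟨-, r, hr, hr'⟩ := exists_pos_of_mem_pencilEigenspace hq h he
  exact hr.ne (by exact_mod_cast hr')

theorem inv_isCompactOperator (hc : IsCompactOperator j) : IsCompactOperator (q.inv j) :=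
  hc.comp_clm (q.sol j)

/-- The inverse factors through the compact `j`, so by the Fredholm alternative its nonzero spectrum
consists of eigenvalues. -/
theorem mem_spectrum_inv_iff (hc : IsCompactOperator j) {lam : ℂ} (h0 : lam ≠ 0) :
    lam⁻¹ ∈ spectrum ℂ (q.inv j) ↔ pencilEigenspace q (pullInner j) lam ≠ ⊥ := by
  rw [← (inv_isCompactOperator hq hc).hasEigenvalue_iff_mem_spectrum (inv_ne_zero h0)]
  constructor
  · intro h
    obtain ⟨y, hy⟩ := h.exists_hasEigenvector
    obtain ⟨e, he, hey⟩ := (inv_apply_eq_smul_iff hq h0 y).1 hy.apply_eq_smul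
    intro hbot
    rw [hbot, Submodule.mem_bot] at he
    rw [he, map_zero] at hey
    exact hy.2 hey.symm
  · intro h
    obtain ⟨e, he, he0⟩ := Submodule.exists_mem_ne_zero_of_ne_bot h
    obtain ⟨hje, -⟩ := exists_pos_of_mem_pencilEigenspace hq he0 he
    refine Module.End.hasEigenvalue_of_hasEigenvector (x := j e)
      ⟨Module.End.mem_eigenspace_iff.2 ?_, hje⟩
    exact (inv_apply_eq_smul_iff hq h0 (j e)).2 ⟨e, he, rfl⟩

theorem mem_sp_iff (hc : IsCompactOperator j) (hd : DenseRange j) {lam : ℂ} :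
    lam ∈ Sp (formOperator (innerForm Y) j.toLinearMap q.toSForm) ↔
      pencilEigenspace q (pullInner j) lam ≠ ⊥ := by
  rw [formOperator, sp_toLinearPMap_eq (mem_formGraph_iff hq j) (inv_injective hq j hd)]
  constructor
  · rintro ⟨h0, h⟩
    exact (mem_spectrum_inv_iff hq hc h0).1 h
  · intro h
    have h0 : lam ≠ 0 := by
      rintro rfl
      exact h (pencilEigenspace_zero hq)
    exact ⟨h0, (mem_spectrum_inv_iff hq hc h0).2 h⟩

theorem eigenspaceOf_formOperator (hd : DenseRange j) (lam : ℂ) :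
    eigenspaceOf (formOperator (innerForm Y) j.toLinearMap q.toSForm) lam =
      (pencilEigenspace q (pullInner j) lam).map j.toLinearMap := by
  ext x
  rw [formOperator, mem_eigenspaceOf_toLinearPMap, mem_formGraph, Submodule.mem_map]
  · constructor
    · rintro ⟨e, rfl, he⟩
      refine ⟨e, fun w => ?_, rfl⟩
      have := he w
      rw [map_smul] at this
      exact this
    · rintro ⟨e, he, rfl⟩
      refine ⟨e, rfl, fun w => ?_⟩
      have := he w
      rw [map_smul]
      exact this
  · intro p hp h0
    rw [mem_formGraph_iff hq, h0] at hp
    exact inv_injective hq j hd (by rw [← hp, map_zero])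

/-- Evaluating `q u v` through either eigenvalue equation gives `(t - s) ⟪j v, j u⟫ = 0`. -/
theorem pullInner_eq_zero_of_ne {s t : ℝ} (hst : s ≠ t) {u v : E}
    (hu : u ∈ pencilEigenspace q (pullInner j) (s : ℂ))
    (hv : v ∈ pencilEigenspace q (pullInner j) (t : ℂ)) : pullInner j u v = 0 := by
  have h1 := hu v
  have h2 := hv u
  have h3 : pullInner j u v = starRingEnd ℂ (pullInner j v u) := by
    rw [pullInner_apply, pullInner_apply, inner_conj_symm]
  rw [hq.herm, h2, map_mul, ← h3, Complex.conj_ofReal] at h1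
  have h4 : ((t : ℂ) - s) * pullInner j u v = 0 := by linear_combination h1
  rcases mul_eq_zero.1 h4 with h5 | h5
  · exact absurd (by exact_mod_cast (sub_eq_zero.1 h5).symm) hst
  · exact h5

/-- On the span of the eigenspaces up to `r` the quotient of the forms is at most `r`. -/
theorem re_le_of_mem_pencilSpan {r : ℝ} {e : E} (he : e ∈ pencilSpan q (pullInner j) r) :
    (q e e).re ≤ r * ‖j e‖ ^ 2 := by
  rw [pencilSpan, iSup_subtype', Submodule.mem_iSup_iff_exists_finsupp] at he
  obtain ⟨f, hf, rfl⟩ := he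
  have hk : ∀ s ∈ f.support, ∀ t ∈ f.support, t ≠ s → pullInner j (f s) (f t) = 0 :=
    fun s _ t _ hst => pullInner_eq_zero_of_ne hq (fun h => hst (Subtype.ext h.symm)) (hf s) (hf t)
  -- Different eigenspaces are orthogonal for both forms, so on a finite sum of eigenvectors both
  -- quadratic forms are diagonal.
  have h1 : q (f.sum fun _ x => x) (f.sum fun _ x => x) =
      ∑ s ∈ f.support, ((s : ℝ) : ℂ) * pullInner j (f s) (f s) := by
    simp only [Finsupp.sum, map_sum, sum_apply]
    rw [Finset.sum_comm]
    refine Finset.sum_congr rfl fun s hs => ?_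
    rw [Finset.sum_eq_single s]
    · exact hf s _
    · intro t ht hts
      rw [hf s, hk s hs t ht hts, mul_zero]
    · exact fun h => absurd hs h
  have h2 : ((‖j (f.sum fun _ x => x)‖ ^ 2 : ℝ) : ℂ) =
      ∑ s ∈ f.support, pullInner j (f s) (f s) := by
    rw [← pullInner_self]
    simp only [Finsupp.sum, map_sum, sum_apply]
    rw [Finset.sum_comm]
    refine Finset.sum_congr rfl fun s hs => ?_
    rw [Finset.sum_eq_single s]
    · intro t ht hts
      exact hk s hs t ht hts
    · exact fun h => absurd hs h
  have h2' : ‖j (f.sum fun _ x => x)‖ ^ 2 = ∑ s ∈ f.support, ‖j (f s)‖ ^ 2 := by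
    simp only [pullInner_self] at h2
    exact_mod_cast h2
  rw [h1, h2', Complex.re_sum, Finset.mul_sum]
  refine Finset.sum_le_sum fun s _ => ?_
  rw [pullInner_self, ← Complex.ofReal_mul, Complex.ofReal_re]
  exact mul_le_mul_of_nonneg_right s.2 (by positivity)

theorem eq_zero_of_mem_pencilSpan {r s : ℝ} (hrs : r < s) {e : E}
    (he : e ∈ pencilSpan q (pullInner j) r)
    (he' : e ∈ pencilEigenspace q (pullInner j) (s : ℂ)) : e = 0 := by
  by_contra h0
  have h1 := re_le_of_mem_pencilSpan hq he
  obtain ⟨h2, -⟩ := exists_pos_of_mem_pencilEigenspace hq h0 he'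
  rw [he' e, pullInner_self, ← Complex.ofReal_mul, Complex.ofReal_re] at h1
  have h3 : 0 < ‖j e‖ ^ 2 := by positivity
  nlinarith

/-- The Rayleigh bound controls the norm of `E` by that of `Y` on the closure of the span. There `j`
is a closed embedding as well as compact, so the identity is compact. -/
theorem finiteDimensional_pencilSpan (hc : IsCompactOperator j) (r : ℝ) :
    FiniteDimensional ℂ (pencilSpan q (pullInner j) r) := by
  obtain ⟨c, hc0, hcu⟩ := hq.coercive
  set M := (pencilSpan q (pullInner j) r).topologicalClosure
  have hM : IsClosed (M : Set E) := Submodule.isClosed_topologicalClosure _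
  have : CompleteSpace M := hM.completeSpace_coe
  have hbound : ∀ e ∈ M, c * ‖e‖ ^ 2 ≤ (|r| + 1) * ‖j e‖ ^ 2 := by
    intro e he
    have hcl : IsClosed {e : E | c * ‖e‖ ^ 2 ≤ (|r| + 1) * ‖j e‖ ^ 2} :=
      isClosed_le (by fun_prop) (by fun_prop)
    refine closure_minimal (fun x hx => ?_) hcl he
    have h1 := re_le_of_mem_pencilSpan hq hx
    have h2 := hcu x
    have h3 : r ≤ |r| + 1 := by linarith [le_abs_self r]
    have h4 : r * ‖j x‖ ^ 2 ≤ (|r| + 1) * ‖j x‖ ^ 2 := by gcongr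
    exact h2.trans (h1.trans h4)
  let jM : M →L[ℂ] Y := j.comp M.subtypeL
  have hanti : ∃ K, AntilipschitzWith K jM := by
    refine ⟨⟨√((|r| + 1) / c), Real.sqrt_nonneg _⟩,
      ContinuousLinearMap.antilipschitz_of_bound _ fun e => ?_⟩
    have h1 := hbound e e.2
    have h2 : ‖(e : E)‖ ^ 2 ≤ (|r| + 1) / c * ‖j e‖ ^ 2 := by
      rw [div_mul_eq_mul_div, le_div_iff₀ hc0]
      linarith
    have h3 : (0:ℝ) ≤ (|r| + 1) / c := by positivity
    change ‖(e : E)‖ ≤ √((|r| + 1) / c) * ‖j e‖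
    rw [← Real.sqrt_sq (norm_nonneg (e : E)), ← Real.sqrt_sq (norm_nonneg (j e)),
      ← Real.sqrt_mul h3]
    exact Real.sqrt_le_sqrt h2
  obtain ⟨K, hK⟩ := hanti
  have hemb := hK.isClosedEmbedding jM.uniformContinuous
  have hid : IsCompactOperator (_root_.id : M → M) := by
    obtain ⟨S, hS, hS'⟩ := hc
    refine ⟨jM ⁻¹' S, hemb.isCompact_preimage hS, ?_⟩
    have : Filter.Tendsto (fun e : M => (e : E)) (𝓝 0) (𝓝 0) :=
      (continuous_subtype_val (p := fun x => x ∈ M)).tendsto 0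
    exact this hS'
  have hfin : FiniteDimensional ℂ M := FiniteDimensional.of_isCompactOperator_id hid
  exact Submodule.finiteDimensional_of_le (Submodule.le_topologicalClosure _)

/-- Invariance of the low eigenspaces makes their orthogonal complement invariant under the
self-adjoint inverse. -/
theorem inv_mem_map_pencilSpan (r : ℝ) {y : Y}
    (hy : y ∈ (pencilSpan q (pullInner j) r).map j.toLinearMap) :
    q.inv j y ∈ (pencilSpan q (pullInner j) r).map j.toLinearMap := by
  have h : (pencilSpan q (pullInner j) r).map j.toLinearMap ≤
      ((pencilSpan q (pullInner j) r).map j.toLinearMap).comap (q.inv j).toLinearMap := by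
    rw [Submodule.map_le_iff_le_comap]
    refine iSup₂_le fun s hs e he => ?_
    rcases eq_or_ne (s : ℂ) 0 with h0 | h0
    · rw [h0, pencilEigenspace_zero hq, Submodule.mem_bot] at he
      rw [he]
      exact zero_mem _
    · have h1 := (inv_apply_eq_smul_iff hq h0 (j e)).2 ⟨e, he, rfl⟩
      rw [Submodule.mem_comap, Submodule.mem_comap]
      change q.inv j (j e) ∈ _
      rw [h1]
      exact Submodule.smul_mem _ _
        (Submodule.mem_map_of_mem (pencilEigenspace_le_pencilSpan _ _ hs he))
  exact h hy

/-- A vector orthogonal to the eigenspaces up to `r` has quotient larger than `r`. -/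
theorem eq_zero_of_orthogonal_of_re_le (hc : IsCompactOperator j) {r : ℝ} {u : E}
    (hu : j u ∈ ((pencilSpan q (pullInner j) r).map j.toLinearMap)ᗮ)
    (hr : (q u u).re ≤ r * ‖j u‖ ^ 2) : u = 0 := by
  by_contra hu0
  have hpos : 0 < (q u u).re := by
    by_contra! h
    exact hu0 (eq_zero_of_re_le hq h)
  have hy0 : j u ≠ 0 := by
    intro h
    rw [h] at hr
    simp at hr
    linarith
  have hy : 0 < ‖j u‖ := norm_pos_iff.2 hy0
  have hrpos : 0 < r := by
    by_contra! h
    nlinarith [sq_nonneg ‖j u‖]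
  set M := (pencilSpan q (pullInner j) r).map j.toLinearMap with hM
  set T := q.inv j with hT
  have hsym : T.IsSymmetric := (ContinuousLinearMap.isSelfAdjoint_iff_isSymmetric.1
    (isSelfAdjoint_inv hq j))
  have hinv : ∀ y ∈ Mᗮ, T y ∈ Mᗮ := by
    intro y hy m hm
    have h1 : inner ℂ (T m) y = inner ℂ m (T y) := hsym m y
    rw [← h1]
    exact hy _ (inv_mem_map_pencilSpan hq r hm)
  let S : Mᗮ →L[ℂ] Mᗮ := T.restrict hinv
  have hScomp : IsCompactOperator S := (inv_isCompactOperator hq hc).restrict' hinv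
  have hSsym : S.IsSymmetric := hsym.restrict_invariant hinv
  have hSsa : IsSelfAdjoint S := ContinuousLinearMap.isSelfAdjoint_iff_isSymmetric.2 hSsym
  let y : Mᗮ := ⟨j u, hu⟩
  have hnt : Nontrivial Mᗮ := ⟨y, 0, fun h => hy0 (congrArg Subtype.val h)⟩
  -- the Rayleigh quotient of `S` at `j u` is at least `1 / r`
  have hcs : ‖j u‖ ^ 2 ≤ r * ‖S‖ * ‖j u‖ ^ 2 := by
    have e1 : q (q.sol j (j u)) u = ((‖j u‖ ^ 2 : ℝ) : ℂ) := by
      rw [sol_spec hq, ← pullInner_self, pullInner_apply]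
    set v := q.sol j (j u)
    have e2 : (q v v).re ≤ ‖S‖ * ‖j u‖ ^ 2 := by
      have e3 : q v v = inner ℂ (j u) (T (j u)) := (inner_inv hq j (j u) (j u)).symm
      have e4 : ‖(inner ℂ (j u) (T (j u)) : ℂ)‖ ≤ ‖j u‖ * (‖S‖ * ‖j u‖) :=
        (norm_inner_le_norm _ _).trans (by gcongr; exact S.le_opNorm y)
      rw [e3]
      calc _ ≤ _ := Complex.re_le_norm _
        _ ≤ _ := e4
        _ = _ := by ring
    -- Cauchy-Schwarz for `q`, in the form `0 ≤ q (u - r v)`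
    have e5 : 0 ≤ (q (u - (r : ℂ) • v) (u - (r : ℂ) • v)).re := by
      obtain ⟨c, hc, hcu⟩ := hq.coercive
      exact le_trans (by positivity) (hcu _)
    have e6 : q u v = ((‖j u‖ ^ 2 : ℝ) : ℂ) := by
      rw [hq.herm, e1, Complex.conj_ofReal]
    have e7 : (q (u - (r : ℂ) • v) (u - (r : ℂ) • v)).re =
        (q u u).re - 2 * r * ‖j u‖ ^ 2 + r ^ 2 * (q v v).re := by
      have : q (u - (r : ℂ) • v) (u - (r : ℂ) • v) = q u u - (r : ℂ) * q u v - (r : ℂ) * q v u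
          + ((r ^ 2 : ℝ) : ℂ) * q v v := by
        simp only [map_sub, sub_apply, map_smulₛₗ, smul_apply, smul_eq_mul, Complex.conj_ofReal,
          RingHom.id_apply]
        push_cast
        ring
      rw [this, e1, e6, self_eq_re hq u, self_eq_re hq v]
      simp only [← Complex.ofReal_mul, ← Complex.ofReal_sub, ← Complex.ofReal_add,
        Complex.ofReal_re]
      ring
    rw [e7] at e5
    have e8 : r * ‖j u‖ ^ 2 ≤ r ^ 2 * (q v v).re := by nlinarith
    have e9 : ‖j u‖ ^ 2 ≤ r * (q v v).re := by
      have : r * ‖j u‖ ^ 2 ≤ r * (r * (q v v).re) := by nlinarith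
      exact le_of_mul_le_mul_left this hrpos
    calc _ ≤ _ := e9
      _ ≤ r * (‖S‖ * ‖j u‖ ^ 2) := by gcongr
      _ = _ := by ring
  have hSn : r⁻¹ ≤ ‖S‖ := by
    have h1 : 1 ≤ r * ‖S‖ := by
      by_contra! h
      nlinarith [pow_pos hy 2]
    rw [inv_le_iff_one_le_mul₀ hrpos]
    linarith
  -- The compact self-adjoint restriction to `Mᗮ` attains its norm, which is at least `1 / r`, at an
  -- eigenvalue `z`. Then `1 / z` is a pencil eigenvalue not exceeding `r`, and its eigenvector lies
  -- both in `M` and in `Mᗮ`.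
  obtain ⟨z, hz, hzn⟩ := spectrum.exists_nnnorm_eq_spectralRadius S
  rw [ContinuousLinearMap.spectralRadius_eq_nnnorm S hSsa] at hzn
  have hzn' : ‖z‖ = ‖S‖ := by
    have := ENNReal.coe_inj.1 hzn
    exact congrArg NNReal.toReal this
  have hz0 : z ≠ 0 := by
    rw [← norm_pos_iff, hzn']
    exact lt_of_lt_of_le (by positivity) hSn
  rw [← hScomp.hasEigenvalue_iff_mem_spectrum hz0] at hz
  obtain ⟨x, hx⟩ := hz.exists_hasEigenvector
  have hx1 : T (x : Y) = (z⁻¹)⁻¹ • (x : Y) := by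
    rw [inv_inv]
    exact congrArg Subtype.val hx.apply_eq_smul
  obtain ⟨e, he, hex⟩ := (inv_apply_eq_smul_iff hq (inv_ne_zero hz0) (x : Y)).1 hx1
  have hx0 : (x : Y) ≠ 0 := fun h => hx.2 (Subtype.ext h)
  have he0 : e ≠ 0 := by
    rintro rfl
    exact hx0 (by rw [← hex, map_zero])
  obtain ⟨-, s, hs, hzs⟩ := exists_pos_of_mem_pencilEigenspace hq he0 he
  have hsr : s ≤ r := by
    have h1 : ‖z‖ = s⁻¹ := by
      rw [← inv_inv z, hzs, norm_inv, Complex.norm_real, Real.norm_of_nonneg hs.le]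
    rw [← hzn', h1] at hSn
    exact (inv_le_inv₀ hrpos hs).1 hSn
  rw [hzs] at he
  have hxM : (x : Y) ∈ M := by
    rw [← hex]
    exact Submodule.mem_map_of_mem (pencilEigenspace_le_pencilSpan _ _ hsr he)
  exact hx0 (inner_self_eq_zero.1 (x.2 _ hxM))

/-- The min-max principle. -/
theorem le_specCount_iff (hc : IsCompactOperator j) (r : ℝ) (m : ℕ) :
    m ≤ specCount q (pullInner j) r ↔ ∃ F : Submodule ℂ E, FiniteDimensional ℂ F ∧
      m ≤ Module.finrank ℂ F ∧ ∀ u ∈ F, (q u u).re ≤ r * ‖j u‖ ^ 2 := by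
  have hfin := finiteDimensional_pencilSpan hq hc r
  constructor
  · intro h
    exact ⟨pencilSpan q (pullInner j) r, hfin, h, fun u hu => re_le_of_mem_pencilSpan hq hu⟩
  · rintro ⟨F, hF, hm, h⟩
    by_contra! hlt
    set M := (pencilSpan q (pullInner j) r).map j.toLinearMap with hM
    have hMle : Module.finrank ℂ M ≤ specCount q (pullInner j) r :=
      Submodule.finrank_map_le _ _
    have : CompleteSpace M := FiniteDimensional.complete ℂ M
    -- `F` has larger dimension than `M`, so some nonzero vector of `F` is mapped by `j` into the
    -- orthogonal complement of `M`.
    let f : F →ₗ[ℂ] M := (M.orthogonalProjectionOnto.comp (j.comp F.subtypeL)).toLinearMap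
    have hker : LinearMap.ker f ≠ ⊥ := LinearMap.ker_ne_bot_of_finrank_lt (by omega)
    obtain ⟨u, hu, hu0⟩ := Submodule.exists_mem_ne_zero_of_ne_bot hker
    have h1 : j (u : E) ∈ Mᗮ := by
      rw [LinearMap.mem_ker] at hu
      exact Submodule.orthogonalProjectionOnto_eq_zero_iff.1 hu
    exact hu0 (Subtype.ext (eq_zero_of_orthogonal_of_re_le hq hc h1 (h u u.2)))

/-- Right continuity of the counting function. Being integer-valued, it attains its minimum over
`(r, ∞)` at some `s₁`; an eigenvalue in `(r, s₁]` would make it smaller slightly above `r`. -/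
theorem exists_pencilSpan_eq_right (hc : IsCompactOperator j) (r : ℝ) :
    ∃ s, r < s ∧ pencilSpan q (pullInner j) s = pencilSpan q (pullInner j) r := by
  have hfin := finiteDimensional_pencilSpan hq hc
  obtain ⟨s₁, hs₁, hmin⟩ : ∃ s₁, r < s₁ ∧ ∀ s, r < s →
      specCount q (pullInner j) s₁ ≤ specCount q (pullInner j) s := by
    have hne : ∃ m, ∃ s, r < s ∧ specCount q (pullInner j) s = m := ⟨_, r + 1, by linarith, rfl⟩
    classical
    obtain ⟨s₁, hs₁, h⟩ := Nat.find_spec hne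
    refine ⟨s₁, hs₁, fun s hs => ?_⟩
    rw [h]
    exact Nat.find_min' hne ⟨s, hs, rfl⟩
  refine ⟨s₁, hs₁, pencilSpan_eq_of_forall _ _ hs₁.le fun t ht => ?_⟩
  rw [Submodule.eq_bot_iff]
  intro e he
  obtain ⟨s, hrs, hst⟩ := exists_between ht.1
  have h1 : pencilSpan q (pullInner j) s = pencilSpan q (pullInner j) s₁ :=
    Submodule.eq_of_le_of_finrank_le (pencilSpan_mono _ _ (hst.le.trans ht.2)) (hmin s hrs)
  refine eq_zero_of_mem_pencilSpan hq hst ?_ he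
  rw [h1]
  exact pencilEigenspace_le_pencilSpan _ _ ht.2 he

/-- Left limits are attained: below `r` the counting function is bounded by its value at `r`, so it
has a maximum there. -/
theorem exists_pencilSpan_le_left (hc : IsCompactOperator j) (r : ℝ) :
    ∃ s, s < r ∧ ∀ t, t < r → pencilSpan q (pullInner j) t ≤ pencilSpan q (pullInner j) s := by
  have hfin := finiteDimensional_pencilSpan hq hc
  obtain ⟨s₁, hs₁, hmax⟩ : ∃ s₁, s₁ < r ∧ ∀ s, s < r →
      specCount q (pullInner j) s ≤ specCount q (pullInner j) s₁ := by
    classical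
    set P : ℕ → Prop := fun m => ∃ s, s < r ∧ specCount q (pullInner j) s = m
    have hP : P (specCount q (pullInner j) (r - 1)) := ⟨r - 1, by linarith, rfl⟩
    have hb : ∀ m, P m → m ≤ specCount q (pullInner j) r := by
      rintro m ⟨s, hs, rfl⟩
      exact Submodule.finrank_mono (pencilSpan_mono _ _ hs.le)
    obtain ⟨s₁, hs₁, h⟩ := Nat.findGreatest_spec (hb _ hP) hP
    refine ⟨s₁, hs₁, fun s hs => ?_⟩
    rw [h]
    exact Nat.le_findGreatest (hb _ ⟨s, hs, rfl⟩) ⟨s, hs, rfl⟩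
  refine ⟨s₁, hs₁, fun t ht => ?_⟩
  have h1 : pencilSpan q (pullInner j) s₁ = pencilSpan q (pullInner j) (max t s₁) :=
    Submodule.eq_of_le_of_finrank_le (pencilSpan_mono _ _ (le_max_right _ _))
      (hmax _ (max_lt ht hs₁))
  rw [h1]
  exact pencilSpan_mono _ _ (le_max_left _ _)

theorem nthEigenvalue_formOperator (hc : IsCompactOperator j) (hd : DenseRange j)
    (hj : Function.Injective j) (m : ℕ) :
    nthEigenvalue (formOperator (innerForm Y) j.toLinearMap q.toSForm) m =
      sInf {r : ℝ | m ≤ specCount q (pullInner j) r} := by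
  rw [nthEigenvalue]
  congr 1
  ext r
  have hfin := finiteDimensional_pencilSpan hq hc r
  have h1 : (⨆ s ∈ Set.Iic r, eigenspaceOf
      (formOperator (innerForm Y) j.toLinearMap q.toSForm) (s : ℂ)) =
      (pencilSpan q (pullInner j) r).map j.toLinearMap := by
    simp only [eigenspaceOf_formOperator hq hd, pencilSpan, Submodule.map_iSup]
  have h2 := (Submodule.equivMapOfInjective j.toLinearMap hj
    (pencilSpan q (pullInner j) r)).finrank_eq
  rw [mem_ofPred_eq, mem_ofPred_eq, h1, ← Module.finrank_eq_rank, Nat.cast_le, ← h2]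
  rfl

/-- The infimum in the definition of an eigenvalue is attained. -/
theorem sInf_le_iff (hc : IsCompactOperator j) {m : ℕ} (hm : 1 ≤ m)
    (hne : {r : ℝ | m ≤ specCount q (pullInner j) r}.Nonempty) (r : ℝ) :
    sInf {r : ℝ | m ≤ specCount q (pullInner j) r} ≤ r ↔ m ≤ specCount q (pullInner j) r := by
  have hfin := finiteDimensional_pencilSpan hq hc
  have hmono : ∀ s t, s ≤ t → m ≤ specCount q (pullInner j) s →
      m ≤ specCount q (pullInner j) t :=
    fun s t hst h => h.trans (Submodule.finrank_mono (pencilSpan_mono _ _ hst))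
  -- This needs `m ≥ 1`: the set would be the whole line for `m = 0`, but a positive count occurs
  -- only at positive levels.
  have hbdd : BddBelow {r : ℝ | m ≤ specCount q (pullInner j) r} := by
    refine ⟨0, fun r hr => ?_⟩
    by_contra! hr0
    have h1 : pencilSpan q (pullInner j) r = ⊥ := by
      refine (iSup₂_eq_bot.2 fun s hs => ?_)
      rw [Submodule.eq_bot_iff]
      intro e he
      by_contra he0
      obtain ⟨-, t, ht, hst⟩ := exists_pos_of_mem_pencilEigenspace hq he0 he
      have : s = t := by exact_mod_cast hst
      have hs' : s ≤ r := hs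
      linarith
    have h2 : m ≤ Module.finrank ℂ (pencilSpan q (pullInner j) r) := hr
    rw [h1, finrank_bot] at h2
    omega
  constructor
  · intro h
    obtain ⟨s, hs, heq⟩ := exists_pencilSpan_eq_right hq hc r
    obtain ⟨t, ht, hts⟩ := exists_lt_of_csInf_lt hne (lt_of_le_of_lt h hs)
    have := hmono t s hts.le ht
    rwa [specCount, heq] at this
  · intro h
    exact csInf_le hbdd h

/-- On the finite-dimensional `F` the injective `j` is bounded below, so the Rayleigh quotient is
bounded there and min-max applies. -/
theorem nonempty_of_le_finrank (hc : IsCompactOperator j)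
    (hj : Function.Injective j) {m : ℕ} {F : Submodule ℂ E} (hF : FiniteDimensional ℂ F)
    (hm : m ≤ Module.finrank ℂ F) : {r : ℝ | m ≤ specCount q (pullInner j) r}.Nonempty := by
  let jF : F →L[ℂ] Y := j.comp F.subtypeL
  have hker : LinearMap.ker jF.toLinearMap = ⊥ := by
    rw [LinearMap.ker_eq_bot]
    exact hj.comp Subtype.val_injective
  obtain ⟨K, hK, hanti⟩ := LinearMap.exists_antilipschitzWith jF.toLinearMap hker
  refine ⟨‖q‖ * K ^ 2, (le_specCount_iff hq hc _ _).2 ⟨F, hF, hm, fun u hu => ?_⟩⟩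
  have h1 : ‖u‖ ≤ K * ‖j u‖ := by
    have := hanti.le_mul_dist (⟨u, hu⟩ : F) 0
    simpa [jF] using this
  calc (q u u).re ≤ ‖q u u‖ := Complex.re_le_norm _
    _ ≤ ‖q‖ * ‖u‖ * ‖u‖ := q.le_opNorm₂ _ _
    _ ≤ ‖q‖ * (K * ‖j u‖) * (K * ‖j u‖) := by gcongr
    _ = _ := by ring

end BForm

section

/-! ## Vector-valued `L²` spaces, multiplication operators and the Fourier transform -/

open FourierTransform

/-- Weyl's criterion. If `B - ν` were bounded below by `η`, its square, with `ν` real, would have a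
quadratic form at least `η²` and be invertible, and so would `B - ν`. -/
theorem IsSelfAdjoint.exists_norm_le_of_mem_spectrum {Y : Type*} [NormedAddCommGroup Y]
    [InnerProductSpace ℂ Y] [CompleteSpace Y] {B : Y →L[ℂ] Y} (hB : IsSelfAdjoint B) {ν : ℂ}
    (hν : ν ∈ spectrum ℂ B) {η : ℝ} (hη : 0 < η) : ∃ x, x ≠ 0 ∧ ‖B x - ν • x‖ ≤ η * ‖x‖ := by
  by_contra! hcon
  have hre : ν = (ν.re : ℂ) := hB.mem_spectrum_eq_re hν
  set D : Y →L[ℂ] Y := B - algebraMap ℂ _ ν with hD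
  have hDsa : IsSelfAdjoint D := by
    rw [hD, hre]
    refine hB.sub ?_
    exact IsSelfAdjoint.algebraMap _ (by rw [isSelfAdjoint_iff]; simp)
  have hDapp : ∀ x, D x = B x - ν • x := by
    intro x
    simp [hD, Algebra.algebraMap_eq_smul_one]
  have hD2 : IsUnit (D * D) := by
    refine ContinuousLinearMap.isUnit_of_forall_le_norm_inner_map (D * D) (c := ⟨η ^ 2, by positivity⟩)
      (by exact_mod_cast (by positivity : (0:ℝ) < η ^ 2)) fun x => ?_
    have h1 : inner ℂ ((D * D) x) x = inner ℂ (D x) (D x) :=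
      ContinuousLinearMap.isSelfAdjoint_iff_isSymmetric.1 hDsa (D x) x
    rw [h1, inner_self_eq_norm_sq_to_K, hDapp]
    have h2 : η * ‖x‖ ≤ ‖B x - ν • x‖ := by
      rcases eq_or_ne x 0 with rfl | hx
      · simp
      · exact (hcon x hx).le
    have h3 : ‖((‖B x - ν • x‖ : ℂ)) ^ 2‖ = ‖B x - ν • x‖ ^ 2 := by
      rw [norm_pow, Complex.norm_real, norm_norm]
    change ‖x‖ ^ 2 * η ^ 2 ≤ ‖((‖B x - ν • x‖ : ℂ)) ^ 2‖
    rw [h3]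
    have h4 : (η * ‖x‖) ^ 2 ≤ ‖B x - ν • x‖ ^ 2 := by gcongr
    linarith [mul_pow η ‖x‖ 2]
  have hDu : IsUnit D := by
    rw [← pow_two] at hD2
    exact (isUnit_pow_iff two_ne_zero).1 hD2
  rw [spectrum.mem_iff] at hν
  apply hν
  have : algebraMap ℂ _ ν - B = -D := by rw [hD]; abel
  rw [this]
  exact hDu.neg

section L2

variable {n : ℕ} {Y Y' : Type*}
  [NormedAddCommGroup Y] [NormedSpace ℂ Y] [NormedAddCommGroup Y'] [NormedSpace ℂ Y']

local notation "𝕍" => EuclideanSpace ℝ (Fin n)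

theorem integrable_bform (q : BForm Y) (f g : Lp Y 2 (volume : Measure 𝕍)) :
    Integrable (fun x => q (f x) (g x)) volume := by
  have hf := Lp.memLp f
  have hg := Lp.memLp g
  have hfg : Integrable (fun x => ‖f x‖ * ‖g x‖) volume := hf.norm.integrable_mul hg.norm
  refine (hfg.const_mul ‖q‖).mono' ?_ ?_
  · exact q.continuous_uncurry.comp_aestronglyMeasurable (hf.1.prodMk hg.1)
  · filter_upwards with x
    calc ‖q (f x) (g x)‖ ≤ ‖q‖ * ‖f x‖ * ‖g x‖ := q.le_opNorm₂ _ _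
      _ = ‖q‖ * (‖f x‖ * ‖g x‖) := by ring

theorem memLp_fiber {Φ : 𝕍 → Y →L[ℂ] Y'} (hΦ : Continuous Φ) {C : ℝ} (hC : ∀ ξ, ‖Φ ξ‖ ≤ C)
    (f : Lp Y 2 (volume : Measure 𝕍)) : MemLp (fun ξ => Φ ξ (f ξ)) 2 (volume : Measure 𝕍) := by
  refine MemLp.of_le_mul (c := C) (Lp.memLp f) ?_ ?_
  · exact (isBoundedBilinearMap_apply (𝕜 := ℂ)).continuous.comp_aestronglyMeasurable
      (hΦ.aestronglyMeasurable.prodMk (Lp.memLp f).1)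
  · filter_upwards with ξ
    exact (Φ ξ).le_of_opNorm_le (hC ξ) _

/-- Multiplication by a bounded continuous operator-valued function. -/
def fiberMul (Φ : 𝕍 → Y →L[ℂ] Y') (hΦ : Continuous Φ) (C : ℝ) (hC : ∀ ξ, ‖Φ ξ‖ ≤ C) :
    Lp Y 2 (volume : Measure 𝕍) →L[ℂ] Lp Y' 2 (volume : Measure 𝕍) :=
  LinearMap.mkContinuous
    { toFun := fun f => (memLp_fiber hΦ hC f).toLp _
      map_add' := fun f g => by
        rw [← MemLp.toLp_add]
        refine MemLp.toLp_congr _ _ ?_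
        filter_upwards [Lp.coeFn_add f g] with ξ h
        rw [h]
        exact map_add _ _ _
      map_smul' := fun c f => by
        rw [RingHom.id_apply, ← MemLp.toLp_const_smul]
        refine MemLp.toLp_congr _ _ ?_
        filter_upwards [Lp.coeFn_smul c f] with ξ h
        rw [h]
        exact map_smul _ _ _ } C fun f => by
      refine Lp.norm_le_mul_norm_of_ae_le_mul ?_
      filter_upwards [(memLp_fiber hΦ hC f).coeFn_toLp] with ξ h
      change ‖((memLp_fiber hΦ hC f).toLp _ : 𝕍 → Y') ξ‖ ≤ _
      rw [h]
      exact (Φ ξ).le_of_opNorm_le (hC ξ) _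

theorem coeFn_fiberMul {Φ : 𝕍 → Y →L[ℂ] Y'} (hΦ : Continuous Φ) {C : ℝ} (hC : ∀ ξ, ‖Φ ξ‖ ≤ C)
    (f : Lp Y 2 (volume : Measure 𝕍)) :
    fiberMul Φ hΦ C hC f =ᵐ[volume] fun ξ => Φ ξ (f ξ) :=
  (memLp_fiber hΦ hC f).coeFn_toLp

end L2

section Spectrum

variable {n : ℕ} {Y : Type*} [NormedAddCommGroup Y] [InnerProductSpace ℂ Y] [CompleteSpace Y]

local notation "𝕍" => EuclideanSpace ℝ (Fin n)

theorem isClosed_spectrum_clm {Y : Type*} [NormedAddCommGroup Y] [NormedSpace ℂ Y]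
    [CompleteSpace Y] (T : Y →L[ℂ] Y) : IsClosed (spectrum ℂ T) :=
  spectrum.isClosed T

/-- The spectrum of multiplication by a norm-continuous family of self-adjoint operators. -/
theorem spectrum_fiberMul {Φ : 𝕍 → Y →L[ℂ] Y} (hΦ : Continuous Φ) {C : ℝ} (hC : ∀ ξ, ‖Φ ξ‖ ≤ C)
    (hsa : ∀ ξ, IsSelfAdjoint (Φ ξ)) :
    spectrum ℂ (fiberMul Φ hΦ C hC) = closure (⋃ ξ, spectrum ℂ (Φ ξ)) := by
  set T := fiberMul Φ hΦ C hC with hT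
  apply subset_antisymm
  · intro μ hμ
    by_contra hcl
    rw [Metric.mem_closure_iff] at hcl
    push Not at hcl
    obtain ⟨δ, hδ, hdist⟩ := hcl
    have h1 : ∀ ξ, ∀ ν ∈ spectrum ℂ (Φ ξ), δ ≤ ‖ν - μ‖ := fun ξ ν hν => by
      have := hdist ν (mem_iUnion.2 ⟨ξ, hν⟩)
      rwa [dist_comm, dist_eq_norm] at this
    -- Off the closure the fibre resolvents are bounded by `1 / δ`, uniformly in `ξ`, and continuous
    -- because inversion is; multiplication by them inverts `T - μ`.
    choose R hR hR1 hR2 using fun ξ => (hsa ξ).exists_resolvent_norm_le hδ (h1 ξ)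
    have hRinv : ∀ ξ, R ξ = Ring.inverse (Φ ξ - algebraMap ℂ _ μ) := by
      intro ξ
      have : (⟨Φ ξ - algebraMap ℂ _ μ, R ξ, hR2 ξ, hR1 ξ⟩ : (Y →L[ℂ] Y)ˣ).val =
        Φ ξ - algebraMap ℂ _ μ := rfl
      rw [← this, Ring.inverse_unit]
      rfl
    have hRc : Continuous R := by
      rw [continuous_iff_continuousAt]
      intro ξ
      have h2 : ContinuousAt (fun ξ => Φ ξ - algebraMap ℂ (Y →L[ℂ] Y) μ) ξ := by fun_prop
      have h3 := NormedRing.inverse_continuousAt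
        (⟨Φ ξ - algebraMap ℂ _ μ, R ξ, hR2 ξ, hR1 ξ⟩ : (Y →L[ℂ] Y)ˣ)
      have h4 : ContinuousAt (fun ξ => Ring.inverse (Φ ξ - algebraMap ℂ (Y →L[ℂ] Y) μ)) ξ :=
        ContinuousAt.comp (g := Ring.inverse) h3 h2
      simpa only [← hRinv] using h4
    set B := fiberMul R hRc δ⁻¹ hR
    have e1 : (T - algebraMap ℂ _ μ) * B = 1 := by
      ext1 f
      refine Lp.ext ?_
      change (T (B f) - μ • B f : Lp Y 2 (volume : Measure 𝕍)) =ᵐ[volume] f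
      filter_upwards [Lp.coeFn_sub (T (B f)) (μ • B f), Lp.coeFn_smul μ (B f),
        coeFn_fiberMul hΦ hC (B f), coeFn_fiberMul hRc hR f] with ξ g1 g2 g3 g4
      have g5 := DFunLike.congr_fun (hR2 ξ) (f ξ)
      rw [g1, Pi.sub_apply, g2, Pi.smul_apply, g3, g4]
      simpa [Algebra.algebraMap_eq_smul_one] using g5
    have e2 : B * (T - algebraMap ℂ _ μ) = 1 := by
      ext1 f
      refine Lp.ext ?_
      change B (T f - μ • f : Lp Y 2 (volume : Measure 𝕍)) =ᵐ[volume] f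
      filter_upwards [Lp.coeFn_sub (T f) (μ • f), Lp.coeFn_smul μ f,
        coeFn_fiberMul hΦ hC f, coeFn_fiberMul hRc hR (T f - μ • f)] with ξ g1 g2 g3 g4
      have g5 := DFunLike.congr_fun (hR1 ξ) (f ξ)
      rw [g4, g1, Pi.sub_apply, g2, Pi.smul_apply, g3]
      simpa [Algebra.algebraMap_eq_smul_one] using g5
    apply hμ
    have : algebraMap ℂ _ μ - T = -(T - algebraMap ℂ _ μ) := by abel
    rw [spectrum.mem_resolventSet_iff, this]
    exact IsUnit.neg (⟨⟨_, _, e1, e2⟩, rfl⟩ : IsUnit (T - algebraMap ℂ _ μ))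
  · refine closure_minimal (iUnion_subset fun ξ₀ μ hμ => ?_)
      (isClosed_spectrum_clm T)
    by_contra hcon
    rw [spectrum.notMem_iff] at hcon
    obtain ⟨⟨A, B, e1, e2⟩, rfl : A = _⟩ := hcon
    -- on a small ball around `ξ₀` an approximate eigenvector gives a contradiction
    set K := ‖B‖ + 1
    have hK : 0 < K := by positivity
    -- The error `1 / (4K)` at `ξ₀` leaves room for `1 / (2K)` on a ball; as `‖B‖ ≤ K`, this
    -- contradicts `B` being the inverse on the vector `x` times the indicator of the ball.
    obtain ⟨x, hx, hxn⟩ := (hsa ξ₀).exists_norm_le_of_mem_spectrum hμ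
      (η := (4 * K)⁻¹) (by positivity)
    have hx' : 0 < ‖x‖ := norm_pos_iff.2 hx
    have hcont : ContinuousAt (fun ξ => ‖Φ ξ x - μ • x‖) ξ₀ := by fun_prop
    have hlt : ‖Φ ξ₀ x - μ • x‖ < (2 * K)⁻¹ * ‖x‖ := by
      refine lt_of_le_of_lt hxn ?_
      gcongr
      norm_num
    obtain ⟨r, hr, hball⟩ := Metric.mem_nhds_iff.1
      (hcont.eventually (gt_mem_nhds hlt))
    set f : Lp Y 2 (volume : Measure 𝕍) := indicatorConstLp 2 (measurableSet_ball (x := ξ₀) (ε := r))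
      measure_ball_lt_top.ne x with hf
    have hf0 : 0 < ‖f‖ := by
      rw [hf, norm_indicatorConstLp (by norm_num) (by norm_num)]
      have : 0 < volume.real (Metric.ball ξ₀ r) :=
        ENNReal.toReal_pos (Metric.measure_ball_pos _ _ hr).ne' measure_ball_lt_top.ne
      positivity
    have h1 : ‖μ • f - T f‖ ≤ (2 * K)⁻¹ * ‖f‖ := by
      refine Lp.norm_le_mul_norm_of_ae_le_mul ?_
      filter_upwards [Lp.coeFn_sub (μ • f) (T f), Lp.coeFn_smul μ f, coeFn_fiberMul hΦ hC f,
        indicatorConstLp_coeFn (p := 2) (hs := measurableSet_ball (x := ξ₀) (ε := r))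
          (hμs := (measure_ball_lt_top (μ := (volume : Measure 𝕍))).ne) (c := x)]
        with ξ g1 g2 g3 g4
      rw [g1, Pi.sub_apply, g2, Pi.smul_apply, g3, g4]
      by_cases hξ : ξ ∈ Metric.ball ξ₀ r
      · rw [indicator_of_mem hξ, norm_sub_rev]
        exact (hball hξ).le
      · rw [indicator_of_notMem hξ]
        simp
    have h2 : B (μ • f - T f) = f := by
      have := DFunLike.congr_fun e2 f
      simpa [Algebra.algebraMap_eq_smul_one] using this
    have h3 : ‖f‖ ≤ ‖B‖ * ((2 * K)⁻¹ * ‖f‖) := by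
      calc ‖f‖ = ‖B (μ • f - T f)‖ := by rw [h2]
        _ ≤ ‖B‖ * ‖μ • f - T f‖ := B.le_opNorm _
        _ ≤ _ := by gcongr
    have h4 : ‖B‖ * ((2 * K)⁻¹ * ‖f‖) ≤ K * ((2 * K)⁻¹ * ‖f‖) := by
      gcongr
      exact le_add_of_nonneg_right zero_le_one
    have h5 : K * ((2 * K)⁻¹ * ‖f‖) = ‖f‖ / 2 := by field_simp
    linarith

end Spectrum

section Fourier

variable {n : ℕ} {Y Y' : Type*} [NormedAddCommGroup Y] [InnerProductSpace ℂ Y] [CompleteSpace Y]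
  [NormedAddCommGroup Y'] [InnerProductSpace ℂ Y'] [CompleteSpace Y']

local notation "𝕍" => EuclideanSpace ℝ (Fin n)

theorem integrable_schwartz_smul (φ : 𝓢(𝕍, ℂ)) (f : Lp Y 2 (volume : Measure 𝕍)) :
    Integrable (fun x => φ x • f x) volume :=
  memLp_one_iff_integrable.1 ((Lp.memLp f).smul (φ.memLp 2 volume))

theorem toTemperedDistribution_injective {f g : Lp Y 2 (volume : Measure 𝕍)}
    (h : ∀ φ : 𝓢(𝕍, ℂ), ∫ x, φ x • f x = ∫ x, φ x • g x) : f = g := by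
  have h1 := LinearMap.ker_eq_bot.1
    (Lp.ker_toTemperedDistributionCLM_eq_bot (F := Y) (μ := (volume : Measure 𝕍)) (p := 2))
  refine h1 ?_
  change Lp.toTemperedDistribution f = Lp.toTemperedDistribution g
  ext φ
  rw [Lp.toTemperedDistribution_apply, Lp.toTemperedDistribution_apply, h]

/-- The defining property of the Fourier transform on `L²`. -/
theorem integral_smul_fourier (φ : 𝓢(𝕍, ℂ)) (f : Lp Y 2 (volume : Measure 𝕍)) :
    ∫ x, φ x • (𝓕 f : Lp Y 2 (volume : Measure 𝕍)) x = ∫ x, (𝓕 φ) x • f x := by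
  rw [← Lp.toTemperedDistribution_apply, ← Lp.toTemperedDistribution_apply,
    ← Lp.fourier_toTemperedDistribution_eq, TemperedDistribution.fourier_apply]

/-- The Fourier transform commutes with bounded operators. -/
theorem fourier_compLpL (L : Y →L[ℂ] Y') (f : Lp Y 2 (volume : Measure 𝕍)) :
    𝓕 (L.compLpL 2 volume f) = L.compLpL 2 volume (𝓕 f) := by
  have key : ∀ (φ : 𝓢(𝕍, ℂ)) (g : Lp Y 2 (volume : Measure 𝕍)),
      ∫ x, φ x • (L.compLpL 2 volume g) x = L (∫ x, φ x • g x) := by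
    intro φ g
    rw [← L.integral_comp_comm (integrable_schwartz_smul φ g)]
    refine integral_congr_ae ?_
    filter_upwards [L.coeFn_compLpL (p := 2) (μ := (volume : Measure 𝕍)) g] with x hx
    rw [hx, map_smul]
  refine toTemperedDistribution_injective fun φ => ?_
  rw [integral_smul_fourier, key, key, integral_smul_fourier]

theorem l2Form_apply (q : BForm Y) (f g : Lp Y 2 (volume : Measure 𝕍)) :
    l2Form q f g = ∫ x, q (f x) (g x) := rfl

theorem l2Form_eq_inner (q : BForm Y) (f g : Lp Y 2 (volume : Measure 𝕍)) :
    l2Form q f g = inner ℂ g (q.repr.compLpL 2 volume f) := by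
  rw [l2Form_apply, MeasureTheory.L2.inner_def]
  refine integral_congr_ae ?_
  filter_upwards [q.repr.coeFn_compLpL (p := 2) (μ := (volume : Measure 𝕍)) f] with x hx
  rw [hx, q.inner_repr]

/-- Plancherel's theorem for bounded forms. -/
theorem l2Form_fourier (q : BForm Y) (f g : Lp Y 2 (volume : Measure 𝕍)) :
    l2Form q (𝓕 f) (𝓕 g) = l2Form q f g := by
  rw [l2Form_eq_inner, l2Form_eq_inner, ← fourier_compLpL, Lp.inner_fourier_eq]

/-- Generalised derivatives of `L²` functions on the Fourier side. -/
theorem lineDeriv_toTemperedDistribution_iff (f g : Lp Y 2 (volume : Measure 𝕍)) (m : 𝕍) :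
    ∂_{m} (Lp.toTemperedDistribution f) = Lp.toTemperedDistribution g ↔
      ∀ᵐ x, (𝓕 g : Lp Y 2 (volume : Measure 𝕍)) x =
        (2 * Real.pi * Complex.I * ((inner ℝ x m : ℝ) : ℂ)) •
          (𝓕 f : Lp Y 2 (volume : Measure 𝕍)) x := by
  have hm : (fun x : 𝕍 => ((inner ℝ x m : ℝ) : ℂ)).HasTemperateGrowth := by fun_prop
  have h1 : ∂_{m} (Lp.toTemperedDistribution f) = Lp.toTemperedDistribution g ↔
      ∀ φ : 𝓢(𝕍, ℂ), ∫ x, φ x • ((2 * Real.pi * Complex.I * ((inner ℝ x m : ℝ) : ℂ)) •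
          (𝓕 f : Lp Y 2 (volume : Measure 𝕍)) x) =
        ∫ x, φ x • (𝓕 g : Lp Y 2 (volume : Measure 𝕍)) x := by
    have h2 : ∂_{m} (Lp.toTemperedDistribution f) = Lp.toTemperedDistribution g ↔
        𝓕 (∂_{m} (Lp.toTemperedDistribution f)) = 𝓕 (Lp.toTemperedDistribution g) := by
      constructor
      · intro h
        rw [h]
      · intro h
        have h' := congrArg (fun u : 𝓢'(𝕍, Y) => (𝓕⁻ u : 𝓢'(𝕍, Y))) h
        simpa only [fourierInv_fourier_eq] using h'
    rw [h2, TemperedDistribution.fourier_lineDerivOp_eq, Lp.fourier_toTemperedDistribution_eq,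
      Lp.fourier_toTemperedDistribution_eq]
    have h3 : ∀ φ : 𝓢(𝕍, ℂ), ((2 * Real.pi * Complex.I) • TemperedDistribution.smulLeftCLM Y
        (fun x => ((inner ℝ x m : ℝ) : ℂ)) (Lp.toTemperedDistribution (𝓕 f))) φ =
        ∫ x, φ x • ((2 * Real.pi * Complex.I * ((inner ℝ x m : ℝ) : ℂ)) •
          (𝓕 f : Lp Y 2 (volume : Measure 𝕍)) x) := by
      intro φ
      change (2 * Real.pi * Complex.I) • ((TemperedDistribution.smulLeftCLM Y
        (fun x => ((inner ℝ x m : ℝ) : ℂ)) (Lp.toTemperedDistribution (𝓕 f))) φ) = _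
      rw [TemperedDistribution.smulLeftCLM_apply_apply, Lp.toTemperedDistribution_apply,
        ← integral_smul]
      refine integral_congr_ae ?_
      filter_upwards with x
      rw [SchwartzMap.smulLeftCLM_apply_apply hm, smul_smul, smul_smul, smul_eq_mul]
      congr 1
      ring
    constructor
    · intro h φ
      rw [← h3, h, Lp.toTemperedDistribution_apply]
    · intro h
      ext φ
      rw [h3, h, Lp.toTemperedDistribution_apply]
  rw [h1]
  constructor
  · intro h
    have hloc1 : LocallyIntegrable (fun x => (𝓕 g : Lp Y 2 (volume : Measure 𝕍)) x) volume :=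
      (Lp.memLp (𝓕 g)).locallyIntegrable (by norm_num)
    -- A linear factor times an `L²` function is only locally integrable, so compactly supported
    -- test functions are used.
    have hloc2 : LocallyIntegrable (fun x => (2 * Real.pi * Complex.I * ((inner ℝ x m : ℝ) : ℂ)) •
        (𝓕 f : Lp Y 2 (volume : Measure 𝕍)) x) volume := by
      have h0 : LocallyIntegrable (fun x => (𝓕 f : Lp Y 2 (volume : Measure 𝕍)) x) volume :=
        (Lp.memLp (𝓕 f)).locallyIntegrable (by norm_num)
      rw [← locallyIntegrableOn_univ] at h0 ⊢
      exact h0.continuousOn_smul isOpen_univ.isLocallyClosed (Continuous.continuousOn (by fun_prop))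
    refine ae_eq_of_integral_contDiff_smul_eq hloc1 hloc2 fun φ hφ hφc => ?_
    have hg₁ : HasCompactSupport (Complex.ofRealCLM ∘ φ) := hφc.comp_left rfl
    have hg₂ : ContDiff ℝ ((⊤ : ℕ∞) : WithTop ℕ∞) (Complex.ofRealCLM ∘ φ) :=
      Complex.ofRealCLM.contDiff.comp hφ
    have := h (hg₁.toSchwartzMap hg₂)
    simpa using this.symm
  · intro h φ
    refine integral_congr_ae ?_
    filter_upwards [h] with x hx
    rw [hx]

end Fourier

end

/-! ## Non-negative forms -/

namespace BForm

variable {E : Type*} [NormedAddCommGroup E] [NormedSpace ℂ E]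

/-- Non-negative forms. -/
def IsNonneg (q : BForm E) : Prop := ∀ u, 0 ≤ q u u

/-- The seminorm `√ q[u]`. -/
def en (q : BForm E) (u : E) : ℝ := √(q u u).re

theorem en_nonneg (q : BForm E) (u : E) : 0 ≤ q.en u := Real.sqrt_nonneg _

variable {q : BForm E} (hq : q.IsNonneg)
include hq

theorem IsNonneg.re_nonneg (u : E) : 0 ≤ (q u u).re := (Complex.le_def.1 (hq u)).1

theorem IsNonneg.im_eq_zero (u : E) : (q u u).im = 0 := (Complex.le_def.1 (hq u)).2.symm

theorem IsNonneg.en_sq (u : E) : q.en u ^ 2 = (q u u).re := Real.sq_sqrt (hq.re_nonneg u)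

/-- Polarisation: the quadratic form is real at `u + v` and at `u + i v`. -/
theorem IsNonneg.herm (u v : E) : q u v = starRingEnd ℂ (q v u) := by
  have h1 := hq.im_eq_zero (u + v)
  have h2 := hq.im_eq_zero (u + Complex.I • v)
  have h3 := hq.im_eq_zero u
  have h4 := hq.im_eq_zero v
  simp only [map_add, add_apply, map_smulₛₗ, smul_apply, smul_eq_mul, RingHom.id_apply,
    Complex.add_im, Complex.add_re, Complex.mul_im, Complex.conj_I, Complex.neg_re, Complex.neg_im, Complex.I_re,
    Complex.I_im, Complex.mul_re] at h1 h2
  apply Complex.ext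
  · rw [Complex.conj_re]
    linarith
  · rw [Complex.conj_im]
    linarith

/-- The Cauchy-Schwarz inequality. -/
theorem IsNonneg.norm_le (u v : E) : ‖q u v‖ ≤ q.en u * q.en v := by
  let c : PreInnerProductSpace.Core ℂ E :=
    { inner := fun x y => q y x
      conj_inner_symm := fun x y => (hq.herm y x).symm
      re_inner_nonneg := fun x => hq.re_nonneg x
      add_left := fun x y z => by simp
      smul_left := fun x y r => by simp }
  have h := @InnerProductSpace.Core.norm_inner_le_norm ℂ E _ _ _ c v u
  have h1 : ∀ x : E, (@InnerProductSpace.Core.toNorm ℂ E _ _ _ c).norm x = q.en x := fun x => rfl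
  rw [h1, h1] at h
  calc _ ≤ _ := h
    _ = _ := mul_comm _ _

theorem IsNonneg.en_add_le (u v : E) : q.en (u + v) ≤ q.en u + q.en v := by
  have h1 := hq.norm_le u v
  have h2 := (Complex.re_le_norm (q u v)).trans h1
  have h3 : (q v u).re = (q u v).re := by rw [hq.herm v u, Complex.conj_re]
  have h4 : q.en (u + v) ^ 2 ≤ (q.en u + q.en v) ^ 2 := by
    rw [hq.en_sq]
    simp only [map_add, add_apply, Complex.add_re]
    rw [h3, ← hq.en_sq u, ← hq.en_sq v]
    nlinarith
  exact (abs_le_of_sq_le_sq' h4 (add_nonneg (q.en_nonneg u) (q.en_nonneg v))).2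

theorem IsNonneg.apply_eq_zero {u : E} (hu : q u u = 0) (v : E) : q u v = 0 := by
  have h := hq.norm_le u v
  rw [en, hu, Complex.zero_re, Real.sqrt_zero, zero_mul] at h
  exact norm_le_zero_iff.1 h

theorem IsNonneg.apply_eq_zero' {u : E} (hu : q u u = 0) (v : E) : q v u = 0 := by
  rw [hq.herm, hq.apply_eq_zero hu, map_zero]

omit hq in
theorem en_neg (q : BForm E) (u : E) : q.en (-u) = q.en u := by
  simp [en]

theorem IsNonneg.en_le_add_sub (u v : E) : q.en v ≤ q.en (u + v) + q.en u := by
  have := hq.en_add_le (u + v) (-u)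
  rw [en_neg] at this
  simpa using this

end BForm

/-- An approximate solution of a form equation is close to the solution in energy. -/
theorem BForm.en_sub_le_of_residual {E : Type*} [NormedAddCommGroup E] [NormedSpace ℂ E]
    {q : BForm E} (hq : q.IsNonneg) {ℓ : E → ℂ} (hℓ : Continuous ℓ) {u U : E} {δ : ℝ}
    (hδ : 0 ≤ δ) (hu : ∀ w, q u w = ℓ w) {D : Set E} (hD : Dense D)
    (hU : ∀ t ∈ D, ‖q U t - ℓ t‖ ≤ δ * q.en t) : q.en (u - U) ≤ δ := by
  have hcont : Continuous fun t => q.en t :=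
    Real.continuous_sqrt.comp (Complex.continuous_re.comp
      (q.continuous_uncurry.comp (continuous_id.prodMk continuous_id)))
  have hall : ∀ t, ‖q U t - ℓ t‖ ≤ δ * q.en t := by
    have hcl : IsClosed {t | ‖q U t - ℓ t‖ ≤ δ * q.en t} :=
      isClosed_le (((q U).continuous.sub hℓ).norm) (continuous_const.mul hcont)
    intro t
    have := closure_minimal hU hcl
    rw [hD.closure_eq] at this
    exact this (mem_univ t)
  -- Testing the residual with the error itself gives `q[u - U] ≤ δ √q[u - U]`.
  have h1 := hall (u - U)
  have h2 : q U (u - U) - ℓ (u - U) = -q (u - U) (u - U) := by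
    rw [← hu]
    simp
  rw [h2, norm_neg] at h1
  have h3 : q.en (u - U) ^ 2 ≤ δ * q.en (u - U) := by
    rw [hq.en_sq]
    exact (Complex.re_le_norm _).trans h1
  rcases (q.en_nonneg (u - U)).eq_or_lt with h0 | h0
  · rwa [← h0]
  · rw [pow_two] at h3
    exact le_of_mul_le_mul_right h3 h0

/-- The operator `R` with `⟪w, R v⟫ = ℓ v w`. -/
def sesqRepr {F E : Type*} [NormedAddCommGroup F] [InnerProductSpace ℂ F] [CompleteSpace F]
    [NormedAddCommGroup E] [InnerProductSpace ℂ E] [CompleteSpace E]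
    (ℓ : F →L[ℂ] E →L⋆[ℂ] ℂ) : F →L[ℂ] E :=
  ContinuousLinearMap.adjoint
    ((InnerProductSpace.toDual ℂ F).symm.toContinuousLinearEquiv.toContinuousLinearMap.comp ℓ.flip)

theorem inner_sesqRepr {F E : Type*} [NormedAddCommGroup F] [InnerProductSpace ℂ F]
    [CompleteSpace F] [NormedAddCommGroup E] [InnerProductSpace ℂ E] [CompleteSpace E]
    (ℓ : F →L[ℂ] E →L⋆[ℂ] ℂ) (v : F) (w : E) : inner ℂ w (sesqRepr ℓ v) = ℓ v w := by
  rw [sesqRepr, ContinuousLinearMap.adjoint_inner_right]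
  simp

/-- The form-orthogonal projection onto a closed subspace. -/
theorem BForm.IsCoerciveHermitian.exists_proj {E : Type*} [NormedAddCommGroup E]
    [InnerProductSpace ℂ E] [CompleteSpace E] {q : BForm E} (hq : q.IsCoerciveHermitian)
    {V : Submodule ℂ E} (hV : IsClosed (V : Set E)) (u : E) :
    ∃ v ∈ V, ∀ w ∈ V, q (u - v) w = 0 := by
  have : CompleteSpace V := hV.completeSpace_coe
  let qV : BForm V := q.bilinearComp V.subtypeL V.subtypeL
  have hqV : qV.IsCoerciveHermitian := by
    obtain ⟨c, hc, hcu⟩ := hq.coercive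
    exact ⟨fun u w => hq.herm u w, c, hc, fun u => hcu u⟩
  refine ⟨qV.sol V.subtypeL (q.repr u), Subtype.prop _, fun w hw => ?_⟩
  have h := BForm.sol_spec hqV V.subtypeL (q.repr u) ⟨w, hw⟩
  have h2 : q (qV.sol V.subtypeL (q.repr u) : E) w = q u w := by
    rw [← q.inner_repr u w]
    exact h
  rw [map_sub, sub_apply, h2, sub_self]

/-- Used to extract leading coefficients of expansions at `θ = 0` after division by a power of `t`.
-/
theorem le_of_forall_small {x y C t₀ : ℝ} (ht₀ : 0 < t₀)
    (h : ∀ t, 0 < t → t < t₀ → x ≤ y + C * t) : x ≤ y := by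
  by_contra! hlt
  have hC : 0 < C := by
    by_contra! hC
    have := h (t₀ / 2) (by linarith) (by linarith)
    nlinarith
  have h1 := h (min (t₀ / 2) ((x - y) / (2 * C)))
    (lt_min (by linarith) (div_pos (by linarith) (by linarith)))
    (lt_of_le_of_lt (min_le_left _ _) (by linarith))
  have h2 : C * min (t₀ / 2) ((x - y) / (2 * C)) ≤ C * ((x - y) / (2 * C)) := by
    gcongr
    exact min_le_right _ _
  have h3 : C * ((x - y) / (2 * C)) = (x - y) / 2 := by field_simp
  linarith

/-! ### First consequences of the standing assumptions -/

namespace Setting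

variable {n : ℕ} {H X : Type*} [NormedAddCommGroup H] [InnerProductSpace ℂ H] [CompleteSpace H]
  [NormedAddCommGroup X] [InnerProductSpace ℂ X] [CompleteSpace X] (S : Setting n H X)

theorem isNonneg_a (θ : S.Θ) : (S.a θ).IsNonneg := S.a_nonneg θ

theorem isNonneg_b (θ : S.Θ) : (S.b θ).IsNonneg := S.b_nonneg θ

theorem isNonneg_d (θ : S.Θ) : (S.d θ).IsNonneg := S.d_nonneg θ

theorem isNonneg_ab (θ : S.Θ) : (S.a θ + S.b θ).IsNonneg := fun u =>
  add_nonneg (S.a_nonneg θ u) (S.b_nonneg θ u)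

theorem nrm_eq_en (θ : S.Θ) (u : H) : S.nrm θ u = (S.a θ + S.b θ).en u := rfl

theorem nrm_nonneg (θ : S.Θ) (u : H) : 0 ≤ S.nrm θ u := Real.sqrt_nonneg _

theorem nrm_sq (θ : S.Θ) (u : H) : S.nrm θ u ^ 2 = (S.a θ u u).re + (S.b θ u u).re :=
  (S.isNonneg_ab θ).en_sq u

theorem a_add_b_zero (u v : H) : S.a S.o u v + S.b S.o u v = inner ℂ v u := S.inner_H u v

theorem d_zero (u v : X) : S.d S.o u v = inner ℂ v u := S.inner_X u v

theorem nrm_zero (u : H) : S.nrm S.o u = ‖u‖ := by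
  rw [nrm, S.a_add_b_zero, inner_self_eq_norm_sq_to_K]
  have : (((‖u‖ : ℂ)) ^ 2).re = ‖u‖ ^ 2 := by
    rw [← Complex.ofReal_pow, Complex.ofReal_re]
  change √(((‖u‖ : ℂ)) ^ 2).re = ‖u‖
  rw [this, Real.sqrt_sq (norm_nonneg _)]

theorem en_d_zero (u : X) : (S.d S.o).en u = ‖u‖ := by
  rw [BForm.en, S.d_zero, inner_self_eq_norm_sq_to_K]
  have : (((‖u‖ : ℂ)) ^ 2).re = ‖u‖ ^ 2 := by
    rw [← Complex.ofReal_pow, Complex.ofReal_re]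
  change √(((‖u‖ : ℂ)) ^ 2).re = ‖u‖
  rw [this, Real.sqrt_sq (norm_nonneg _)]

theorem exists_nrm_equiv : ∃ K : ℝ, 1 ≤ K ∧ ∀ θ u, S.nrm θ u ≤ K * ‖u‖ ∧ ‖u‖ ≤ K * S.nrm θ u := by
  obtain ⟨K, hK, h⟩ := S.equiv_H
  refine ⟨K + 1, by linarith, fun θ u => ⟨?_, ?_⟩⟩
  · rw [← S.nrm_zero u]
    have h1 : S.nrm θ u ≤ K * S.nrm S.o u := h θ S.o u
    nlinarith [S.nrm_nonneg S.o u]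
  · rw [← S.nrm_zero u]
    have h1 : S.nrm S.o u ≤ K * S.nrm θ u := h S.o θ u
    nlinarith [S.nrm_nonneg θ u]

theorem en_b_le_nrm (θ : S.Θ) (u : H) : (S.b θ).en u ≤ S.nrm θ u := by
  refine Real.sqrt_le_sqrt ?_
  rw [Complex.add_re]
  linarith [(S.isNonneg_a θ).re_nonneg u]

theorem en_d_le_en_b (θ : S.Θ) (u : H) : (S.d θ).en (S.J u) ≤ (S.b θ).en u :=
  Real.sqrt_le_sqrt (S.d_le_b θ u)

theorem norm_J_le (u : H) : ‖S.J u‖ ≤ ‖u‖ := by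
  rw [← S.en_d_zero, ← S.nrm_zero]
  exact (S.en_d_le_en_b S.o u).trans (S.en_b_le_nrm S.o u)

theorem isClosed_V (θ : S.Θ) : IsClosed (S.V θ : Set H) :=
  isClosed_eq ((S.a θ).continuous_uncurry.comp (continuous_id.prodMk continuous_id))
    continuous_const

instance (θ : S.Θ) : CompleteSpace (S.V θ) := (S.isClosed_V θ).completeSpace_coe

instance (U : Submodule ℂ H) : CompleteSpace (S.clos U) :=
  (Submodule.isClosed_topologicalClosure (U.map S.J.toLinearMap)).completeSpace_coe

theorem a_left_V {θ : S.Θ} {v : H} (hv : v ∈ S.V θ) (u : H) : S.a θ v u = 0 :=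
  (S.isNonneg_a θ).apply_eq_zero hv u

theorem a_right_V {θ : S.Θ} {v : H} (hv : v ∈ S.V θ) (u : H) : S.a θ u v = 0 :=
  (S.isNonneg_a θ).apply_eq_zero' hv u

/-- `a_0` annihilates `V_0`, so with one argument in `V_0` the form `b_0` is the inner product of
`H`. -/
theorem b_zero_eq_inner {v : H} (hv : v ∈ S.V S.o) (u : H) : S.b S.o v u = inner ℂ u v := by
  rw [← S.a_add_b_zero v u, S.a_left_V hv, zero_add]

theorem mem_W_o {w : H} : w ∈ S.W S.o ↔ w ∈ (S.V S.o)ᗮ := by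
  rw [Submodule.mem_orthogonal]
  constructor
  · intro h v hv
    rw [← S.a_add_b_zero]
    exact h v hv
  · intro h v hv
    rw [S.a_add_b_zero]
    exact h v hv

theorem W_o_eq : S.W S.o = (S.V S.o)ᗮ := Submodule.ext fun _ => S.mem_W_o

/-- Orthogonal projection onto the closed subspace `V_θ` with respect to `a_θ + b_θ`, which is
coercive by norm equivalence. -/
theorem exists_add_W (θ : S.Θ) (u : H) : ∃ v ∈ S.V θ, ∃ w ∈ S.W θ, u = v + w := by
  obtain ⟨K, hK, hKu⟩ := S.exists_nrm_equiv
  have hq : (S.a θ + S.b θ).IsCoerciveHermitian := by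
    refine ⟨(S.isNonneg_ab θ).herm, (K ^ 2)⁻¹, by positivity, fun u => ?_⟩
    rw [← (S.isNonneg_ab θ).en_sq, ← S.nrm_eq_en, inv_mul_le_iff₀ (by positivity), ← mul_pow]
    exact pow_le_pow_left₀ (norm_nonneg _) (hKu θ u).2 2
  obtain ⟨v, hv, h⟩ := hq.exists_proj (S.isClosed_V θ) u
  exact ⟨v, hv, u - v, fun v' hv' => h v' hv', by abel⟩

theorem exists_lipschitz_a : ∃ K : ℝ, 0 ≤ K ∧ ∀ (θ : S.Θ) (u v : H),
    ‖S.a θ u v - S.a S.o u v‖ ≤ K * ‖(θ : EuclideanSpace ℝ (Fin n))‖ * ‖u‖ * ‖v‖ := by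
  obtain ⟨L, hL, h⟩ := S.lipschitz_a
  refine ⟨L, hL.le, fun θ u v => ?_⟩
  have h1 := h S.o θ u v
  have h2 : ((S.o : S.Θ) : EuclideanSpace ℝ (Fin n)) = 0 := rfl
  rw [norm_sub_rev, h2, zero_sub, norm_neg] at h1
  rw [← S.nrm_zero u, ← S.nrm_zero v]
  exact h1

/-! ### The splitting of `V_0` and its stability for small `θ` -/

namespace Splitting

variable {S} (P : S.Splitting)

instance : CompleteSpace P.Vs := P.isClosed_Vs.completeSpace_coe
instance : CompleteSpace P.Z := P.isClosed_Z.completeSpace_coe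

theorem Vs_le : P.Vs ≤ S.V S.o := P.sup_eq ▸ le_sup_left

theorem Z_le : P.Z ≤ S.V S.o := P.sup_eq ▸ le_sup_right

theorem coprod_injective : Function.Injective (P.inclVs.coprod P.inclZ) := by
  rw [injective_iff_map_eq_zero]
  rintro ⟨v, z⟩ h
  have h1 : (v : H) + z = 0 := congrArg Subtype.val h
  have h2 : (v : H) = -z := eq_neg_of_add_eq_zero_left h1
  have h3 : (v : H) ∈ P.Vs ⊓ P.Z := ⟨v.2, h2 ▸ P.Z.neg_mem z.2⟩
  rw [P.disjoint.eq_bot, Submodule.mem_bot] at h3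
  rw [h3, zero_add] at h1
  exact Prod.ext (Subtype.ext h3) (Subtype.ext h1)

theorem coprod_surjective : Function.Surjective (P.inclVs.coprod P.inclZ) := by
  rintro ⟨u, hu⟩
  rw [← P.sup_eq, Submodule.mem_sup] at hu
  obtain ⟨v, hv, z, hz, rfl⟩ := hu
  exact ⟨(⟨v, hv⟩, ⟨z, hz⟩), Subtype.ext rfl⟩

/-- `V_⋆ × Z ≃ V_0`. -/
def splitEquiv : (P.Vs × P.Z) ≃L[ℂ] S.V S.o :=
  ContinuousLinearEquiv.ofBijective (P.inclVs.coprod P.inclZ)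
    (LinearMap.ker_eq_bot.2 P.coprod_injective) (LinearMap.range_eq_top.2 P.coprod_surjective)

/-- The projection of `V_0` onto `Z` along `V_⋆`. -/
def projZ : S.V S.o →L[ℂ] P.Z :=
  (ContinuousLinearMap.snd ℂ P.Vs P.Z).comp P.splitEquiv.symm.toContinuousLinearMap

/-- The projection of `V_0` onto `V_⋆` along `Z`. -/
def projVs : S.V S.o →L[ℂ] P.Vs :=
  (ContinuousLinearMap.fst ℂ P.Vs P.Z).comp P.splitEquiv.symm.toContinuousLinearMap

theorem proj_add (u : S.V S.o) : P.inclVs (P.projVs u) + P.inclZ (P.projZ u) = u :=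
  P.splitEquiv.apply_symm_apply u

theorem coe_proj_add (u : S.V S.o) : (P.projVs u : H) + (P.projZ u : H) = u :=
  congrArg Subtype.val (P.proj_add u)

theorem projZ_add (v : P.Vs) (z : P.Z) : P.projZ (P.inclVs v + P.inclZ z) = z :=
  congrArg Prod.snd (P.splitEquiv.symm_apply_apply (v, z))

theorem projVs_add (v : P.Vs) (z : P.Z) : P.projVs (P.inclVs v + P.inclZ z) = v :=
  congrArg Prod.fst (P.splitEquiv.symm_apply_apply (v, z))

@[simp] theorem projZ_inclZ (z : P.Z) : P.projZ (P.inclZ z) = z := by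
  simpa using P.projZ_add 0 z

@[simp] theorem projZ_inclVs (v : P.Vs) : P.projZ (P.inclVs v) = 0 := by
  simpa using P.projZ_add v 0

@[simp] theorem projVs_inclVs (v : P.Vs) : P.projVs (P.inclVs v) = v := by
  simpa using P.projVs_add v 0

theorem Vstar_o : P.Vstar S.o = P.Vs := if_pos rfl

theorem Vstar_of_ne {θ : S.Θ} (h : θ ≠ S.o) : P.Vstar θ = S.V θ := if_neg h

theorem Vstar_le (θ : S.Θ) : P.Vstar θ ≤ S.V θ := by
  by_cases h : θ = S.o
  · subst h
    rw [P.Vstar_o]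
    exact P.Vs_le
  · rw [P.Vstar_of_ne h]

/-- The projections of `V_0` onto `V_⋆` and `Z` are bounded, and `W_0` is orthogonal to `V_0`, so
Pythagoras applies. -/
theorem exists_bound_sum : ∃ C : ℝ, 1 ≤ C ∧ ∀ v ∈ P.Vs, ∀ z ∈ P.Z, ∀ w ∈ S.W S.o,
    ‖v‖ ≤ C * ‖v + z + w‖ ∧ ‖z‖ ≤ C * ‖v + z + w‖ ∧ ‖w‖ ≤ C * ‖v + z + w‖ := by
  refine ⟨1 + ‖P.projVs‖ + ‖P.projZ‖, by linarith [norm_nonneg P.projVs, norm_nonneg P.projZ],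
    fun v hv z hz w hw => ?_⟩
  set s : S.V S.o := P.inclVs ⟨v, hv⟩ + P.inclZ ⟨z, hz⟩ with hs
  have hsv : (s : H) = v + z := rfl
  have horth : inner ℂ (s : H) w = 0 := (S.mem_W_o.1 hw) _ s.2
  have hpyth : ‖(s : H) + w‖ * ‖(s : H) + w‖ = ‖(s : H)‖ * ‖(s : H)‖ + ‖w‖ * ‖w‖ :=
    norm_add_sq_eq_norm_sq_add_norm_sq_of_inner_eq_zero _ _ horth
  have h1 : ‖(s : H)‖ ≤ ‖(s : H) + w‖ := by
    nlinarith [norm_nonneg (s : H), norm_nonneg w, norm_nonneg ((s : H) + w)]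
  have h2 : ‖w‖ ≤ ‖(s : H) + w‖ := by
    nlinarith [norm_nonneg (s : H), norm_nonneg w, norm_nonneg ((s : H) + w)]
  have h3 : ‖v‖ ≤ ‖P.projVs‖ * ‖(s : H)‖ := by
    have := P.projVs.le_opNorm s
    rw [hs, P.projVs_add] at this
    exact this
  have h4 : ‖z‖ ≤ ‖P.projZ‖ * ‖(s : H)‖ := by
    have := P.projZ.le_opNorm s
    rw [hs, P.projZ_add] at this
    exact this
  rw [← hsv]
  have g1 : ‖P.projVs‖ * ‖(s : H)‖ ≤ ‖P.projVs‖ * ‖(s : H) + w‖ := by gcongr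
  have g2 : ‖P.projZ‖ * ‖(s : H)‖ ≤ ‖P.projZ‖ * ‖(s : H) + w‖ := by gcongr
  have g3 : 0 ≤ ‖P.projVs‖ * ‖(s : H) + w‖ := by positivity
  have g4 : 0 ≤ ‖P.projZ‖ * ‖(s : H) + w‖ := by positivity
  have g5 := norm_nonneg ((s : H) + w)
  refine ⟨?_, ?_, ?_⟩ <;> nlinarith

theorem exists_eq_sum (u : H) : ∃ v ∈ P.Vs, ∃ z ∈ P.Z, ∃ w ∈ S.W S.o, u = v + z + w := by
  obtain ⟨s, hs, w, hw, rfl⟩ := S.exists_add_W S.o u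
  rw [← P.sup_eq, Submodule.mem_sup] at hs
  obtain ⟨v, hv, z, hz, rfl⟩ := hs
  exact ⟨v, hv, z, hz, w, hw, rfl⟩

/-- `V^⋆_θ` and `V_⋆` are close. -/
theorem exists_close (h2 : P.RemovableSingularity) : ∃ K : ℝ, 0 ≤ K ∧ ∀ θ : S.Θ,
    (∀ v ∈ P.Vstar θ, ∃ v' ∈ P.Vs, ‖v - v'‖ ≤ K * ‖(θ : EuclideanSpace ℝ (Fin n))‖ * ‖v‖) ∧
    (∀ v' ∈ P.Vs, ∃ v ∈ P.Vstar θ,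
      ‖v - v'‖ ≤ K * ‖(θ : EuclideanSpace ℝ (Fin n))‖ * ‖v'‖) := by
  obtain ⟨L, hL, h⟩ := h2
  obtain ⟨K, hK, hKu⟩ := S.exists_nrm_equiv
  have key : ∀ θ₁ θ₂ : S.Θ, (θ₁ : EuclideanSpace ℝ (Fin n)) ≠ θ₂ → ∀ v₁ ∈ P.Vstar θ₁, v₁ ≠ 0 →
      ∃ v₂ ∈ P.Vstar θ₂, ‖v₁ - v₂‖ ≤
        K * (L + 1) * K * ‖(θ₁ : EuclideanSpace ℝ (Fin n)) - θ₂‖ * ‖v₁‖ := by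
    intro θ₁ θ₂ hne v₁ hv₁ hv0
    have h1 := h θ₁ θ₂ v₁ hv₁
    have hpos : 0 < S.nrm θ₁ v₁ := by
      have := (hKu θ₁ v₁).2
      by_contra! hcon
      have h2 : 0 < ‖v₁‖ := norm_pos_iff.2 hv0
      nlinarith
    have hd : 0 < ‖(θ₁ : EuclideanSpace ℝ (Fin n)) - θ₂‖ := norm_pos_iff.2 (sub_ne_zero.2 hne)
    -- The infimum need not be attained; enlarging `L` to `L + 1` makes the inequality strict, so an
    -- actual vector satisfies it.
    have h3 : ⨅ v₂ : P.Vstar θ₂, S.nrm θ₂ (v₁ - v₂) <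
        (L + 1) * ‖(θ₁ : EuclideanSpace ℝ (Fin n)) - θ₂‖ * S.nrm θ₁ v₁ := by
      refine lt_of_le_of_lt h1 ?_
      nlinarith [mul_pos hd hpos]
    obtain ⟨v₂, hv₂⟩ := exists_lt_of_ciInf_lt h3
    refine ⟨v₂, v₂.2, ?_⟩
    calc ‖v₁ - v₂‖ ≤ K * S.nrm θ₂ (v₁ - v₂) := (hKu _ _).2
      _ ≤ K * ((L + 1) * ‖(θ₁ : EuclideanSpace ℝ (Fin n)) - θ₂‖ * S.nrm θ₁ v₁) := by gcongr
      _ ≤ K * ((L + 1) * ‖(θ₁ : EuclideanSpace ℝ (Fin n)) - θ₂‖ * (K * ‖v₁‖)) := by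
        gcongr
        exact (hKu _ _).1
      _ = _ := by ring
  refine ⟨K * (L + 1) * K, by positivity, fun θ => ?_⟩
  have hz : ((S.o : S.Θ) : EuclideanSpace ℝ (Fin n)) = 0 := rfl
  by_cases hθ : θ = S.o
  · subst hθ
    rw [P.Vstar_o]
    exact ⟨fun v hv => ⟨v, hv, by simp [hz]⟩, fun v hv => ⟨v, hv, by simp [hz]⟩⟩
  · have hθ' : (θ : EuclideanSpace ℝ (Fin n)) ≠ (S.o : S.Θ) := fun h => hθ (Subtype.ext h)
    refine ⟨fun v hv => ?_, fun v hv => ?_⟩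
    · rcases eq_or_ne v 0 with rfl | h0
      · exact ⟨0, Submodule.zero_mem _, by simp⟩
      · obtain ⟨v', hv', hle⟩ := key θ S.o hθ' v hv h0
        rw [P.Vstar_o] at hv'
        rw [hz, sub_zero] at hle
        exact ⟨v', hv', hle⟩
    · rcases eq_or_ne v 0 with rfl | h0
      · exact ⟨0, Submodule.zero_mem _, by simp⟩
      · obtain ⟨v', hv', hle⟩ := key S.o θ hθ'.symm v (by rwa [P.Vstar_o]) h0
        rw [hz, zero_sub, norm_neg, norm_sub_rev] at hle
        exact ⟨v', hv', hle⟩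

/-- For small `θ` the space `H` is still the direct sum of `V^⋆_θ`, `Z` and `W_0`, uniformly. -/
theorem exists_decomposition (h2 : P.RemovableSingularity) : ∃ δ C : ℝ, 0 < δ ∧ 1 ≤ C ∧
    ∀ θ : S.Θ, ‖(θ : EuclideanSpace ℝ (Fin n))‖ ≤ δ →
      (∀ v ∈ P.Vstar θ, ∀ z ∈ P.Z, ∀ w ∈ S.W S.o,
        ‖v‖ ≤ C * ‖v + z + w‖ ∧ ‖z‖ ≤ C * ‖v + z + w‖ ∧ ‖w‖ ≤ C * ‖v + z + w‖) ∧
      Dense {u : H | ∃ v ∈ P.Vstar θ, ∃ z ∈ P.Z, ∃ w ∈ S.W S.o, u = v + z + w} := by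
  obtain ⟨K, hK, hclose⟩ := P.exists_close h2
  obtain ⟨C, hC, hb⟩ := P.exists_bound_sum
  -- For such `θ`, replacing a vector of `V^⋆_θ` by one of `V_⋆` costs at most `1 / (4C)` of its
  -- norm, which the bounds at `θ = 0` absorb.
  refine ⟨(4 * (K + 1) * C)⁻¹, 4 * C, by positivity, by linarith, fun θ hθ => ?_⟩
  have hKθ : K * ‖(θ : EuclideanSpace ℝ (Fin n))‖ * (4 * C) ≤ 1 := by
    have h1 : ‖(θ : EuclideanSpace ℝ (Fin n))‖ * (4 * (K + 1) * C) ≤ 1 := by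
      rwa [← le_div_iff₀ (by positivity), one_div]
    nlinarith [norm_nonneg (θ : EuclideanSpace ℝ (Fin n)),
      mul_nonneg (norm_nonneg (θ : EuclideanSpace ℝ (Fin n))) (by linarith : 0 ≤ C)]
  set κ := K * ‖(θ : EuclideanSpace ℝ (Fin n))‖ with hκ
  have hκ0 : 0 ≤ κ := by positivity
  have hκ1 : κ ≤ 1 / 4 := by nlinarith
  constructor
  · intro v hv z hz w hw
    obtain ⟨v', hv', hle⟩ := (hclose θ).1 v hv
    obtain ⟨b1, b2, b3⟩ := hb v' hv' z hz w hw
    have t1 : ‖v‖ ≤ ‖v'‖ + κ * ‖v‖ := by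
      have := norm_le_norm_add_norm_sub' v v'
      linarith
    have t2 : ‖v'‖ ≤ ‖v‖ + κ * ‖v‖ := by
      have := norm_le_norm_add_norm_sub' v' v
      rw [norm_sub_rev] at this
      linarith
    have t3 : ‖v' + z + w‖ ≤ ‖v + z + w‖ + κ * ‖v‖ := by
      have h1 : v' + z + w = (v + z + w) - (v - v') := by abel
      rw [h1]
      exact (norm_sub_le _ _).trans (by linarith)
    have t4 : ‖v‖ ≤ 2 * ‖v'‖ := by nlinarith [norm_nonneg v]
    have t5 : κ * ‖v‖ ≤ κ * C * 2 * ‖v' + z + w‖ := by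
      calc κ * ‖v‖ ≤ κ * (2 * (C * ‖v' + z + w‖)) := by
            gcongr
            linarith
        _ = _ := by ring
    have t6 : κ * C * 2 * ‖v' + z + w‖ ≤ (1 / 2) * ‖v' + z + w‖ := by
      gcongr
      linarith
    have t7 : ‖v' + z + w‖ ≤ 2 * ‖v + z + w‖ := by linarith
    have t8 : C * ‖v' + z + w‖ ≤ C * (2 * ‖v + z + w‖) := by gcongr
    have t9 : 0 ≤ C * ‖v + z + w‖ := by positivity
    refine ⟨by linarith, by linarith, by linarith⟩
  · set M : Submodule ℂ H := P.Vstar θ ⊔ P.Z ⊔ S.W S.o with hM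
    have hsub : (M : Set H) ⊆
        {u : H | ∃ v ∈ P.Vstar θ, ∃ z ∈ P.Z, ∃ w ∈ S.W S.o, u = v + z + w} := by
      intro u hu
      rw [hM, SetLike.mem_coe, Submodule.mem_sup] at hu
      obtain ⟨s, hs, w, hw, rfl⟩ := hu
      rw [Submodule.mem_sup] at hs
      obtain ⟨v, hv, z, hz, rfl⟩ := hs
      exact ⟨v, hv, z, hz, w, hw, rfl⟩
    refine Dense.mono hsub ?_
    rw [Submodule.dense_iff_topologicalClosure_eq_top]
    by_contra hne
    have hex : ∃ x, x ∉ M.topologicalClosure := by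
      by_contra! hall
      exact hne (Submodule.eq_top_iff'.2 hall)
    -- If the closure were proper, some nonzero `u` would have distance at least `3/4 ‖u‖` from it.
    -- Exchanging its `V_⋆`-part for a nearby vector of `V^⋆_θ` moves `u` by at most `1/4 ‖u‖` into
    -- the sum.
    obtain ⟨u, hu, hdist⟩ := riesz_lemma (Submodule.isClosed_topologicalClosure M) hex
      (r := 3 / 4) (by norm_num)
    obtain ⟨v', hv', z, hz, w, hw, rfl⟩ := P.exists_eq_sum u
    obtain ⟨v, hv, hle⟩ := (hclose θ).2 v' hv'
    have hy : v + z + w ∈ M.topologicalClosure := Submodule.le_topologicalClosure _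
      (Submodule.add_mem_sup (Submodule.add_mem_sup hv hz) hw)
    have h1 := hdist _ hy
    have h3 : v' + z + w - (v + z + w) = -(v - v') := by abel
    rw [h3, norm_neg] at h1
    have h4 := (hb v' hv' z hz w hw).1
    have h5 : κ * ‖v'‖ ≤ κ * (C * ‖v' + z + w‖) := by gcongr
    have h6 : κ * C * ‖v' + z + w‖ ≤ 1 / 4 * ‖v' + z + w‖ := by
      gcongr
      linarith
    have h7 : v' + z + w ≠ 0 := fun h0 => hu (by rw [h0]; exact Submodule.zero_mem _)
    have h8 := norm_pos_iff.2 h7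
    linarith

end Splitting

end Setting

/-! ### Correctors and the homogenised form -/

namespace Setting

variable {n : ℕ} {H X : Type*} [NormedAddCommGroup H] [InnerProductSpace ℂ H] [CompleteSpace H]
  [NormedAddCommGroup X] [InnerProductSpace ℂ X] [CompleteSpace X] {S : Setting n H X}

local notation "𝕍" => EuclideanSpace ℝ (Fin n)

theorem exists_gap_zero (h1 : S.GapCondition) : ∃ ν : ℝ, 0 < ν ∧ ∀ w ∈ S.W S.o,
    ν * ‖w‖ ^ 2 ≤ (S.a S.o w w).re := by
  obtain ⟨ν, hν, h⟩ := h1 S.o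
  refine ⟨ν, hν, fun w hw => ?_⟩
  rw [← S.nrm_zero w]
  exact h w hw

theorem norm_coord_le (ξ : 𝕍) (j : Fin n) : ‖(ξ j : ℂ)‖ ≤ ‖ξ‖ := by
  rw [Complex.norm_real]
  exact PiLp.norm_apply_le ξ j

namespace Expansion

variable (A : S.Expansion) (P : S.Splitting)

include A in
theorem exists_ball : ∃ r : ℝ, 0 < r ∧ ∀ ξ : 𝕍, ‖ξ‖ < r → ξ ∈ S.Θ := by
  obtain ⟨r, hr, h⟩ := Metric.mem_nhds_iff.1 (mem_interior_iff_mem_nhds.1 A.zero_mem_interior)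
  exact ⟨r, hr, fun ξ hξ => h (by simpa using hξ)⟩

/-- `∑ θ_j a'_{0,j}`. -/
def a1Sum (ξ : 𝕍) (v : S.V S.o) (u : H) : ℂ := ∑ j, A.a1 j v u * (ξ j : ℂ)

/-- `∑ θ_j θ_k a''_{0,jk}`. -/
def a2Sum (ξ : 𝕍) (v w : S.V S.o) : ℂ := ∑ j, ∑ k, A.a2 j k v w * (ξ j : ℂ) * (ξ k : ℂ)

theorem exists_first_order : ∃ K : ℝ, 0 ≤ K ∧ ∀ (θ : S.Θ) (v : S.V S.o) (u : H),
    ‖S.a θ v u - A.a1Sum θ v u‖ ≤ K * ‖(θ : 𝕍)‖ ^ 2 * ‖v‖ * ‖u‖ := by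
  obtain ⟨K, hK, h⟩ := A.first_order
  refine ⟨K, hK, fun θ v u => ?_⟩
  have := h θ v u
  rwa [S.nrm_zero, S.nrm_zero] at this

theorem exists_second_order : ∃ K : ℝ, 0 ≤ K ∧ ∀ (θ : S.Θ) (v w : S.V S.o),
    ‖S.a θ v w - A.a2Sum θ v w‖ ≤ K * ‖(θ : 𝕍)‖ ^ 3 * ‖v‖ * ‖w‖ := by
  obtain ⟨K, hK, h⟩ := A.second_order
  refine ⟨K, hK, fun θ v w => ?_⟩
  have := h θ v w
  rwa [S.nrm_zero, S.nrm_zero] at this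

theorem exists_a2Sum_bound : ∃ K : ℝ, 0 ≤ K ∧ ∀ (ξ : 𝕍) (v w : S.V S.o),
    ‖A.a2Sum ξ v w‖ ≤ K * ‖ξ‖ ^ 2 * ‖v‖ * ‖w‖ := by
  refine ⟨∑ j, ∑ k, ‖A.a2 j k‖, by positivity, fun ξ v w => ?_⟩
  rw [a2Sum]
  refine (norm_sum_le _ _).trans ?_
  simp only [Finset.sum_mul]
  refine Finset.sum_le_sum fun j _ => (norm_sum_le _ _).trans (Finset.sum_le_sum fun k _ => ?_)
  rw [norm_mul, norm_mul]
  calc ‖A.a2 j k v w‖ * ‖(ξ j : ℂ)‖ * ‖(ξ k : ℂ)‖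
      ≤ (‖A.a2 j k‖ * ‖v‖ * ‖w‖) * ‖ξ‖ * ‖ξ‖ := by
        gcongr
        · exact (A.a2 j k).le_opNorm₂ v w
        · exact norm_coord_le ξ j
        · exact norm_coord_le ξ k
    _ = _ := by ring

/-- On `V_0 × V_0` the second order expansion makes `a_θ` of order `|θ|²`; comparison with the first
order expansion along the `j`-th axis leaves no linear term. -/
theorem a1_eq_zero (j : Fin n) (v w : S.V S.o) : A.a1 j v w = 0 := by
  obtain ⟨r, hr, hball⟩ := A.exists_ball
  obtain ⟨K₁, hK₁, h₁⟩ := A.exists_first_order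
  obtain ⟨K₂, hK₂, h₂⟩ := A.exists_second_order
  obtain ⟨K₃, hK₃, h₃⟩ := A.exists_a2Sum_bound
  rw [← norm_le_zero_iff]
  refine le_of_forall_small (C := (K₁ + K₂ + K₃) * ‖v‖ * ‖w‖) (t₀ := min r 1) (by positivity)
    fun t ht htr => ?_
  have htr1 := lt_of_lt_of_le htr (min_le_left _ _)
  have ht1 : t ≤ 1 := (lt_of_lt_of_le htr (min_le_right _ _)).le
  set ξ : 𝕍 := EuclideanSpace.single j t with hξ
  have hξn : ‖ξ‖ = t := by
    rw [hξ, EuclideanSpace.norm_single, Real.norm_of_nonneg ht.le]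
  have hmem : ξ ∈ S.Θ := hball ξ (by rwa [hξn])
  have e1 := h₁ ⟨ξ, hmem⟩ v (w : H)
  have e2 := h₂ ⟨ξ, hmem⟩ v w
  have e3 := h₃ ξ v w
  have e4 : A.a1Sum ξ v (w : H) = A.a1 j v w * t := by
    rw [a1Sum, Finset.sum_eq_single j]
    · simp [hξ]
    · intro k _ hk
      simp [hξ, hk]
    · simp
  rw [e4] at e1
  simp only [hξn] at e1 e2 e3
  have e5 : ‖A.a1 j v w * t‖ ≤ K₁ * t ^ 2 * ‖v‖ * ‖w‖ + K₂ * t ^ 3 * ‖v‖ * ‖w‖ +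
      K₃ * t ^ 2 * ‖v‖ * ‖w‖ := by
    have : A.a1 j v w * (t : ℂ) = -(S.a ⟨ξ, hmem⟩ v w - A.a1 j v w * t) +
      (S.a ⟨ξ, hmem⟩ v w - A.a2Sum ξ v w) + A.a2Sum ξ v w := by ring
    rw [this]
    refine (norm_add_le _ _).trans (add_le_add ((norm_add_le _ _).trans (add_le_add ?_ e2)) e3)
    rw [norm_neg]
    exact e1
  rw [norm_mul, Complex.norm_real, Real.norm_of_nonneg ht.le] at e5
  have e6 : K₂ * t ^ 3 * ‖v‖ * ‖w‖ ≤ K₂ * t ^ 2 * ‖v‖ * ‖w‖ := by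
    have : t ^ 3 ≤ t ^ 2 := pow_le_pow_of_le_one ht.le ht1 (by norm_num)
    gcongr
  have e7 : ‖A.a1 j v w‖ * t ≤ ((K₁ + K₂ + K₃) * ‖v‖ * ‖w‖ * t) * t := by nlinarith
  rw [zero_add]
  exact le_of_mul_le_mul_right e7 ht

variable (h1 : S.GapCondition)

section N

include h1

/-- The gap condition at `θ = 0` makes `a_0` coercive on `W_0`, so the cell problem is solvable and
the fallback value of `N` never occurs. -/
theorem N_spec (j : Fin n) (v : S.V S.o) : A.N j v ∈ S.W S.o ∧
    ∀ w ∈ S.W S.o, S.a S.o (A.N j v) w = -A.a1 j v w := by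
  have hex : ∃ N : S.V S.o →L[ℂ] H, ∀ v, N v ∈ S.W S.o ∧
      ∀ w ∈ S.W S.o, S.a S.o (N v) w = -A.a1 j v w := by
    obtain ⟨ν, hν, hgap⟩ := exists_gap_zero h1
    have hWcl : IsClosed (S.W S.o : Set H) := by
      rw [S.W_o_eq]
      exact Submodule.isClosed_orthogonal _
    have : CompleteSpace (S.W S.o) := hWcl.completeSpace_coe
    let q : BForm (S.W S.o) := (S.a S.o).bilinearComp (S.W S.o).subtypeL (S.W S.o).subtypeL
    have hq : q.IsCoerciveHermitian :=
      ⟨fun u w => (S.isNonneg_a S.o).herm u w, ν, hν, fun w => hgap w w.2⟩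
    let ℓ : S.V S.o →L[ℂ] S.W S.o →L⋆[ℂ] ℂ :=
      (A.a1 j).bilinearComp (ContinuousLinearMap.id ℂ (S.V S.o)) (S.W S.o).subtypeL
    refine ⟨-((S.W S.o).subtypeL ∘L q.sol (ContinuousLinearMap.id ℂ (S.W S.o)) ∘L sesqRepr ℓ),
      fun v => ⟨(S.W S.o).neg_mem (Subtype.prop _), fun w hw => ?_⟩⟩
    have e1 := BForm.sol_spec hq (ContinuousLinearMap.id ℂ (S.W S.o)) (sesqRepr ℓ v) ⟨w, hw⟩
    have e2 := inner_sesqRepr ℓ v ⟨w, hw⟩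
    have e3 : S.a S.o ((q.sol (ContinuousLinearMap.id ℂ (S.W S.o)) (sesqRepr ℓ v) : S.W S.o) : H) w
        = A.a1 j v w := by
      refine Eq.trans e1 ?_
      rw [ContinuousLinearMap.id_apply, e2]
      rfl
    rw [← e3]
    simp
  rw [N, dif_pos hex]
  exact hex.choose_spec v

/-- The cell equation, posed against `W_0`, extends to all of `H` because both sides vanish on
`V_0`. -/
theorem a_N (j : Fin n) (v : S.V S.o) (u : H) : S.a S.o (A.N j v) u = -A.a1 j v u := by
  obtain ⟨v', hv', w, hw, rfl⟩ := S.exists_add_W S.o u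
  rw [map_add, map_add, S.a_right_V hv', (A.N_spec h1 j v).2 w hw]
  have := A.a1_eq_zero j v ⟨v', hv'⟩
  change A.a1 j v v' = 0 at this
  rw [this]
  ring

end N

/-- `∑ ξ_j N^j`. -/
def NSum (ξ : 𝕍) : S.V S.o →L[ℂ] H := ∑ j, (ξ j : ℂ) • A.N j

theorem NSum_apply (ξ : 𝕍) (v : S.V S.o) : A.NSum ξ v = ∑ j, (ξ j : ℂ) • A.N j v := by
  simp [NSum, sum_apply]

theorem exists_NSum_bound : ∃ K : ℝ, 0 ≤ K ∧ ∀ (ξ : 𝕍) (v : S.V S.o),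
    ‖A.NSum ξ v‖ ≤ K * ‖ξ‖ * ‖v‖ := by
  refine ⟨∑ j, ‖A.N j‖, by positivity, fun ξ v => ?_⟩
  rw [NSum_apply]
  refine (norm_sum_le _ _).trans ?_
  simp only [Finset.sum_mul]
  refine Finset.sum_le_sum fun j _ => ?_
  rw [norm_smul]
  calc ‖(ξ j : ℂ)‖ * ‖A.N j v‖ ≤ ‖ξ‖ * (‖A.N j‖ * ‖v‖) := by
        gcongr
        · exact norm_coord_le ξ j
        · exact (A.N j).le_opNorm v
    _ = _ := by ring

/-- The form `a^h_ξ` on `V_0`. -/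
def ahForm (ξ : 𝕍) : BForm (S.V S.o) := ∑ j, ∑ k, ((ξ j : ℂ) * (ξ k : ℂ)) • A.ah j k

theorem ahForm_apply (ξ : 𝕍) (v w : S.V S.o) :
    A.ahForm ξ v w = ∑ j, ∑ k, (ξ j : ℂ) * (ξ k : ℂ) * A.ah j k v w := by
  simp [ahForm, sum_apply]

theorem ahForm_eq (ξ : 𝕍) (v w : S.V S.o) :
    A.ahForm ξ v w = A.a2Sum ξ v w - S.a S.o (A.NSum ξ v) (A.NSum ξ w) := by
  have e1 : S.a S.o (A.NSum ξ v) (A.NSum ξ w) =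
      ∑ j, ∑ k, (ξ j : ℂ) * (ξ k : ℂ) * S.a S.o (A.N j v) (A.N k w) := by
    simp only [NSum_apply, map_sum, map_smulₛₗ, sum_apply, smul_apply, smul_eq_mul,
      Complex.conj_ofReal, RingHom.id_apply, Finset.mul_sum]
    rw [Finset.sum_comm]
    refine Finset.sum_congr rfl fun j _ => Finset.sum_congr rfl fun k _ => ?_
    ring
  rw [ahForm_apply, a2Sum, e1, ← Finset.sum_sub_distrib]
  refine Finset.sum_congr rfl fun j _ => ?_
  rw [← Finset.sum_sub_distrib]
  refine Finset.sum_congr rfl fun k _ => ?_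
  have : A.ah j k v w = A.a2 j k v w - S.a S.o (A.N j v) (A.N k w) := rfl
  rw [this]
  ring

theorem ahForm_smul (t : ℝ) (ξ : 𝕍) (v w : S.V S.o) :
    A.ahForm (t • ξ) v w = (t : ℂ) ^ 2 * A.ahForm ξ v w := by
  simp only [ahForm_apply, Finset.mul_sum]
  refine Finset.sum_congr rfl fun j _ => Finset.sum_congr rfl fun k _ => ?_
  simp
  ring

include h1 in
/-- The corrected vector `v + N_θ v` almost annihilates `a_θ`. -/
theorem exists_a_corrected : ∃ K : ℝ, 0 ≤ K ∧ ∀ (θ : S.Θ) (v : S.V S.o) (u : H),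
    ‖S.a θ (v + A.NSum θ v) u‖ ≤ K * ‖(θ : 𝕍)‖ ^ 2 * ‖v‖ * ‖u‖ := by
  obtain ⟨K₁, hK₁, h₁⟩ := A.exists_first_order
  obtain ⟨K₂, hK₂, h₂⟩ := S.exists_lipschitz_a
  obtain ⟨K₃, hK₃, h₃⟩ := A.exists_NSum_bound
  refine ⟨K₁ + K₂ * K₃, by positivity, fun θ v u => ?_⟩
  have e1 : S.a S.o (A.NSum θ v) u = -A.a1Sum θ v u := by
    simp only [NSum_apply, map_sum, map_smulₛₗ, sum_apply, smul_apply, smul_eq_mul,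
      RingHom.id_apply, A.a_N h1, a1Sum, ← Finset.sum_neg_distrib]
    exact Finset.sum_congr rfl fun j _ => by ring
  -- The corrector cancels the linear term of `a_θ(v, u)`. What remains is the first order remainder
  -- and the change from `a_0` to `a_θ` on a corrector of size `O(|θ|)`.
  have e2 : S.a θ (v + A.NSum θ v) u = (S.a θ v u - A.a1Sum θ v u) +
      (S.a θ (A.NSum θ v) u - S.a S.o (A.NSum θ v) u) := by
    rw [e1, map_add, add_apply]
    ring
  rw [e2]
  calc _ ≤ K₁ * ‖(θ : 𝕍)‖ ^ 2 * ‖v‖ * ‖u‖ + K₂ * ‖(θ : 𝕍)‖ * (K₃ * ‖(θ : 𝕍)‖ * ‖v‖) * ‖u‖ := by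
        refine (norm_add_le _ _).trans (add_le_add (h₁ θ v u) ((h₂ θ _ u).trans ?_))
        gcongr
        exact h₃ θ v
    _ = _ := by ring

include h1 in
/-- On corrected vectors `a_θ` is the homogenised form up to third order. -/
theorem exists_a_corrected_corrected : ∃ K : ℝ, 0 ≤ K ∧ ∀ (θ : S.Θ) (v w : S.V S.o),
    ‖S.a θ (v + A.NSum θ v) (w + A.NSum θ w) - A.ahForm θ v w‖ ≤
      K * ‖(θ : 𝕍)‖ ^ 3 * ‖v‖ * ‖w‖ := by
  obtain ⟨K₁, hK₁, h₁⟩ := A.exists_first_order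
  obtain ⟨K₂, hK₂, h₂⟩ := A.exists_second_order
  obtain ⟨K₃, hK₃, h₃⟩ := A.exists_NSum_bound
  obtain ⟨K₄, hK₄, h₄⟩ := A.exists_a_corrected h1
  refine ⟨K₄ * K₃ + K₂ + K₁ * K₃, by positivity, fun θ v w => ?_⟩
  have e1 : S.a S.o (A.NSum θ w) (A.NSum θ v) = -A.a1Sum θ w (A.NSum θ v) := by
    conv_lhs => rw [NSum_apply A _ w]
    simp only [map_sum, map_smulₛₗ, sum_apply, smul_apply, smul_eq_mul,
      RingHom.id_apply, A.a_N h1, a1Sum, ← Finset.sum_neg_distrib]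
    exact Finset.sum_congr rfl fun j _ => by ring
  have e2 : S.a θ (v + A.NSum θ v) (w + A.NSum θ w) - A.ahForm θ v w =
      S.a θ (v + A.NSum θ v) (A.NSum θ w) + (S.a θ v w - A.a2Sum θ v w) +
        starRingEnd ℂ (S.a θ w (A.NSum θ v) - A.a1Sum θ w (A.NSum θ v)) := by
    have e3 : A.a1Sum θ w (A.NSum θ v) = -S.a S.o (A.NSum θ w) (A.NSum θ v) := by rw [e1, neg_neg]
    rw [ahForm_eq, e3, map_sub, map_neg, ← (S.isNonneg_a θ).herm, ← (S.isNonneg_a S.o).herm]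
    simp only [map_add, add_apply]
    ring
  rw [e2]
  calc _ ≤ K₄ * ‖(θ : 𝕍)‖ ^ 2 * ‖v‖ * (K₃ * ‖(θ : 𝕍)‖ * ‖w‖) + K₂ * ‖(θ : 𝕍)‖ ^ 3 * ‖v‖ * ‖w‖ +
        K₁ * ‖(θ : 𝕍)‖ ^ 2 * ‖w‖ * (K₃ * ‖(θ : 𝕍)‖ * ‖v‖) := by
        refine (norm_add_le _ _).trans (add_le_add ((norm_add_le _ _).trans (add_le_add ?_ ?_)) ?_)
        · refine (h₄ θ v _).trans ?_
          gcongr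
          exact h₃ θ w
        · exact h₂ θ v w
        · rw [RCLike.norm_conj]
          refine (h₁ θ w _).trans ?_
          gcongr
          exact h₃ θ v
    _ = _ := by ring

include h1 in
-- `a_θ` is Hermitian on corrected vectors, and the homogenised form is its second order limit along
-- `θ = tξ`.
theorem ahForm_herm (ξ : 𝕍) (v w : S.V S.o) :
    A.ahForm ξ v w = starRingEnd ℂ (A.ahForm ξ w v) := by
  obtain ⟨r, hr, hball⟩ := A.exists_ball
  obtain ⟨K, hK, h⟩ := A.exists_a_corrected_corrected h1
  rw [← sub_eq_zero, ← norm_le_zero_iff]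
  refine le_of_forall_small (C := 2 * K * ‖ξ‖ ^ 3 * ‖v‖ * ‖w‖) (t₀ := r / (‖ξ‖ + 1)) (by positivity)
    fun t ht htr => ?_
  have hn : ‖t • ξ‖ = t * ‖ξ‖ := by rw [norm_smul, Real.norm_of_nonneg ht.le]
  have hmem : t • ξ ∈ S.Θ := by
    refine hball _ ?_
    rw [hn]
    rw [lt_div_iff₀ (by positivity)] at htr
    nlinarith
  have e1 := h ⟨t • ξ, hmem⟩ v w
  have e2 := h ⟨t • ξ, hmem⟩ w v
  rw [← RCLike.norm_conj, map_sub, ← (S.isNonneg_a _).herm] at e2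
  simp only [ahForm_smul, hn, map_mul, map_pow, Complex.conj_ofReal] at e1 e2
  have e3 : ‖((t : ℂ) ^ 2 * A.ahForm ξ v w) - (t : ℂ) ^ 2 * starRingEnd ℂ (A.ahForm ξ w v)‖ ≤
      K * (t * ‖ξ‖) ^ 3 * ‖v‖ * ‖w‖ + K * (t * ‖ξ‖) ^ 3 * ‖w‖ * ‖v‖ := by
    rw [norm_sub_rev] at e1
    refine le_trans ?_ ((norm_add_le _ _).trans (add_le_add e1 e2))
    apply le_of_eq
    congr 1
    ring
  rw [← mul_sub, norm_mul, norm_pow, Complex.norm_real, Real.norm_of_nonneg ht.le] at e3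
  rw [zero_add]
  refine le_of_mul_le_mul_left ?_ (by positivity : 0 < t ^ 2)
  calc _ ≤ _ := e3
    _ = _ := by ring

include A in
/-- Coercivity of `a_θ` transversally to `V^⋆_θ`, for small `θ`. -/
theorem exists_a_lower (h1 : S.GapCondition) (h2 : P.RemovableSingularity)
    (h3 : S.QuadraticGap) : ∃ δ C : ℝ, 0 < δ ∧ 0 ≤ C ∧
    ∀ θ : S.Θ, ‖(θ : 𝕍)‖ ≤ δ → ∀ z ∈ P.Z, ∀ w ∈ S.W S.o,
      ‖(θ : 𝕍)‖ * ‖z‖ ≤ C * (S.a θ).en (z + w) ∧ ‖w‖ ≤ C * (S.a θ).en (z + w) := by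
  obtain ⟨δ, C, hδ, hC, hdec⟩ := P.exists_decomposition h2
  obtain ⟨γ, hγ, hgap⟩ := h3
  obtain ⟨ν, hν, hgap0⟩ := exists_gap_zero h1
  obtain ⟨K, hK, hKu⟩ := S.exists_nrm_equiv
  obtain ⟨L, hL, hlip⟩ := S.exists_lipschitz_a
  obtain ⟨K₂, hK₂, h₂⟩ := A.exists_second_order
  obtain ⟨K₃, hK₃, h₃⟩ := A.exists_a2Sum_bound
  -- first part
  have hfirst : ∀ θ : S.Θ, ‖(θ : 𝕍)‖ ≤ δ → ∀ z ∈ P.Z, ∀ w ∈ S.W S.o,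
      ‖(θ : 𝕍)‖ * ‖z‖ ≤ (C * K / √γ) * (S.a θ).en (z + w) := by
    intro θ hθ z hz w hw
    by_cases h0 : θ = S.o
    · have : (θ : 𝕍) = 0 := by rw [h0]; rfl
      rw [this, norm_zero, zero_mul]
      have := (S.a θ).en_nonneg (z + w)
      positivity
    -- Removing the kernel part of `z + w` leaves the energy unchanged. Since `w' = -v + z + w`, the
    -- stable decomposition bounds `z` by `w'`, to which the quadratic gap applies.
    obtain ⟨v, hv, w', hw', heq⟩ := S.exists_add_W θ (z + w)
    have hv' : -v ∈ P.Vstar θ := by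
      rw [P.Vstar_of_ne h0]
      exact (S.V θ).neg_mem hv
    have e1 : -v + z + w = w' := by rw [add_assoc, heq]; abel
    have e2 := ((hdec θ hθ).1 (-v) hv' z hz w hw).2.1
    rw [e1] at e2
    have e3 : (S.a θ).en (z + w) = (S.a θ).en w' := by
      rw [heq]
      simp only [BForm.en, map_add, add_apply, S.a_left_V hv, S.a_right_V hv, zero_add]
    rw [e3]
    have e4 := hgap θ w' hw'
    rw [← (S.isNonneg_a θ).en_sq] at e4
    have e5 : √γ * ‖(θ : 𝕍)‖ * S.nrm θ w' ≤ (S.a θ).en w' := by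
      have h5 : (√γ * ‖(θ : 𝕍)‖ * S.nrm θ w') ^ 2 ≤ (S.a θ).en w' ^ 2 := by
        rw [mul_pow, mul_pow, Real.sq_sqrt hγ.le]
        exact e4
      exact (abs_le_of_sq_le_sq' h5 (BForm.en_nonneg _ _)).2
    have hs : 0 < √γ := Real.sqrt_pos.2 hγ
    rw [div_mul_eq_mul_div, le_div_iff₀ hs]
    calc ‖(θ : 𝕍)‖ * ‖z‖ * √γ ≤ ‖(θ : 𝕍)‖ * (C * (K * S.nrm θ w')) * √γ := by
          gcongr
          refine e2.trans ?_
          gcongr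
          exact (hKu θ w').2
      _ = C * K * (√γ * ‖(θ : 𝕍)‖ * S.nrm θ w') := by ring
      _ ≤ C * K * (S.a θ).en w' := by gcongr
  set C₁ := C * K / √γ
  have hC₁ : 0 ≤ C₁ := by positivity
  set D := √(K₂ + K₃) with hD
  have hsν : 0 < √(ν / 2) := Real.sqrt_pos.2 (by positivity)
  set C₂ := (1 + D * C₁) / √(ν / 2)
  refine ⟨min δ (min 1 (ν / (2 * (L + 1)))), C₁ + C₂, by positivity, by positivity,
    fun θ hθ z hz w hw => ?_⟩
  have hθ1 := hθ.trans (min_le_left _ _)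
  have hθ2 := (hθ.trans (min_le_right _ _)).trans (min_le_left _ _)
  have hθ3 := (hθ.trans (min_le_right _ _)).trans (min_le_right _ _)
  have f1 := hfirst θ hθ1 z hz w hw
  have f0 := (S.a θ).en_nonneg (z + w)
  -- By the second order expansion `z` alone has energy `O(|θ| ‖z‖)`, already controlled by the
  -- first part. The triangle inequality then bounds the energy of `w`.
  have f2 : (S.a θ).en z ≤ D * (‖(θ : 𝕍)‖ * ‖z‖) := by
    have g1 : (S.a θ z z).re ≤ (K₂ + K₃) * (‖(θ : 𝕍)‖ * ‖z‖) ^ 2 := by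
      have g2 := h₂ θ (P.inclZ ⟨z, hz⟩) (P.inclZ ⟨z, hz⟩)
      have g3 := h₃ θ (P.inclZ ⟨z, hz⟩) (P.inclZ ⟨z, hz⟩)
      have g4 : ‖S.a θ z z‖ ≤ _ := (norm_le_norm_sub_add _ _).trans (add_le_add g2 g3)
      have g5 : ‖P.inclZ ⟨z, hz⟩‖ = ‖z‖ := rfl
      rw [g5] at g4
      have g6 : K₂ * ‖(θ : 𝕍)‖ ^ 3 * ‖z‖ * ‖z‖ ≤ K₂ * ‖(θ : 𝕍)‖ ^ 2 * ‖z‖ * ‖z‖ := by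
        have : ‖(θ : 𝕍)‖ ^ 3 ≤ ‖(θ : 𝕍)‖ ^ 2 :=
          pow_le_pow_of_le_one (norm_nonneg _) hθ2 (by norm_num)
        gcongr
      have g7 := (Complex.re_le_norm _).trans g4
      nlinarith
    rw [BForm.en, hD]
    calc √(S.a θ z z).re ≤ √((K₂ + K₃) * (‖(θ : 𝕍)‖ * ‖z‖) ^ 2) := Real.sqrt_le_sqrt g1
      _ = _ := by rw [Real.sqrt_mul (by positivity), Real.sqrt_sq (by positivity)]
  -- Lipschitz continuity of `a_θ` keeps half of the gap at `θ = 0` on `W_0`.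
  have f3 : √(ν / 2) * ‖w‖ ≤ (S.a θ).en w := by
    have g1 := hgap0 w hw
    have g2 := (Complex.re_le_norm _).trans (hlip θ w w)
    have g2' : -(S.a θ w w - S.a S.o w w).re ≤ L * ‖(θ : 𝕍)‖ * ‖w‖ * ‖w‖ :=
      ((neg_le_abs _).trans (Complex.abs_re_le_norm _)).trans (hlip θ w w)
    rw [Complex.sub_re] at g2'
    have g3 : L * ‖(θ : 𝕍)‖ ≤ ν / 2 := by
      have g4 : ‖(θ : 𝕍)‖ * (2 * (L + 1)) ≤ ν := by
        rwa [le_div_iff₀ (by positivity)] at hθ3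
      nlinarith [norm_nonneg (θ : 𝕍)]
    have g5 : L * ‖(θ : 𝕍)‖ * ‖w‖ * ‖w‖ ≤ ν / 2 * ‖w‖ * ‖w‖ := by gcongr
    have g6 : ν / 2 * ‖w‖ ^ 2 ≤ (S.a θ w w).re := by nlinarith
    calc √(ν / 2) * ‖w‖ = √(ν / 2 * ‖w‖ ^ 2) := by
          rw [Real.sqrt_mul (by positivity), Real.sqrt_sq (norm_nonneg _)]
      _ ≤ _ := Real.sqrt_le_sqrt g6
  have f4 := (S.isNonneg_a θ).en_le_add_sub z w
  constructor
  · have : 0 ≤ C₂ * (S.a θ).en (z + w) := by positivity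
    nlinarith
  · have f5 : √(ν / 2) * ‖w‖ ≤ (1 + D * C₁) * (S.a θ).en (z + w) := by
      have : D * (‖(θ : 𝕍)‖ * ‖z‖) ≤ D * (C₁ * (S.a θ).en (z + w)) := by gcongr
      linarith
    have f6 : ‖w‖ ≤ C₂ * (S.a θ).en (z + w) := by
      rw [div_mul_eq_mul_div, le_div_iff₀ hsν]
      linarith
    have : 0 ≤ C₁ * (S.a θ).en (z + w) := by positivity
    linarith

include h1 in
/-- The homogenised form is coercive on `Z`. -/
theorem exists_ahForm_lower (h2 : P.RemovableSingularity) (h3 : S.QuadraticGap) :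
    ∃ c : ℝ, 0 < c ∧ ∀ (ξ : 𝕍) (z : P.Z),
      c * ‖ξ‖ ^ 2 * ‖z‖ ^ 2 ≤ (A.ahForm ξ (P.inclZ z) (P.inclZ z)).re := by
  obtain ⟨r, hr, hball⟩ := A.exists_ball
  obtain ⟨K, hK, h⟩ := A.exists_a_corrected_corrected h1
  obtain ⟨δ, C, hδ, hC, hlow⟩ := A.exists_a_lower P h1 h2 h3
  -- `C + 1` is inverted because `C` is allowed to vanish.
  refine ⟨((C + 1) ^ 2)⁻¹, by positivity, fun ξ z => ?_⟩
  refine le_of_forall_small (C := K * ‖ξ‖ ^ 3 * ‖z‖ * ‖z‖) (t₀ := min r δ / (‖ξ‖ + 1))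
    (by positivity) fun t ht htr => ?_
  have hn : ‖t • ξ‖ = t * ‖ξ‖ := by rw [norm_smul, Real.norm_of_nonneg ht.le]
  have hlt : ‖t • ξ‖ < min r δ := by
    rw [hn]
    rw [lt_div_iff₀ (by positivity)] at htr
    nlinarith
  have hmem : t • ξ ∈ S.Θ := hball _ (lt_of_lt_of_le hlt (min_le_left _ _))
  -- The corrector lies in `W_0`, so the transversal lower bound applies to the corrected vector,
  -- whose energy is `t² a^h_ξ` up to `O(t³)`.
  have hW : A.NSum (t • ξ) (P.inclZ z) ∈ S.W S.o := by
    rw [NSum_apply]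
    exact Submodule.sum_mem _ fun j _ => Submodule.smul_mem _ _ (A.N_spec h1 j _).1
  have e1 := (hlow ⟨t • ξ, hmem⟩ (lt_of_lt_of_le hlt (min_le_right _ _)).le z z.2 _ hW).1
  have e2 := h ⟨t • ξ, hmem⟩ (P.inclZ z) (P.inclZ z)
  have hzn : ‖P.inclZ z‖ = ‖z‖ := rfl
  rw [ahForm_smul] at e2
  simp only [hn, hzn] at e1 e2
  set U : H := P.inclZ z + A.NSum (t • ξ) (P.inclZ z) with hU
  have e3 : (S.a ⟨t • ξ, hmem⟩ U U).re - t ^ 2 * (A.ahForm ξ (P.inclZ z) (P.inclZ z)).re ≤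
      K * (t * ‖ξ‖) ^ 3 * ‖z‖ * ‖z‖ := by
    have := (Complex.re_le_norm _).trans e2
    rwa [Complex.sub_re, ← Complex.ofReal_pow, Complex.re_ofReal_mul] at this
  rw [← (S.isNonneg_a _).en_sq] at e3
  have e4 : (t * ‖ξ‖ * ‖z‖) ^ 2 ≤ (C + 1) ^ 2 * (S.a ⟨t • ξ, hmem⟩).en U ^ 2 := by
    rw [← mul_pow]
    have h0 := (S.a ⟨t • ξ, hmem⟩).en_nonneg U
    have e1' : t * ‖ξ‖ * ‖z‖ ≤ C * (S.a ⟨t • ξ, hmem⟩).en U := e1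
    refine pow_le_pow_left₀ (by positivity) ?_ 2
    linarith
  have e5 : ((C + 1) ^ 2)⁻¹ * (t * ‖ξ‖ * ‖z‖) ^ 2 ≤ (S.a ⟨t • ξ, hmem⟩).en U ^ 2 := by
    rw [inv_mul_le_iff₀ (by positivity)]
    exact e4
  refine le_of_mul_le_mul_left ?_ (by positivity : 0 < t ^ 2)
  calc t ^ 2 * (((C + 1) ^ 2)⁻¹ * ‖ξ‖ ^ 2 * ‖z‖ ^ 2) = ((C + 1) ^ 2)⁻¹ * (t * ‖ξ‖ * ‖z‖) ^ 2 := by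
        ring
    _ ≤ t ^ 2 * (A.ahForm ξ (P.inclZ z) (P.inclZ z)).re + K * (t * ‖ξ‖) ^ 3 * ‖z‖ * ‖z‖ := by
        linarith
    _ = _ := by ring

/-! ### The fibre forms on `V_0` -/

/-- The form `𝕊_ξ` on `V_0`. -/
def fibreForm (ξ : 𝕍) : BForm (S.V S.o) :=
  (A.ahForm ξ).bilinearComp (P.inclZ.comp P.projZ) (P.inclZ.comp P.projZ) + S.b0 (S.V S.o)

theorem fibreForm_apply (ξ : 𝕍) (u w : S.V S.o) : A.fibreForm P ξ u w =
    A.ahForm ξ (P.inclZ (P.projZ u)) (P.inclZ (P.projZ w)) + S.b S.o u w := rfl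

include A in
theorem b_self_V (u : S.V S.o) : (S.b S.o u u).re = ‖u‖ ^ 2 := by
  rw [S.b_zero_eq_inner u.2, inner_self_eq_norm_sq_to_K]
  change (((‖(u : H)‖ : ℂ)) ^ 2).re = ‖(u : H)‖ ^ 2
  rw [← Complex.ofReal_pow, Complex.ofReal_re]

/-- Uniform coercivity of the fibre forms. -/
structure FibreBound (c : ℝ) : Prop where
  pos : 0 < c
  herm : ∀ (ξ : 𝕍) (u w : S.V S.o), A.fibreForm P ξ u w = starRingEnd ℂ (A.fibreForm P ξ w u)
  lower : ∀ (ξ : 𝕍) (u : S.V S.o),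
    ‖u‖ ^ 2 + c * ‖ξ‖ ^ 2 * ‖P.projZ u‖ ^ 2 ≤ (A.fibreForm P ξ u u).re

include h1 in
theorem exists_fibreBound (h2 : P.RemovableSingularity) (h3 : S.QuadraticGap) :
    ∃ c, A.FibreBound P c := by
  obtain ⟨c, hc, h⟩ := A.exists_ahForm_lower P h1 h2 h3
  refine ⟨c, hc, fun ξ u w => ?_, fun ξ u => ?_⟩
  · rw [fibreForm_apply, fibreForm_apply, map_add, ← A.ahForm_herm h1, ← (S.isNonneg_b S.o).herm]
  · rw [fibreForm_apply, Complex.add_re, A.b_self_V, add_comm]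
    exact add_le_add (h ξ _) le_rfl

variable {A P} {c : ℝ} (hc : A.FibreBound P c)
include hc

theorem FibreBound.coercive (ξ : 𝕍) : (A.fibreForm P ξ).IsCoerciveHermitian := by
  refine ⟨hc.herm ξ, 1, one_pos, fun u => ?_⟩
  have := hc.lower ξ u
  have h2 : 0 ≤ c * ‖ξ‖ ^ 2 * ‖P.projZ u‖ ^ 2 := by
    have := hc.pos
    positivity
  linarith

/-- Bounds for the solutions of fibre equations whose right-hand side has norm at most `F`. -/
theorem FibreBound.sol_bound {ξ : 𝕍} {s : S.V S.o} {F : ℝ} (hF : 0 ≤ F)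
    (hs : ∀ w, ‖A.fibreForm P ξ s w‖ ≤ F * ‖w‖) :
    ‖s‖ ≤ F ∧ c * ‖ξ‖ ^ 2 * ‖P.projZ s‖ ≤ 2 * F := by
  have hpos := hc.pos
  have h1 := (hc.lower ξ s).trans ((Complex.re_le_norm _).trans (hs s))
  have h2 : 0 ≤ c * ‖ξ‖ ^ 2 * ‖P.projZ s‖ ^ 2 := by positivity
  have h3 : ‖s‖ ≤ F := by
    by_contra! h
    nlinarith [norm_nonneg s]
  refine ⟨h3, ?_⟩
  set z := P.projZ s
  have h4 : c * ‖ξ‖ ^ 2 * ‖z‖ ^ 2 ≤ (A.ahForm ξ (P.inclZ z) (P.inclZ z)).re := by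
    have h5 := hc.lower ξ (P.inclZ z)
    rw [fibreForm_apply, Complex.add_re, A.b_self_V, P.projZ_inclZ] at h5
    linarith
  -- Testing with the `Z`-component isolates the homogenised form, and both terms on the right are
  -- bounded linearly in `‖z‖`. Cancelling one factor `‖z‖` yields the full power `|ξ|²`, more than
  -- the energy estimate would give.
  have h5 : A.ahForm ξ (P.inclZ z) (P.inclZ z) =
      A.fibreForm P ξ s (P.inclZ z) - S.b S.o s (P.inclZ z) := by
    rw [fibreForm_apply, P.projZ_inclZ]
    ring
  have h6 : ‖S.b S.o s (P.inclZ z : H)‖ ≤ ‖s‖ * ‖z‖ := by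
    rw [S.b_zero_eq_inner s.2]
    exact (norm_inner_le_norm _ _).trans (le_of_eq (mul_comm _ _))
  have h7 : c * ‖ξ‖ ^ 2 * ‖z‖ ^ 2 ≤ F * ‖z‖ + F * ‖z‖ := by
    refine h4.trans ((Complex.re_le_norm _).trans ?_)
    rw [h5]
    refine (norm_sub_le _ _).trans (add_le_add (hs (P.inclZ z)) (h6.trans ?_))
    gcongr
  rcases (norm_nonneg z).eq_or_lt with h0 | h0
  · rw [← h0, mul_zero]
    positivity
  · refine le_of_mul_le_mul_right ?_ h0
    nlinarith

end Expansion

end Setting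

theorem formGraph_comp_surjective {E F Y : Type*} [AddCommGroup E] [Module ℂ E] [AddCommGroup F]
    [Module ℂ F] [NormedAddCommGroup Y] [NormedSpace ℂ Y] (d : BForm Y) (j : F →ₗ[ℂ] Y)
    {q : SForm F} {q' : SForm E} {e : E →ₗ[ℂ] F} (he : Function.Surjective e)
    (hq : ∀ u w, q' u w = q (e u) (e w)) : formGraph d (j ∘ₗ e) q' = formGraph d j q := by
  ext p
  simp only [mem_formGraph]
  constructor
  · rintro ⟨u, hu, h⟩
    refine ⟨e u, hu, fun w => ?_⟩
    obtain ⟨w, rfl⟩ := he w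
    rw [← hq]
    exact h w
  · rintro ⟨u, hu, h⟩
    obtain ⟨u, rfl⟩ := he u
    refine ⟨u, hu, fun w => ?_⟩
    rw [hq]
    exact h _

namespace BForm

variable {E Y : Type*} [NormedAddCommGroup E] [InnerProductSpace ℂ E] [CompleteSpace E]
  [NormedAddCommGroup Y] [InnerProductSpace ℂ Y] [CompleteSpace Y]

theorem continuous_sol {Ξ : Type*} [TopologicalSpace Ξ] {q : Ξ → BForm E}
    (hq : Continuous fun ξ => (q ξ).repr)
    (hco : ∀ ξ, (q ξ).IsCoerciveHermitian) (j : E →L[ℂ] Y) :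
    Continuous fun ξ => (q ξ).sol j := by
  refine continuous_iff_continuousAt.2 fun ξ => ?_
  obtain ⟨u, hu⟩ := isUnit_repr (hco ξ)
  have h1 : ContinuousAt (fun ξ => Ring.inverse (q ξ).repr) ξ := by
    have h2 := NormedRing.inverse_continuousAt u
    rw [hu] at h2
    exact ContinuousAt.comp (f := fun ξ => (q ξ).repr) h2 hq.continuousAt
  exact h1.clm_comp continuousAt_const

end BForm

theorem norm_le_of_mem_spectrum_clm {Y : Type*} [NormedAddCommGroup Y] [NormedSpace ℂ Y]
    [CompleteSpace Y] {T : Y →L[ℂ] Y} {ν : ℂ} (h : ν ∈ spectrum ℂ T) : ‖ν‖ ≤ ‖T‖ := by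
  refine (spectrum.norm_le_norm_mul_of_mem h).trans ?_
  exact mul_le_of_le_one_right (norm_nonneg _) ContinuousLinearMap.norm_id_le

/-! ### The fibre operators and their inverses -/

namespace Setting

variable {n : ℕ} {H X : Type*} [NormedAddCommGroup H] [InnerProductSpace ℂ H] [CompleteSpace H]
  [NormedAddCommGroup X] [InnerProductSpace ℂ X] [CompleteSpace X] {S : Setting n H X}

local notation "𝕍" => EuclideanSpace ℝ (Fin n)

theorem norm_emb_le (U : Submodule ℂ H) (u : U) : ‖S.emb U u‖ ≤ ‖u‖ := S.norm_J_le u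

theorem emb_injective (U : Submodule ℂ H) : Function.Injective (S.emb U) := fun _ _ h =>
  Subtype.ext (S.J_injective (congrArg Subtype.val h))

theorem emb_denseRange (U : Submodule ℂ H) : DenseRange (S.emb U) := by
  intro x
  have h1 : (Subtype.val '' range (S.emb U) : Set X) = (U.map S.J.toLinearMap : Set X) := by
    rw [← range_comp]
    ext y
    simp only [mem_range, Function.comp, Submodule.map_coe, mem_image]
    constructor
    · rintro ⟨u, rfl⟩
      exact ⟨u, u.2, rfl⟩
    · rintro ⟨u, hu, rfl⟩
      exact ⟨⟨u, hu⟩, rfl⟩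
  rw [closure_subtype, h1]
  exact x.2

theorem emb_isCompactOperator (U : Submodule ℂ H) : IsCompactOperator (S.emb U) :=
  (S.J_compact.comp_clm U.subtypeL).codRestrict
    (fun u => Submodule.le_topologicalClosure _ (Submodule.mem_map_of_mem u.2))
    (Submodule.isClosed_topologicalClosure _)

namespace Expansion

variable {A : S.Expansion} {P : S.Splitting}

theorem opLxi_eq (A : S.Expansion) (P : S.Splitting) (ξ : 𝕍) : A.opLxi P ξ =
    formOperator (innerForm (S.clos (S.V S.o))) (S.emb (S.V S.o)).toLinearMap
      (A.fibreForm P ξ).toSForm := by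
  refine congrArg Submodule.toLinearPMap
    (formGraph_comp_surjective _ (S.emb (S.V S.o)).toLinearMap
    (e := (P.inclVs.coprod P.inclZ).toLinearMap) P.coprod_surjective ?_)
  rintro ⟨v, z⟩ ⟨v', z'⟩
  have e1 : (P.inclVs.coprod P.inclZ) (v, z) = P.inclVs v + P.inclZ z := rfl
  have e2 : (P.inclVs.coprod P.inclZ) (v', z') = P.inclVs v' + P.inclZ z' := rfl
  change A.formS P ξ (v, z) (v', z') =
    A.fibreForm P ξ ((P.inclVs.coprod P.inclZ) (v, z)) ((P.inclVs.coprod P.inclZ) (v', z'))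
  rw [e1, e2, fibreForm_apply, P.projZ_add, P.projZ_add, ahForm_apply]
  simp only [formS, add_apply, ContinuousLinearMap.bilinearComp_apply, sum_apply, smul_apply, ahZ,
    smul_eq_mul]
  rfl

/-- The representing operator is a quadratic polynomial in `ξ` with bounded operator coefficients.
-/
theorem continuous_repr_fibreForm : Continuous fun ξ : 𝕍 => (A.fibreForm P ξ).repr := by
  have h : (fun ξ : 𝕍 => (A.fibreForm P ξ).repr) = fun ξ : 𝕍 =>
      (∑ j, ∑ k, ((ξ j : ℂ) * (ξ k : ℂ)) • BForm.repr ((A.ah j k).bilinearComp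
        (P.inclZ.comp P.projZ) (P.inclZ.comp P.projZ))) + (S.b0 (S.V S.o)).repr := by
    funext ξ
    ext1 u
    refine ext_inner_left ℂ fun w => ?_
    rw [BForm.inner_repr, fibreForm_apply, ahForm_apply, add_apply, inner_add_right,
      BForm.inner_repr]
    refine congrArg₂ (· + ·) ?_ rfl
    simp only [sum_apply, smul_apply, inner_sum, inner_smul_right, BForm.inner_repr]
    rfl
  rw [h]
  have hco : ∀ j k : Fin n, Continuous fun ξ : 𝕍 => (ξ j : ℂ) * (ξ k : ℂ) := by fun_prop
  exact (continuous_finsetSum _ fun j _ => continuous_finsetSum _ fun k _ =>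
    (hco j k).smul continuous_const).add continuous_const

variable (A P) in
/-- The solution operator of the fibre problem. -/
def fibreSol (ξ : 𝕍) : S.clos (S.V S.o) →L[ℂ] S.V S.o :=
  (A.fibreForm P ξ).sol (S.emb (S.V S.o))

variable (A P) in
/-- The inverse of `𝕃_ξ`. -/
def fibreInv (ξ : 𝕍) : S.clos (S.V S.o) →L[ℂ] S.clos (S.V S.o) :=
  (A.fibreForm P ξ).inv (S.emb (S.V S.o))

namespace FibreBound

variable {c : ℝ} (hc : A.FibreBound P c)
include hc

theorem fibreSol_spec (ξ : 𝕍) (g : S.clos (S.V S.o)) (w : S.V S.o) :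
    A.fibreForm P ξ (A.fibreSol P ξ g) w = inner ℂ (S.emb (S.V S.o) w) g :=
  BForm.sol_spec (hc.coercive ξ) _ g w

theorem fibreSol_bound (ξ : 𝕍) (g : S.clos (S.V S.o)) : ‖A.fibreSol P ξ g‖ ≤ ‖g‖ ∧
    c * ‖ξ‖ ^ 2 * ‖P.projZ (A.fibreSol P ξ g)‖ ≤ 2 * ‖g‖ := by
  refine hc.sol_bound (norm_nonneg g) fun w => ?_
  rw [hc.fibreSol_spec]
  refine (norm_inner_le_norm _ _).trans ?_
  rw [mul_comm]
  gcongr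
  exact S.norm_emb_le _ w

theorem norm_fibreSol_le (ξ : 𝕍) : ‖A.fibreSol P ξ‖ ≤ 1 :=
  ContinuousLinearMap.opNorm_le_bound _ zero_le_one fun g => by
    rw [one_mul]
    exact (hc.fibreSol_bound ξ g).1

theorem norm_fibreInv_le (ξ : 𝕍) : ‖A.fibreInv P ξ‖ ≤ 1 :=
  ContinuousLinearMap.opNorm_le_bound _ zero_le_one fun g => by
    rw [one_mul]
    exact (S.norm_emb_le _ _).trans (hc.fibreSol_bound ξ g).1

theorem continuous_fibreSol : Continuous (A.fibreSol P) :=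
  BForm.continuous_sol continuous_repr_fibreForm hc.coercive _

theorem continuous_fibreInv : Continuous (A.fibreInv P) :=
  continuous_const.clm_comp hc.continuous_fibreSol

theorem isSelfAdjoint_fibreInv (ξ : 𝕍) : IsSelfAdjoint (A.fibreInv P ξ) :=
  BForm.isSelfAdjoint_inv (hc.coercive ξ) _

theorem fibreInv_injective (ξ : 𝕍) : Function.Injective (A.fibreInv P ξ) :=
  BForm.inv_injective (hc.coercive ξ) _ (S.emb_denseRange _)

theorem sp_opLxi (ξ : 𝕍) :
    Sp (A.opLxi P ξ) = {lam : ℂ | lam ≠ 0 ∧ lam⁻¹ ∈ spectrum ℂ (A.fibreInv P ξ)} := by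
  rw [opLxi_eq]
  exact sp_toLinearPMap_eq (BForm.mem_formGraph_iff (hc.coercive ξ) _) (hc.fibreInv_injective ξ)

/-- Because `d_0 ≤ b_0`, the inverses are contractions. -/
theorem one_le_norm_of_mem_sp {ξ : 𝕍} {lam : ℂ} (h : lam ∈ Sp (A.opLxi P ξ)) : 1 ≤ ‖lam‖ := by
  rw [hc.sp_opLxi] at h
  obtain ⟨h0, h⟩ := h
  have h1 := (norm_le_of_mem_spectrum_clm h).trans (hc.norm_fibreInv_le ξ)
  rw [norm_inv] at h1
  exact (inv_le_one₀ (norm_pos_iff.2 h0)).1 h1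

end FibreBound

end Expansion

end Setting

/-- Inversion commutes with closures away from zero. -/
theorem setOf_inv_mem_closure_eq {A : Set ℂ}
    (hB : ∀ lam : ℂ, lam ≠ 0 → lam⁻¹ ∈ A → 1 ≤ ‖lam‖) :
    {lam : ℂ | lam ≠ 0 ∧ lam⁻¹ ∈ closure A} = closure {lam : ℂ | lam ≠ 0 ∧ lam⁻¹ ∈ A} := by
  ext lam
  constructor
  · rintro ⟨h0, h⟩
    rw [mem_closure_iff_seq_limit] at h ⊢
    obtain ⟨x, hx, hlim⟩ := h
    have hinv : Filter.Tendsto (fun k => (x k)⁻¹) Filter.atTop (𝓝 lam) := by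
      simpa using hlim.inv₀ (inv_ne_zero h0)
    have hne : ∀ᶠ k in Filter.atTop, x k ≠ 0 := hlim.eventually_ne (inv_ne_zero h0)
    obtain ⟨k₀, hk₀⟩ := Filter.eventually_atTop.1 hne
    refine ⟨fun k => (x (k + k₀))⁻¹, fun k => ⟨inv_ne_zero (hk₀ _ (by omega)), ?_⟩,
      hinv.comp (Filter.tendsto_add_atTop_nat k₀)⟩
    rw [inv_inv]
    exact hx _
  · intro h
    -- The lower bound survives the closure and excludes the point where inversion is discontinuous.
    have h1 : 1 ≤ ‖lam‖ :=
      closure_minimal (t := {lam : ℂ | 1 ≤ ‖lam‖}) (fun x hx => hB x hx.1 hx.2)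
        (isClosed_le continuous_const continuous_norm) h
    have h0 : lam ≠ 0 := by
      rintro rfl
      norm_num at h1
    refine ⟨h0, ?_⟩
    rw [mem_closure_iff_seq_limit] at h ⊢
    obtain ⟨x, hx, hlim⟩ := h
    exact ⟨fun k => (x k)⁻¹, fun k => (hx k).2, hlim.inv₀ h0⟩

/-! ### The bivariate form under the Fourier transform -/

section

open FourierTransform

namespace Setting

variable {n : ℕ} {H X : Type*} [NormedAddCommGroup H] [InnerProductSpace ℂ H] [CompleteSpace H]
  [NormedAddCommGroup X] [InnerProductSpace ℂ X] [CompleteSpace X] {S : Setting n H X}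

local notation "𝕍" => EuclideanSpace ℝ (Fin n)

namespace Splitting

variable (P : S.Splitting)

theorem mem_bivariateDomain_iff {p : L2 n P.Z × (Fin n → L2 n P.Z) × L2 n P.Vs} :
    p ∈ P.bivariateDomain ↔ ∀ j, ∀ᵐ x, (𝓕 (p.2.1 j) : L2 n P.Z) x =
      (2 * Real.pi * Complex.I * (x j : ℂ)) • (𝓕 p.1 : L2 n P.Z) x := by
  refine forall_congr' fun j => ?_
  refine (lineDeriv_toTemperedDistribution_iff (P.Z.subtypeL.compLpL 2 volume p.1)
    (P.Z.subtypeL.compLpL 2 volume (p.2.1 j))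
    (EuclideanSpace.single j (1 : ℝ) : 𝕍)).trans ?_
  rw [fourier_compLpL, fourier_compLpL]
  have e1 := P.Z.subtypeL.coeFn_compLpL (p := 2) (μ := (volume : Measure 𝕍)) (𝓕 p.1)
  have e2 := P.Z.subtypeL.coeFn_compLpL (p := 2) (μ := (volume : Measure 𝕍)) (𝓕 (p.2.1 j))
  have e3 : ∀ x : 𝕍, inner ℝ x (EuclideanSpace.single j (1 : ℝ) : 𝕍) = x j := fun x => by
    simp [EuclideanSpace.inner_single_right]
  constructor
  · intro h
    filter_upwards [h, e1, e2] with x hx h1 h2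
    rw [h1, h2, e3] at hx
    exact Subtype.ext hx
  · intro h
    filter_upwards [h, e1, e2] with x hx h1 h2
    rw [h1, h2, e3, hx]
    rfl

theorem fourier_sumMap (e : P.bivariateDomain) : 𝓕 (P.sumMap e) =
    P.inclZ.compLpL 2 volume (𝓕 e.1.1) + P.inclVs.compLpL 2 volume (𝓕 e.1.2.2) := by
  have : P.sumMap e = P.inclZ.compLpL 2 volume e.1.1 + P.inclVs.compLpL 2 volume e.1.2.2 := rfl
  rw [this, ← fourier_compLpL, ← fourier_compLpL]
  exact map_add (Lp.fourierTransformₗᵢ 𝕍 (S.V S.o)) _ _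

theorem projZ_fourier_sumMap (e : P.bivariateDomain) :
    ∀ᵐ x, P.projZ ((𝓕 (P.sumMap e) : L2 n (S.V S.o)) x) = (𝓕 e.1.1 : L2 n P.Z) x := by
  rw [fourier_sumMap]
  filter_upwards [Lp.coeFn_add (P.inclZ.compLpL 2 volume (𝓕 e.1.1))
      (P.inclVs.compLpL 2 volume (𝓕 e.1.2.2)),
    P.inclZ.coeFn_compLpL (p := 2) (μ := (volume : Measure 𝕍)) (𝓕 e.1.1),
    P.inclVs.coeFn_compLpL (p := 2) (μ := (volume : Measure 𝕍)) (𝓕 e.1.2.2)] with x h1 h2 h3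
  rw [h1, Pi.add_apply, h2, h3, map_add, P.projZ_inclZ, P.projZ_inclVs, add_zero]

end Splitting

namespace Expansion

variable {A : S.Expansion} {P : S.Splitting}

/-- The bivariate form on the Fourier side. -/
theorem integrable_and_formQ_eq (e w : P.bivariateDomain) :
    Integrable (fun x : 𝕍 => A.fibreForm P ((2 * Real.pi) • x)
      ((𝓕 (P.sumMap e) : Splitting.L2 n (S.V S.o)) x)
      ((𝓕 (P.sumMap w) : Splitting.L2 n (S.V S.o)) x)) volume ∧ A.formQ P e w =
    ∫ x : 𝕍, A.fibreForm P ((2 * Real.pi) • x) ((𝓕 (P.sumMap e) : Splitting.L2 n (S.V S.o)) x)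
      ((𝓕 (P.sumMap w) : Splitting.L2 n (S.V S.o)) x) := by
  have h1 : A.formQ P e w = ∑ j, ∑ k, l2Form (A.ahZ P j k) (𝓕 (P.gradMap j e))
      (𝓕 (P.gradMap k w)) + l2Form (S.b0 (S.V S.o)) (𝓕 (P.sumMap e)) (𝓕 (P.sumMap w)) := by
    simp only [l2Form_fourier, formQ, LinearMap.add_apply, LinearMap.sum_apply]
    rfl
  rw [h1]
  simp only [l2Form_apply]
  have hi : ∀ j k, Integrable (fun x => A.ahZ P j k ((𝓕 (P.gradMap j e) : Splitting.L2 n P.Z) x)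
      ((𝓕 (P.gradMap k w) : Splitting.L2 n P.Z) x)) (volume : Measure 𝕍) :=
    fun j k => integrable_bform _ _ _
  have hi' : ∀ j, Integrable (fun x => ∑ k, A.ahZ P j k
      ((𝓕 (P.gradMap j e) : Splitting.L2 n P.Z) x)
      ((𝓕 (P.gradMap k w) : Splitting.L2 n P.Z) x)) (volume : Measure 𝕍) :=
    fun j => integrable_finsetSum _ fun k _ => hi j k
  have h2 : ∑ j, ∑ k, (∫ x : 𝕍, A.ahZ P j k ((𝓕 (P.gradMap j e) : Splitting.L2 n P.Z) x)
      ((𝓕 (P.gradMap k w) : Splitting.L2 n P.Z) x)) = ∫ x : 𝕍, ∑ j, ∑ k, A.ahZ P j k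
      ((𝓕 (P.gradMap j e) : Splitting.L2 n P.Z) x)
      ((𝓕 (P.gradMap k w) : Splitting.L2 n P.Z) x) := by
    rw [integral_finsetSum _ fun j _ => hi' j]
    exact Finset.sum_congr rfl fun j _ => (integral_finsetSum _ fun k _ => hi j k).symm
  have hi'' := integrable_finsetSum Finset.univ fun j _ => hi' j
  have hib := integrable_bform (S.b0 (S.V S.o)) (𝓕 (P.sumMap e) : Splitting.L2 n (S.V S.o))
    (𝓕 (P.sumMap w))
  rw [h2, ← integral_add hi'' hib]
  suffices hae : _ from ⟨(integrable_congr hae).1 (hi''.add hib), integral_congr_ae hae⟩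
  have d1 : ∀ᵐ x, ∀ j, (𝓕 (P.gradMap j e) : Splitting.L2 n P.Z) x =
      (2 * Real.pi * Complex.I * (x j : ℂ)) • (𝓕 e.1.1 : Splitting.L2 n P.Z) x :=
    ae_all_iff.2 (P.mem_bivariateDomain_iff.1 e.2)
  have d2 : ∀ᵐ x, ∀ j, (𝓕 (P.gradMap j w) : Splitting.L2 n P.Z) x =
      (2 * Real.pi * Complex.I * (x j : ℂ)) • (𝓕 w.1.1 : Splitting.L2 n P.Z) x :=
    ae_all_iff.2 (P.mem_bivariateDomain_iff.1 w.2)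
  filter_upwards [d1, d2, P.projZ_fourier_sumMap e, P.projZ_fourier_sumMap w] with x h1 h2 h3 h4
  rw [fibreForm_apply, h3, h4, ahForm_apply, Pi.add_apply]
  refine congrArg₂ (· + ·) ?_ rfl
  refine Finset.sum_congr rfl fun j _ => Finset.sum_congr rfl fun k _ => ?_
  rw [h1, h2]
  simp only [map_smulₛₗ, smul_apply, smul_eq_mul, RingHom.id_apply, map_mul, Complex.conj_ofReal,
    Complex.conj_I, map_ofNat, PiLp.smul_apply, Complex.ofReal_mul, Complex.ofReal_ofNat]
  have : A.ahZ P j k ((𝓕 e.1.1 : Splitting.L2 n P.Z) x) ((𝓕 w.1.1 : Splitting.L2 n P.Z) x) =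
    A.ah j k (P.inclZ ((𝓕 e.1.1 : Splitting.L2 n P.Z) x))
      (P.inclZ ((𝓕 w.1.1 : Splitting.L2 n P.Z) x)) := rfl
  rw [this]
  -- The two multipliers, one conjugated, contribute `4π² x_j x_k`; this is why the fibre parameter
  -- is `2πx`.
  linear_combination (-(4 : ℂ) * Real.pi ^ 2 * x j * x k * A.ah j k
    (P.inclZ ((𝓕 e.1.1 : Splitting.L2 n P.Z) x))
      (P.inclZ ((𝓕 w.1.1 : Splitting.L2 n P.Z) x))) * Complex.I_sq

end Expansion

end Setting

end

/-! ### The inverse of the bivariate operator -/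

section

open FourierTransform

/-- The conjugate `e⁻¹ T e` of an operator. -/
def conjBy {Y Y' : Type*} [NormedAddCommGroup Y] [NormedSpace ℂ Y] [NormedAddCommGroup Y']
    [NormedSpace ℂ Y'] (e : Y ≃L[ℂ] Y') (T : Y' →L[ℂ] Y') : Y →L[ℂ] Y :=
  (e.symm : Y' →L[ℂ] Y) ∘L T ∘L (e : Y →L[ℂ] Y')

theorem spectrum_conjBy {Y Y' : Type*} [NormedAddCommGroup Y] [NormedSpace ℂ Y]
    [NormedAddCommGroup Y'] [NormedSpace ℂ Y'] (e : Y ≃L[ℂ] Y') (T : Y' →L[ℂ] Y') :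
    spectrum ℂ (conjBy e T) = spectrum ℂ T :=
  AlgEquiv.spectrum_eq (R := ℂ) e.symm.conjContinuousAlgEquiv T

namespace Setting

variable {n : ℕ} {H X : Type*} [NormedAddCommGroup H] [InnerProductSpace ℂ H] [CompleteSpace H]
  [NormedAddCommGroup X] [InnerProductSpace ℂ X] [CompleteSpace X] {S : Setting n H X}

local notation "𝕍" => EuclideanSpace ℝ (Fin n)

namespace Expansion

variable {A : S.Expansion} {P : S.Splitting} {c : ℝ} (hc : A.FibreBound P c)

include hc

/-- The fibre equations are solved pointwise on the Fourier side. The point is that the gradient of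
the `Z`-part is square integrable, which follows from `|ξ| ≤ 1 + |ξ|²` and the bounds of
`fibreSol_bound`. -/
theorem FibreBound.exists_bivariateDomain (g : Splitting.L2 n (S.clos (S.V S.o))) :
    ∃ e : P.bivariateDomain, ∀ᵐ x : 𝕍, (𝓕 (P.sumMap e) : Splitting.L2 n (S.V S.o)) x =
      A.fibreSol P ((2 * Real.pi) • x) ((𝓕 g : Splitting.L2 n (S.clos (S.V S.o))) x) := by
  have hpos := hc.pos
  have hcont : Continuous fun x : 𝕍 => A.fibreSol P ((2 * Real.pi) • x) :=
    hc.continuous_fibreSol.comp (by fun_prop)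
  set g' : Splitting.L2 n (S.clos (S.V S.o)) := 𝓕 g with hg'
  set s : Splitting.L2 n (S.V S.o) := fiberMul _ hcont 1 (fun x => hc.norm_fibreSol_le _) g' with hs
  have hsx := coeFn_fiberMul hcont (fun x => hc.norm_fibreSol_le _) g'
  rw [← hs] at hsx
  set u' : Splitting.L2 n P.Z := P.projZ.compLpL 2 volume s with hu'
  have hux := P.projZ.coeFn_compLpL (p := 2) (μ := (volume : Measure 𝕍)) s
  have hG : ∀ j, MemLp (fun x : 𝕍 => (2 * Real.pi * Complex.I * (x j : ℂ)) • u' x) 2 volume := by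
    intro j
    refine MemLp.of_le_mul (c := ‖P.projZ‖ + 2 / c) (Lp.memLp g') ?_ ?_
    · have hcj : Continuous fun x : 𝕍 => 2 * Real.pi * Complex.I * (x j : ℂ) := by fun_prop
      exact hcj.aestronglyMeasurable.smul (Lp.memLp u').1
    · filter_upwards [hsx, hux] with x h1 h2
      rw [h2, h1]
      set ξ : 𝕍 := (2 * Real.pi) • x with hξ
      obtain ⟨b1, b2⟩ := hc.fibreSol_bound ξ (g' x)
      set y := A.fibreSol P ξ (g' x)
      have h3 : ‖(2 * Real.pi * Complex.I * (x j : ℂ))‖ ≤ ‖ξ‖ := by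
        rw [hξ, norm_smul, norm_mul, norm_mul, norm_mul, Complex.norm_I, mul_one]
        have := norm_coord_le x j
        rw [Complex.norm_real, Complex.norm_ofNat, Real.norm_of_nonneg Real.two_pi_pos.le,
          Real.norm_of_nonneg Real.pi_pos.le]
        gcongr
      have h4 : ‖ξ‖ ^ 2 * ‖P.projZ y‖ ≤ 2 / c * ‖g' x‖ := by
        rw [div_mul_eq_mul_div, le_div_iff₀ hpos]
        linarith
      have h5 : ‖P.projZ y‖ ≤ ‖P.projZ‖ * ‖g' x‖ :=
        (P.projZ.le_opNorm y).trans (by gcongr)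
      have h6 : ‖ξ‖ ≤ 1 + ‖ξ‖ ^ 2 := by nlinarith [sq_nonneg (‖ξ‖ - 1), norm_nonneg ξ]
      rw [norm_smul]
      calc _ ≤ (1 + ‖ξ‖ ^ 2) * ‖P.projZ y‖ := by
            gcongr
            exact h3.trans h6
        _ = ‖P.projZ y‖ + ‖ξ‖ ^ 2 * ‖P.projZ y‖ := by ring
        _ ≤ ‖P.projZ‖ * ‖g' x‖ + 2 / c * ‖g' x‖ := add_le_add h5 h4
        _ = _ := by ring
  let FZ := Lp.fourierTransformₗᵢ 𝕍 P.Z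
  have FZ_apply : ∀ f, (𝓕 (FZ.symm f) : Splitting.L2 n P.Z) = f := fun f => FZ.apply_symm_apply f
  let p : Splitting.L2 n P.Z × (Fin n → Splitting.L2 n P.Z) × Splitting.L2 n P.Vs :=
    (FZ.symm u', fun j => FZ.symm (hG j).toLp,
      (Lp.fourierTransformₗᵢ 𝕍 P.Vs).symm (P.projVs.compLpL 2 volume s))
  have hp : p ∈ P.bivariateDomain := by
    rw [P.mem_bivariateDomain_iff]
    intro j
    change ∀ᵐ x : 𝕍, (𝓕 (FZ.symm (hG j).toLp) : Splitting.L2 n P.Z) x =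
      (2 * Real.pi * Complex.I * (x j : ℂ)) • (𝓕 (FZ.symm u') : Splitting.L2 n P.Z) x
    rw [FZ_apply, FZ_apply]
    exact (hG j).coeFn_toLp
  refine ⟨⟨p, hp⟩, ?_⟩
  rw [P.fourier_sumMap]
  change ∀ᵐ x : 𝕍, (P.inclZ.compLpL 2 volume (𝓕 (FZ.symm u')) + P.inclVs.compLpL 2 volume
    (𝓕 ((Lp.fourierTransformₗᵢ 𝕍 P.Vs).symm (P.projVs.compLpL 2 volume s))) :
      Splitting.L2 n (S.V S.o)) x = _
  have FV_apply : (𝓕 ((Lp.fourierTransformₗᵢ 𝕍 P.Vs).symm (P.projVs.compLpL 2 volume s)) :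
      Splitting.L2 n P.Vs) = P.projVs.compLpL 2 volume s :=
    (Lp.fourierTransformₗᵢ 𝕍 P.Vs).apply_symm_apply _
  rw [FZ_apply, FV_apply]
  filter_upwards [hsx, hux, P.projVs.coeFn_compLpL (p := 2) (μ := (volume : Measure 𝕍)) s,
    Lp.coeFn_add (P.inclZ.compLpL 2 volume u')
      (P.inclVs.compLpL 2 volume (P.projVs.compLpL 2 volume s)),
    P.inclZ.coeFn_compLpL (p := 2) (μ := (volume : Measure 𝕍)) u',
    P.inclVs.coeFn_compLpL (p := 2) (μ := (volume : Measure 𝕍))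
      (P.projVs.compLpL 2 volume s)] with x h1 h2 h3 h4 h5 h6
  rw [h4, Pi.add_apply, h5, h6, h3, h2, add_comm, P.proj_add, h1]

theorem FibreBound.bivariateInv_cont :
    Continuous fun x : 𝕍 => A.fibreInv P ((2 * Real.pi) • x) :=
  hc.continuous_fibreInv.comp (by fun_prop)

/-- The inverse of the bivariate operator on the Fourier side. -/
def FibreBound.multiplier :
    Splitting.L2 n (S.clos (S.V S.o)) →L[ℂ] Splitting.L2 n (S.clos (S.V S.o)) :=
  fiberMul _ hc.bivariateInv_cont 1 (fun _ => hc.norm_fibreInv_le _)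

/-- The inverse of the bivariate operator. -/
def FibreBound.bivariateInv :
    Splitting.L2 n (S.clos (S.V S.o)) →L[ℂ] Splitting.L2 n (S.clos (S.V S.o)) :=
  conjBy (Lp.fourierTransformₗᵢ 𝕍 (S.clos (S.V S.o))).toContinuousLinearEquiv hc.multiplier

theorem FibreBound.fourier_bivariateInv (g : Splitting.L2 n (S.clos (S.V S.o))) :
    (𝓕 (hc.bivariateInv g) : Splitting.L2 n (S.clos (S.V S.o))) = hc.multiplier (𝓕 g) :=
  (Lp.fourierTransformₗᵢ 𝕍 (S.clos (S.V S.o))).apply_symm_apply _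

theorem FibreBound.bivariateInv_injective : Function.Injective hc.bivariateInv := by
  rw [injective_iff_map_eq_zero]
  intro g hg
  have h1 := hc.fourier_bivariateInv g
  have hF0 : (𝓕 (0 : Splitting.L2 n (S.clos (S.V S.o))) : Splitting.L2 n (S.clos (S.V S.o))) = 0 :=
    map_zero (Lp.fourierTransformₗᵢ 𝕍 (S.clos (S.V S.o)))
  rw [hg, hF0] at h1
  have h2 : (𝓕 g : Splitting.L2 n (S.clos (S.V S.o))) = 0 := by
    rw [Lp.eq_zero_iff_ae_eq_zero]
    have h3 := coeFn_fiberMul hc.bivariateInv_cont (fun _ => hc.norm_fibreInv_le _) (𝓕 g)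
    have h4 : hc.multiplier (𝓕 g) =ᵐ[volume] 0 := by
      rw [← h1]
      exact Lp.coeFn_zero _ _ _
    filter_upwards [h3, h4] with x e1 e2
    have e3 := e1.symm.trans e2
    exact (injective_iff_map_eq_zero _).1 (hc.fibreInv_injective _) _ e3
  exact (Lp.fourierTransformₗᵢ 𝕍 (S.clos (S.V S.o))).injective (h2.trans hF0.symm)

/-- The fibrewise solution solves the form equation by Plancherel. It is unique since the form at a
difference of solutions is the integral of a non-negative function dominating the squared norm of
its transform. -/
theorem FibreBound.mem_formGraph_formQ
    (p : Splitting.L2 n (S.clos (S.V S.o)) × Splitting.L2 n (S.clos (S.V S.o))) :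
    p ∈ formGraph (innerForm _)
      (((S.emb (S.V S.o)).compLpL 2 volume).toLinearMap ∘ₗ P.sumMap) (A.formQ P) ↔
      p.1 = hc.bivariateInv p.2 := by
  obtain ⟨f, g⟩ := p
  obtain ⟨e₀, he₀⟩ := hc.exists_bivariateDomain g
  have hsol : ∀ w, A.formQ P e₀ w =
      inner ℂ ((S.emb (S.V S.o)).compLpL 2 volume (P.sumMap w)) g := by
    intro w
    rw [(integrable_and_formQ_eq _ _).2, ← Lp.inner_fourier_eq, fourier_compLpL, MeasureTheory.L2.inner_def]
    refine integral_congr_ae ?_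
    filter_upwards [he₀, (S.emb (S.V S.o)).coeFn_compLpL (p := 2) (μ := (volume : Measure 𝕍))
      (𝓕 (P.sumMap w))] with x h1 h2
    rw [h1, h2, hc.fibreSol_spec]
  have hval : (S.emb (S.V S.o)).compLpL 2 volume (P.sumMap e₀) = hc.bivariateInv g := by
    apply (Lp.fourierTransformₗᵢ 𝕍 (S.clos (S.V S.o))).injective
    change (𝓕 ((S.emb (S.V S.o)).compLpL 2 volume (P.sumMap e₀)) :
      Splitting.L2 n (S.clos (S.V S.o))) = (𝓕 (hc.bivariateInv g) :
        Splitting.L2 n (S.clos (S.V S.o)))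
    rw [hc.fourier_bivariateInv, fourier_compLpL]
    apply Lp.ext
    filter_upwards [he₀, (S.emb (S.V S.o)).coeFn_compLpL (p := 2) (μ := (volume : Measure 𝕍))
      (𝓕 (P.sumMap e₀)), coeFn_fiberMul hc.bivariateInv_cont (fun _ => hc.norm_fibreInv_le _)
        (𝓕 g)] with x h1 h2 h3
    rw [h2, h1]
    exact h3.symm
  rw [mem_formGraph]
  constructor
  · rintro ⟨e, he, h⟩
    have h0 : A.formQ P (e - e₀) (e - e₀) = 0 := by
      have h1 := h (e - e₀)
      have h2 := hsol (e - e₀)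
      rw [LinearMap.map_sub₂]
      rw [h1, h2]
      exact sub_self _
    obtain ⟨hint, heq⟩ := integrable_and_formQ_eq (A := A) (e - e₀) (e - e₀)
    rw [h0] at heq
    set d : Splitting.L2 n (S.V S.o) := 𝓕 (P.sumMap (e - e₀)) with hd
    have hle : ∀ x : 𝕍, ‖d x‖ ^ 2 ≤ RCLike.re
        (A.fibreForm P ((2 * Real.pi) • x) (d x) (d x)) := fun x => by
      have h1 := hc.lower ((2 * Real.pi) • x) (d x)
      have h2 : 0 ≤ c * ‖(2 * Real.pi) • x‖ ^ 2 * ‖P.projZ (d x)‖ ^ 2 := by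
        have := hc.pos
        positivity
      exact (le_add_of_nonneg_right h2).trans h1
    have h1 : ∫ x : 𝕍, RCLike.re (A.fibreForm P ((2 * Real.pi) • x) (d x) (d x)) = 0 := by
      rw [integral_re hint, ← heq, map_zero]
    rw [integral_eq_zero_iff_of_nonneg (fun x => (sq_nonneg _).trans (hle x)) hint.re] at h1
    have h2 : d = 0 := by
      rw [Lp.eq_zero_iff_ae_eq_zero]
      filter_upwards [h1] with x hx
      have h3 := hle x
      rw [hx, Pi.zero_apply] at h3
      have h4 : ‖d x‖ = 0 := by
        have := norm_nonneg (d x)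
        nlinarith
      exact norm_eq_zero.1 h4
    have h3 : P.sumMap (e - e₀) = 0 :=
      (map_eq_zero_iff (Lp.fourierTransformₗᵢ 𝕍 (S.V S.o))
        (Lp.fourierTransformₗᵢ 𝕍 (S.V S.o)).injective).1 h2
    rw [map_sub, sub_eq_zero] at h3
    have he' : (S.emb (S.V S.o)).compLpL 2 volume (P.sumMap e) = f := he
    rw [← he', h3]
    exact hval
  · intro h
    have h' : f = hc.bivariateInv g := h
    exact ⟨e₀, hval.trans h'.symm, hsol⟩

/-- The inverse is unitarily equivalent to multiplication by the fibre inverses, whose spectrum is a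
closed union. The uniform bound `1 ≤ ‖lam‖` lets reciprocals commute with the closure. -/
theorem FibreBound.sp_bivariateOp :
    Sp (A.bivariateOp P) = closure (⋃ ξ : 𝕍, Sp (A.opLxi P ξ)) := by
  have h1 : Sp (A.bivariateOp P) =
      {lam : ℂ | lam ≠ 0 ∧ lam⁻¹ ∈ spectrum ℂ hc.bivariateInv} :=
    sp_toLinearPMap_eq hc.mem_formGraph_formQ hc.bivariateInv_injective
  have h2 : spectrum ℂ hc.bivariateInv = closure (⋃ ξ : 𝕍, spectrum ℂ (A.fibreInv P ξ)) := by
    refine (spectrum_conjBy _ _).trans ((spectrum_fiberMul hc.bivariateInv_cont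
      (fun _ => hc.norm_fibreInv_le _) fun x => hc.isSelfAdjoint_fibreInv _).trans ?_)
    refine congrArg closure ?_
    apply subset_antisymm
    · exact iUnion_subset fun x => subset_iUnion (fun ξ => spectrum ℂ (A.fibreInv P ξ)) _
    · refine iUnion_subset fun ξ => ?_
      refine subset_iUnion_of_subset ((2 * Real.pi)⁻¹ • ξ) ?_
      rw [smul_smul, mul_inv_cancel₀ Real.two_pi_pos.ne', one_smul]
  have h3 : (⋃ ξ : 𝕍, Sp (A.opLxi P ξ)) =
      {lam : ℂ | lam ≠ 0 ∧ lam⁻¹ ∈ ⋃ ξ : 𝕍, spectrum ℂ (A.fibreInv P ξ)} := by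
    ext lam
    simp only [mem_iUnion, hc.sp_opLxi, Set.mem_ofPred_eq]
    exact exists_and_left
  rw [h1, h2, h3]
  refine setOf_inv_mem_closure_eq fun lam h0 h => ?_
  obtain ⟨ξ, hξ⟩ := mem_iUnion.1 h
  refine hc.one_le_norm_of_mem_sp (ξ := ξ) ?_
  rw [hc.sp_opLxi]
  exact ⟨h0, hξ⟩

end Expansion

end Setting

end

/-! ### Transfer maps and the operators `𝓛_{ε,θ}` in a fixed Hilbert space -/

namespace Setting

variable {n : ℕ} {H X : Type*} [NormedAddCommGroup H] [InnerProductSpace ℂ H] [CompleteSpace H]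
  [NormedAddCommGroup X] [InnerProductSpace ℂ X] [CompleteSpace X] {S : Setting n H X}

local notation "𝕍" => EuclideanSpace ℝ (Fin n)

/-- The transfer bijections, with continuous extensions to `X`. -/
structure Transfer (P : S.Splitting) where
  e : ∀ θ : S.Θ, P.Vs ≃ₗ[ℂ] P.Vstar θ
  E : S.Θ → X ≃L[ℂ] X
  b_e : ∀ (θ : S.Θ) (v w : P.Vs), S.b θ (e θ v) (e θ w) = S.b S.o v w
  coupling : ∃ K : ℝ, 0 ≤ K ∧ ∀ θ : S.Θ, ∀ v : P.Vs, ∀ z ∈ P.Z,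
    ‖S.b θ (e θ v) z - S.b S.o v z‖ ≤ K * ‖(θ : 𝕍)‖ * ‖v‖ * ‖z‖
  E_J : ∀ (θ : S.Θ) (v : P.Vs), E θ (S.J v) = S.J (e θ v)
  d_E : ∀ θ u w, S.d θ (E θ u) (E θ w) = inner ℂ w u
  lipschitz : ∃ K : ℝ, 0 ≤ K ∧ ∀ (θ : S.Θ) (u : X),
    (S.d θ).en (E θ u - u) ≤ K * ‖(θ : 𝕍)‖ * ‖u‖

theorem exists_en_d_equiv : ∃ K : ℝ, 0 ≤ K ∧ ∀ θ x, ‖x‖ ≤ K * (S.d θ).en x ∧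
    (S.d θ).en x ≤ K * ‖x‖ := by
  obtain ⟨K, hK, h⟩ := S.equiv_X
  have key : ∀ θ₁ θ₂ x, (S.d θ₁).en x ≤ √K * (S.d θ₂).en x := fun θ₁ θ₂ x => by
    rw [BForm.en, BForm.en, ← Real.sqrt_mul hK.le]
    exact Real.sqrt_le_sqrt (h θ₁ θ₂ x)
  refine ⟨√K, Real.sqrt_nonneg _, fun θ x => ⟨?_, ?_⟩⟩
  · rw [← S.en_d_zero]
    exact key _ _ x
  · rw [← S.en_d_zero x]
    exact key _ _ x

/-- The extensions to `X` are given only as linear bijections. Carrying `d_0` to `d_θ`, together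
with the uniform equivalence of the `d_θ`, makes them and their inverses continuous. -/
theorem _root_.Setting.Splitting.TransferCondition.nonempty_transfer {P : S.Splitting}
    (h6 : P.TransferCondition) : Nonempty (Transfer P) := by
  obtain ⟨e, E, hb, ⟨Kb, hKb, hcoup⟩, hEJ, hd, h0, Ke, hKe, hlip⟩ := h6
  obtain ⟨K, hK, heq⟩ := S.exists_en_d_equiv
  have hen : ∀ θ u, (S.d θ).en (E θ u) = ‖u‖ := fun θ u => by
    rw [← S.en_d_zero u, BForm.en, BForm.en, hd]
  let E' : S.Θ → X ≃L[ℂ] X := fun θ =>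
    { E θ with
      continuous_toFun := by
        refine AddMonoidHomClass.continuous_of_bound (E θ) K fun u => ?_
        rw [← hen θ u]
        exact (heq θ _).1
      continuous_invFun := by
        refine AddMonoidHomClass.continuous_of_bound (E θ).symm K fun u => ?_
        rw [← hen θ ((E θ).symm u), LinearEquiv.apply_symm_apply]
        exact (heq θ _).2 }
  refine ⟨⟨e, E', hb, ⟨Kb, hKb, fun θ v z hz => ?_⟩, hEJ, fun θ u w => ?_, ⟨Ke, hKe,
    fun θ u => ?_⟩⟩⟩
  · have := hcoup θ v z hz
    rwa [S.nrm_zero, S.nrm_zero] at this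
  · exact (hd θ u w).trans (S.d_zero u w)
  · have := hlip θ S.o u
    rw [h0] at this
    have h2 : ‖(θ : 𝕍) - (S.o : 𝕍)‖ = ‖(θ : 𝕍)‖ := by
      change ‖(θ : 𝕍) - 0‖ = _
      rw [sub_zero]
    rw [h2] at this
    exact this.trans_eq (congrArg _ (S.en_d_zero u))

namespace Transfer

variable {P : S.Splitting} (t : Transfer P)

/-- The embedding `E_θ⁻¹ J` of `H`. -/
def j (θ : S.Θ) : H →L[ℂ] X := (t.E θ).symm.toContinuousLinearMap ∘L S.J

theorem j_apply (θ : S.Θ) (u : H) : t.j θ u = (t.E θ).symm (S.J u) := rfl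

theorem norm_E_symm (θ : S.Θ) (x : X) : ‖(t.E θ).symm x‖ = (S.d θ).en x := by
  rw [← S.en_d_zero, BForm.en, BForm.en, S.d_zero, ← t.d_E, ContinuousLinearEquiv.apply_symm_apply]

theorem norm_j_le (θ : S.Θ) (u : H) : ‖t.j θ u‖ ≤ (S.b θ).en u := by
  rw [j_apply, norm_E_symm]
  exact S.en_d_le_en_b θ u

theorem j_e (θ : S.Θ) (v : P.Vs) : t.j θ (t.e θ v) = S.J v := by
  rw [j_apply, ← t.E_J, ContinuousLinearEquiv.symm_apply_apply]

/-- The difference is the image under the isometry `E_θ⁻¹` of `-(E_θ J u - J u)`, which the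
Lipschitz condition at `θ = 0` bounds. -/
theorem exists_norm_j_sub_le : ∃ K : ℝ, 0 ≤ K ∧ ∀ (θ : S.Θ) (u : H),
    ‖t.j θ u - S.J u‖ ≤ K * ‖(θ : 𝕍)‖ * ‖u‖ := by
  obtain ⟨K, hK, h⟩ := t.lipschitz
  refine ⟨K, hK, fun θ u => ?_⟩
  have h1 : t.j θ u - S.J u = (t.E θ).symm (-(t.E θ (S.J u) - S.J u)) := by
    rw [neg_sub, map_sub, ContinuousLinearEquiv.symm_apply_apply]
    rfl
  rw [h1, norm_E_symm, BForm.en_neg]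
  refine (h θ _).trans ?_
  gcongr
  exact S.norm_J_le u

theorem j_compact (θ : S.Θ) : IsCompactOperator (t.j θ) :=
  S.J_compact.clm_comp (t.E θ).symm.toContinuousLinearMap

theorem j_denseRange (θ : S.Θ) : DenseRange (t.j θ) :=
  (t.E θ).symm.surjective.denseRange.comp S.J_dense (t.E θ).symm.continuous

end Transfer

/-! ### The forms `ε⁻² a_θ + b_θ` -/

/-- The form `ε⁻² a_θ + b_θ`. -/
def formL (S : Setting n H X) (ε : ℝ) (θ : S.Θ) : BForm H := ((ε ^ 2)⁻¹ : ℂ) • S.a θ + S.b θ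

theorem formL_apply (ε : ℝ) (θ : S.Θ) (u w : H) :
    S.formL ε θ u w = ((ε ^ 2)⁻¹ : ℂ) * S.a θ u w + S.b θ u w := rfl

theorem re_formL_self (ε : ℝ) (θ : S.Θ) (u : H) : (S.formL ε θ u u).re =
    (ε ^ 2)⁻¹ * (S.a θ u u).re + (S.b θ u u).re := by
  rw [formL_apply, Complex.add_re, ← Complex.ofReal_pow, ← Complex.ofReal_inv,
    Complex.re_ofReal_mul]

theorem isNonneg_formL (ε : ℝ) (θ : S.Θ) : (S.formL ε θ).IsNonneg := fun u => by
  rw [formL_apply, ← Complex.ofReal_pow, ← Complex.ofReal_inv]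
  exact add_nonneg (mul_nonneg (Complex.zero_le_real.2 (by positivity)) (S.a_nonneg θ u))
    (S.b_nonneg θ u)

section Energy

variable {ε : ℝ} (hε : 0 < ε) (θ : S.Θ) (u : H)
include hε

theorem en_a_le_formL : (S.a θ).en u ≤ ε * (S.formL ε θ).en u := by
  have h1 := S.re_formL_self ε θ u
  have h2 := (S.isNonneg_b θ).re_nonneg u
  rw [← (S.isNonneg_formL ε θ).en_sq, ← (S.isNonneg_a θ).en_sq] at h1
  have h3 : (S.a θ).en u ^ 2 ≤ (ε * (S.formL ε θ).en u) ^ 2 := by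
    rw [mul_pow, h1, mul_add, mul_inv_cancel_left₀ (by positivity)]
    have : 0 ≤ ε ^ 2 * (S.b θ u u).re := by positivity
    linarith
  exact abs_le_of_sq_le_sq' h3 (mul_nonneg hε.le (BForm.en_nonneg _ _)) |>.2

omit hε in
theorem en_b_le_formL : (S.b θ).en u ≤ (S.formL ε θ).en u := by
  refine Real.sqrt_le_sqrt ?_
  rw [re_formL_self]
  have h2 := (S.isNonneg_a θ).re_nonneg u
  have : 0 ≤ (ε ^ 2)⁻¹ * (S.a θ u u).re := by positivity
  linarith

theorem nrm_le_formL (hε1 : ε < 1) : S.nrm θ u ≤ (S.formL ε θ).en u := by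
  refine Real.sqrt_le_sqrt ?_
  rw [re_formL_self, Complex.add_re]
  have h2 := (S.isNonneg_a θ).re_nonneg u
  have h3 : 1 ≤ (ε ^ 2)⁻¹ := one_le_inv₀ (by positivity) |>.2 (by nlinarith)
  nlinarith

theorem formL_coercive (hε1 : ε < 1) : (S.formL ε θ).IsCoerciveHermitian := by
  obtain ⟨K, hK, hKu⟩ := S.exists_nrm_equiv
  refine ⟨fun u w => (S.isNonneg_formL ε θ).herm u w, (K ^ 2)⁻¹, by positivity, fun u => ?_⟩
  rw [← (S.isNonneg_formL ε θ).en_sq, inv_mul_le_iff₀ (by positivity), ← mul_pow]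
  refine pow_le_pow_left₀ (norm_nonneg _) ((hKu θ u).2.trans ?_) 2
  gcongr
  exact S.nrm_le_formL hε θ u hε1

end Energy

/-- Conjugation by `E_θ` replaces the inner product `d_θ` by `d_0` and the embedding `J` by `t.j θ`.
The inverses for all `θ` become self-adjoint in the same space. -/
theorem Transfer.sp_opL {P : S.Splitting} (t : Transfer P) {ε : ℝ} (hε : 0 < ε) (hε1 : ε < 1)
    (θ : S.Θ) : Sp (S.opL ε θ) =
      {lam : ℂ | lam ≠ 0 ∧ lam⁻¹ ∈ spectrum ℂ ((S.formL ε θ).inv (t.j θ))} := by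
  have hq := S.formL_coercive hε θ hε1
  rw [← spectrum_conjBy (t.E θ).symm]
  refine sp_toLinearPMap_eq (fun p => ?_) ?_
  · have h1 : p ∈ formGraph (S.d θ) S.J.toLinearMap (S.formL ε θ).toSForm ↔
        ((t.E θ).symm p.1, (t.E θ).symm p.2) ∈
          formGraph (innerForm X) (t.j θ).toLinearMap (S.formL ε θ).toSForm := by
      rw [mem_formGraph, mem_formGraph]
      refine exists_congr fun e => and_congr ?_ (forall_congr' fun w => ?_)
      · exact (t.E θ).symm.injective.eq_iff.symm
      · have : S.d θ p.2 (S.J w) = inner ℂ (t.j θ w) ((t.E θ).symm p.2) := by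
          rw [← t.d_E θ, t.j_apply, ContinuousLinearEquiv.apply_symm_apply,
            ContinuousLinearEquiv.apply_symm_apply]
        change _ = S.d θ p.2 (S.J w) ↔ _ = inner ℂ (t.j θ w) ((t.E θ).symm p.2)
        rw [this]
    refine h1.trans ?_
    rw [BForm.mem_formGraph_iff hq]
    exact (t.E θ).symm_apply_eq
  · intro x y hxy
    have h1 := (t.E θ).injective hxy
    exact (t.E θ).symm.injective (BForm.inv_injective hq _ (t.j_denseRange θ) h1)

/-- The embedding of `V_0` in `X`. -/
def embX (S : Setting n H X) (U : Submodule ℂ H) : U →L[ℂ] X := S.J ∘L U.subtypeL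

theorem embX_isCompactOperator (U : Submodule ℂ H) : IsCompactOperator (S.embX U) :=
  S.J_compact.comp_clm U.subtypeL

theorem pullInner_emb (U : Submodule ℂ H) : pullInner (S.emb U) = pullInner (S.embX U) := rfl

namespace Expansion

variable {A : S.Expansion} {P : S.Splitting} {c : ℝ} (hc : A.FibreBound P c)
include hc

theorem FibreBound.mem_sp_opLxi_iff {ξ : 𝕍} {lam : ℂ} : lam ∈ Sp (A.opLxi P ξ) ↔
    pencilEigenspace (A.fibreForm P ξ) (pullInner (S.emb (S.V S.o))) lam ≠ ⊥ := by
  rw [opLxi_eq]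
  exact BForm.mem_sp_iff (hc.coercive ξ) (S.emb_isCompactOperator _) (S.emb_denseRange _)

/-- Regarding the fibre inverse as an operator on all of `X` leaves its nonzero spectrum unchanged,
as the eigenvalue equation involves only the pulled-back inner product. It can then be compared with
the inverse of `𝓛_{ε,θ}`. -/
theorem FibreBound.mem_sp_opLxi_iff_spectrum {ξ : 𝕍} {lam : ℂ} (h0 : lam ≠ 0) :
    lam ∈ Sp (A.opLxi P ξ) ↔
      lam⁻¹ ∈ spectrum ℂ ((A.fibreForm P ξ).inv (S.embX (S.V S.o))) := by
  rw [hc.mem_sp_opLxi_iff, BForm.mem_spectrum_inv_iff (hc.coercive ξ)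
    (S.embX_isCompactOperator _) h0, pullInner_emb]

end Expansion

end Setting

/-! ### Trial vectors and the resolvent estimate away from `θ = 0` -/

namespace Setting

variable {n : ℕ} {H X : Type*} [NormedAddCommGroup H] [InnerProductSpace ℂ H] [CompleteSpace H]
  [NormedAddCommGroup X] [InnerProductSpace ℂ X] [CompleteSpace X] {S : Setting n H X}

local notation "𝕍" => EuclideanSpace ℝ (Fin n)

/-- A trial vector `U` with residual `δ₂` in the dual energy norm is within `δ₂` of the solution in
energy, and the energy dominates the norm after `t.j θ`. Testing on a dense set suffices. -/
theorem Transfer.norm_inv_sub_le {P : S.Splitting} (t : Transfer P) {ε : ℝ} (hε : 0 < ε)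
    (hε1 : ε < 1) (θ : S.Θ) (f : X) {U : H} {y : X} {δ₁ δ₂ : ℝ} (hδ₂ : 0 ≤ δ₂)
    (h₁ : ‖t.j θ U - y‖ ≤ δ₁) {D : Set H} (hD : Dense D)
    (hU : ∀ w ∈ D, ‖S.formL ε θ U w - inner ℂ (t.j θ w) f‖ ≤ δ₂ * (S.formL ε θ).en w) :
    ‖(S.formL ε θ).inv (t.j θ) f - y‖ ≤ δ₁ + δ₂ := by
  set u := (S.formL ε θ).sol (t.j θ) f with hu
  have h2 : (S.formL ε θ).en (u - U) ≤ δ₂ :=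
    BForm.en_sub_le_of_residual (S.isNonneg_formL ε θ) (ℓ := fun w => inner ℂ (t.j θ w) f)
      (by fun_prop) hδ₂ (BForm.sol_spec (S.formL_coercive hε θ hε1) (t.j θ) f) hD hU
  have h3 : (S.formL ε θ).inv (t.j θ) f - y = (t.j θ U - y) + t.j θ (u - U) := by
    rw [map_sub]
    change t.j θ u - y = _
    abel
  rw [h3]
  exact (norm_add_le _ _).trans (add_le_add h₁
    ((t.norm_j_le θ _).trans ((S.en_b_le_formL θ _).trans h2)))

theorem norm_b_le {θ : S.Θ} {K : ℝ} (hK : ∀ u, S.nrm θ u ≤ K * ‖u‖) (u w : H) :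
    ‖S.b θ u w‖ ≤ K * ‖u‖ * (K * ‖w‖) := by
  refine ((S.isNonneg_b θ).norm_le u w).trans ?_
  have h1 := (S.en_b_le_nrm θ u).trans (hK u)
  have h2 := (S.en_b_le_nrm θ w).trans (hK w)
  exact mul_le_mul h1 h2 (BForm.en_nonneg _ _) ((BForm.en_nonneg _ _).trans h1)

namespace Transfer

variable {P : S.Splitting} (t : Transfer P)

theorem en_b_e (θ : S.Θ) (v : P.Vs) : (S.b θ).en (t.e θ v) = ‖v‖ := by
  rw [BForm.en, t.b_e, S.b_zero_eq_inner (P.Vs_le v.2), inner_self_eq_norm_sq_to_K]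
  change √(((‖(v : H)‖ : ℂ)) ^ 2).re = ‖(v : H)‖
  rw [← Complex.ofReal_pow, Complex.ofReal_re, Real.sqrt_sq (norm_nonneg _)]

theorem a_e_left (θ : S.Θ) (v : P.Vs) (u : H) : S.a θ (t.e θ v) u = 0 :=
  S.a_left_V (P.Vstar_le θ (t.e θ v).2) u

theorem a_e_right (θ : S.Θ) (v : P.Vs) (u : H) : S.a θ u (t.e θ v) = 0 :=
  S.a_right_V (P.Vstar_le θ (t.e θ v).2) u

end Transfer

namespace Expansion

variable {A : S.Expansion} {P : S.Splitting} {c : ℝ} (hc : A.FibreBound P c)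

section

include hc

/-- The solution of the fibre problem with right-hand side in `X`. -/
theorem FibreBound.exists_fibreX_bound : ∃ C : ℝ, 0 ≤ C ∧ ∀ (ε : ℝ), 0 < ε → ∀ (θ : 𝕍) (f : X),
    ∃ (v : P.Vs) (z : P.Z), (A.fibreForm P (ε⁻¹ • θ)).inv (S.embX (S.V S.o)) f = S.J v + S.J z ∧
      (∀ (v' : P.Vs) (z' : P.Z), ((ε ^ 2)⁻¹ : ℂ) * A.ahForm θ (P.inclZ z) (P.inclZ z') +
        (S.b S.o v v' + S.b S.o v z' + S.b S.o z v' + S.b S.o z z') =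
          inner ℂ (S.J v') f + inner ℂ (S.J z') f) ∧
      ‖v‖ ≤ C * ‖f‖ ∧ ‖z‖ ≤ C * ‖f‖ ∧ ‖θ‖ * ‖z‖ ≤ C * ε * ‖f‖ ∧
      ‖θ‖ ^ 2 * ‖z‖ ≤ C * ε ^ 2 * ‖f‖ := by
  have hpos := hc.pos
  set C := ‖P.projVs‖ + ‖P.projZ‖ + 2 / c with hC
  have hC1 : ‖P.projVs‖ ≤ C := by
    have := norm_nonneg P.projZ
    have : 0 ≤ 2 / c := by positivity
    linarith
  have hC2 : ‖P.projZ‖ ≤ C := by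
    have := norm_nonneg P.projVs
    have : 0 ≤ 2 / c := by positivity
    linarith
  have hC3 : 2 / c ≤ C := by
    have := norm_nonneg P.projVs
    have := norm_nonneg P.projZ
    linarith
  have hC0 : 0 ≤ C := by positivity
  refine ⟨C, hC0, fun ε hε θ f => ?_⟩
  set q := A.fibreForm P (ε⁻¹ • θ) with hq
  set s := q.sol (S.embX (S.V S.o)) f with hs
  have hspec := BForm.sol_spec (hc.coercive (ε⁻¹ • θ)) (S.embX (S.V S.o)) f
  obtain ⟨b1, b2⟩ := hc.sol_bound (ξ := ε⁻¹ • θ) (s := s) (norm_nonneg f) fun w => by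
    rw [hs, hspec]
    refine (norm_inner_le_norm _ _).trans ?_
    rw [mul_comm]
    gcongr
    exact S.norm_J_le w
  set v := P.projVs s with hv
  set z := P.projZ s with hz
  have hvb : ‖v‖ ≤ C * ‖f‖ := (P.projVs.le_opNorm s).trans (by gcongr)
  have hzb : ‖z‖ ≤ C * ‖f‖ := (P.projZ.le_opNorm s).trans (by gcongr)
  -- This is the bound on `|ξ|² ‖z‖` from `sol_bound` with `ξ = θ/ε`. The bound on `‖θ‖ * ‖z‖` below
  -- interpolates it with the one on `‖z‖`.
  have h4 : ‖θ‖ ^ 2 * ‖z‖ ≤ C * ε ^ 2 * ‖f‖ := by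
    rw [norm_smul, mul_pow, norm_inv, Real.norm_of_nonneg hε.le] at b2
    have h5 : ‖θ‖ ^ 2 * ‖z‖ ≤ 2 / c * ε ^ 2 * ‖f‖ := by
      have h6 : c * ((ε⁻¹) ^ 2 * ‖θ‖ ^ 2) * ‖z‖ = (c / ε ^ 2) * (‖θ‖ ^ 2 * ‖z‖) := by
        field_simp
      rw [h6] at b2
      have h7 : ‖θ‖ ^ 2 * ‖z‖ = (ε ^ 2 / c) * ((c / ε ^ 2) * (‖θ‖ ^ 2 * ‖z‖)) := by field_simp
      rw [h7]
      calc _ ≤ (ε ^ 2 / c) * (2 * ‖f‖) := by gcongr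
        _ = _ := by ring
    refine h5.trans ?_
    gcongr
  refine ⟨v, z, ?_, fun v' z' => ?_, hvb, hzb, ?_, h4⟩
  · change S.J (s : H) = _
    rw [← map_add, hv, hz, P.coe_proj_add]
  · have h5 := hspec (P.inclVs v' + P.inclZ z')
    rw [← hs, fibreForm_apply, P.projZ_add] at h5
    have h6 : A.ahForm (ε⁻¹ • θ) (P.inclZ z) (P.inclZ z') =
        ((ε ^ 2)⁻¹ : ℂ) * A.ahForm θ (P.inclZ z) (P.inclZ z') := by
      rw [ahForm_smul]
      simp
    have h7 : S.b S.o s (P.inclVs v' + P.inclZ z' : S.V S.o) =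
        S.b S.o v v' + S.b S.o v z' + S.b S.o z v' + S.b S.o z z' := by
      rw [← P.coe_proj_add s]
      change S.b S.o ((v : H) + (z : H)) ((v' : H) + (z' : H)) = _
      simp only [map_add, add_apply]
      ring
    have h8 : inner ℂ (S.embX (S.V S.o) (P.inclVs v' + P.inclZ z')) f =
        inner ℂ (S.J v') f + inner ℂ (S.J z') f := by
      change inner ℂ (S.J ((v' : H) + (z' : H))) f = _
      rw [map_add, inner_add_left]
    rw [h6, h7, h8] at h5
    exact h5
  · have h5 : (‖θ‖ * ‖z‖) ^ 2 ≤ (C * ε * ‖f‖) ^ 2 := by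
      calc (‖θ‖ * ‖z‖) ^ 2 = (‖θ‖ ^ 2 * ‖z‖) * ‖z‖ := by ring
        _ ≤ (C * ε ^ 2 * ‖f‖) * (C * ‖f‖) := by gcongr
        _ = _ := by ring
    exact (abs_le_of_sq_le_sq' h5 (by positivity)).2

end

/-- The resolvent estimate away from `θ = 0`. -/
theorem FibreBound.exists_far_estimate (hc : A.FibreBound P c) (h3 : S.QuadraticGap)
    (t : Transfer P) {δ : ℝ} (hδ : 0 < δ) : ∃ C : ℝ, 0 ≤ C ∧
    ∀ θ : S.Θ, δ < ‖(θ : 𝕍)‖ → ∀ ε : ℝ, 0 < ε → ε < 1 → ∀ f : X,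
      ‖(S.formL ε θ).inv (t.j θ) f -
        (A.fibreForm P (ε⁻¹ • (θ : 𝕍))).inv (S.embX (S.V S.o)) f‖ ≤ C * ε * ‖f‖ := by
  obtain ⟨C, hC, hsol⟩ := hc.exists_fibreX_bound
  obtain ⟨γ, hγ, hgap⟩ := h3
  set G := (√γ * δ)⁻¹ with hG
  have hγ' := Real.sqrt_pos.2 hγ
  have hG0 : 0 ≤ G := by positivity
  refine ⟨C / δ ^ 2 + ((C * G + G) + C / δ ^ 2), by positivity, fun θ hθ ε hε hε1 f => ?_⟩
  obtain ⟨v, z, hJ, heq, hv, -, -, hz⟩ := hsol ε hε θ f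
  have hne : θ ≠ S.o := by
    rintro rfl
    have : ‖((S.o : S.Θ) : 𝕍)‖ = 0 := norm_zero
    rw [this] at hθ
    exact absurd hθ hδ.not_gt
  have hz' : ‖z‖ ≤ C / δ ^ 2 * (ε * ‖f‖) := by
    have h1 : δ ^ 2 * ‖z‖ ≤ C * ε ^ 2 * ‖f‖ := le_trans (by gcongr) hz
    rw [div_mul_eq_mul_div, le_div_iff₀ (by positivity)]
    calc ‖z‖ * δ ^ 2 ≤ C * ε ^ 2 * ‖f‖ := by linarith
      _ ≤ C * ε * ‖f‖ := by
        gcongr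
        nlinarith
      _ = _ := by ring
  -- For `|θ| > δ` the defect component `z` is itself `O(ε)`, so the trial vector keeps only the
  -- transferred `V_⋆`-component.
  have hmain := t.norm_inv_sub_le hε hε1 θ f (U := t.e θ v)
    (y := (A.fibreForm P (ε⁻¹ • (θ : 𝕍))).inv (S.embX (S.V S.o)) f)
    (δ₁ := C / δ ^ 2 * (ε * ‖f‖)) (δ₂ := ((C * G + G) + C / δ ^ 2) * (ε * ‖f‖)) (by positivity)
    ?_ dense_univ ?_
  · refine hmain.trans (le_of_eq ?_)
    ring
  · rw [t.j_e, hJ, sub_add_cancel_left, norm_neg]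
    exact (S.norm_J_le _).trans hz'
  · intro w _
    obtain ⟨v', hv', w', hw', rfl⟩ := S.exists_add_W θ w
    obtain ⟨v₁, hv₁⟩ := (t.e θ).surjective ⟨v', by rwa [P.Vstar_of_ne hne]⟩
    have hv₁' : (t.e θ v₁ : H) = v' := congrArg Subtype.val hv₁
    rw [← hv₁']
    set 𝓔 := (S.formL ε θ).en ((t.e θ v₁ : H) + w') with h𝓔
    have h𝓔0 : 0 ≤ 𝓔 := BForm.en_nonneg _ _
    have e1 : (S.a θ).en w' ≤ ε * 𝓔 := by
      have h1 : (S.a θ).en ((t.e θ v₁ : H) + w') = (S.a θ).en w' := by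
        simp only [BForm.en, map_add, add_apply, t.a_e_left, t.a_e_right, zero_add]
      rw [← h1]
      exact S.en_a_le_formL hε θ _
    have e2 : S.nrm θ w' ≤ G * (ε * 𝓔) := by
      have h1 := hgap θ w' hw'
      have h2 : √γ * δ * S.nrm θ w' ≤ (S.a θ).en w' := by
        have h5 : (√γ * δ * S.nrm θ w') ^ 2 ≤ (S.a θ).en w' ^ 2 := by
          rw [mul_pow, mul_pow, Real.sq_sqrt hγ.le, (S.isNonneg_a θ).en_sq]
          refine le_trans ?_ h1
          gcongr
        exact (abs_le_of_sq_le_sq' h5 (BForm.en_nonneg _ _)).2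
      rw [hG, le_inv_mul_iff₀ (by positivity)]
      exact h2.trans e1
    have e3 : (S.b θ).en w' ≤ G * (ε * 𝓔) := (S.en_b_le_nrm θ w').trans e2
    -- `V_θ` and `W_θ` are orthogonal for `a_θ + b_θ`, so the kernel part is no larger than the
    -- whole.
    have e4 : ‖v₁‖ ≤ 𝓔 := by
      have h1 : S.nrm θ (t.e θ v₁) ^ 2 ≤ 𝓔 ^ 2 := by
        have h2 : S.nrm θ ((t.e θ v₁ : H) + w') ^ 2 =
            S.nrm θ (t.e θ v₁) ^ 2 + S.nrm θ w' ^ 2 := by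
          have h3 := hw' _ (P.Vstar_le θ (t.e θ v₁).2)
          have h4 : S.a θ (t.e θ v₁) w' + S.b θ (t.e θ v₁) w' = 0 := by
            rw [(S.isNonneg_a θ).herm, (S.isNonneg_b θ).herm, ← map_add, h3, map_zero]
          have h3' := congrArg Complex.re h3
          have h4' := congrArg Complex.re h4
          simp only [Complex.add_re, Complex.zero_re] at h3' h4'
          simp only [nrm_sq, map_add, add_apply, Complex.add_re]
          linarith
        have h3 : S.nrm θ ((t.e θ v₁ : H) + w') ≤ 𝓔 := S.nrm_le_formL hε θ _ hε1
        have h4 := pow_le_pow_left₀ (S.nrm_nonneg θ _) h3 2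
        nlinarith [sq_nonneg (S.nrm θ w')]
      rw [← t.en_b_e θ v₁]
      exact (S.en_b_le_nrm θ _).trans (abs_le_of_sq_le_sq' h1 h𝓔0).2
    -- The fibre equation tested with `(v₁, 0)` cancels the leading terms; the rest contains `w'` or
    -- `z`, both small.
    have e5 : S.formL ε θ (t.e θ v) ((t.e θ v₁ : H) + w') -
        inner ℂ (t.j θ ((t.e θ v₁ : H) + w')) f =
        (S.b θ (t.e θ v) w' - inner ℂ (t.j θ w') f) - S.b S.o z v₁ := by
      have h1 := heq v₁ 0
      simp only [map_zero, inner_zero_left, ZeroMemClass.coe_zero, mul_zero, add_zero,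
        zero_add] at h1
      rw [formL_apply, t.a_e_left, map_add, map_add, t.b_e, inner_add_left, t.j_e, ← h1]
      ring
    rw [e5]
    have f1 : ‖S.b θ (t.e θ v) w'‖ ≤ (C * ‖f‖) * (G * (ε * 𝓔)) := by
      refine ((S.isNonneg_b θ).norm_le _ _).trans ?_
      rw [t.en_b_e]
      have := BForm.en_nonneg (S.b θ) w'
      gcongr
    have f2 : ‖inner ℂ (t.j θ w') f‖ ≤ (G * (ε * 𝓔)) * ‖f‖ := by
      refine (norm_inner_le_norm _ _).trans ?_
      gcongr
      exact (t.norm_j_le θ w').trans e3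
    have f3 : ‖S.b S.o z v₁‖ ≤ (C / δ ^ 2 * (ε * ‖f‖)) * 𝓔 := by
      rw [S.b_zero_eq_inner (P.Z_le z.2)]
      refine (norm_inner_le_norm _ _).trans ?_
      rw [mul_comm]
      exact mul_le_mul hz' e4 (norm_nonneg _) (by positivity)
    calc _ ≤ ((C * ‖f‖) * (G * (ε * 𝓔)) + (G * (ε * 𝓔)) * ‖f‖) +
          (C / δ ^ 2 * (ε * ‖f‖)) * 𝓔 :=
        (norm_sub_le _ _).trans (add_le_add ((norm_sub_le _ _).trans (add_le_add f1 f2)) f3)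
      _ = _ := by ring

end Expansion

end Setting

/-! ### The resolvent estimate near `θ = 0` -/

namespace Setting

variable {n : ℕ} {H X : Type*} [NormedAddCommGroup H] [InnerProductSpace ℂ H] [CompleteSpace H]
  [NormedAddCommGroup X] [InnerProductSpace ℂ X] [CompleteSpace X] {S : Setting n H X}

local notation "𝕍" => EuclideanSpace ℝ (Fin n)

namespace Expansion

variable {A : S.Expansion} {P : S.Splitting} {c : ℝ}

set_option maxHeartbeats 1600000 in
/-- The resolvent estimate near `θ = 0`. -/
theorem FibreBound.exists_near_estimate (hc : A.FibreBound P c) (h1 : S.GapCondition)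
    (h2 : P.RemovableSingularity) (h3 : S.QuadraticGap) (h5 : S.LipschitzB)
    (t : Transfer P) : ∃ δ C : ℝ, 0 < δ ∧ 0 ≤ C ∧
    ∀ θ : S.Θ, ‖(θ : 𝕍)‖ ≤ δ → ∀ ε : ℝ, 0 < ε → ε < 1 → ∀ f : X,
      ‖(S.formL ε θ).inv (t.j θ) f -
        (A.fibreForm P (ε⁻¹ • (θ : 𝕍))).inv (S.embX (S.V S.o)) f‖ ≤ C * ε * ‖f‖ := by
  obtain ⟨C, hC, hsol⟩ := hc.exists_fibreX_bound
  obtain ⟨δ₁, D, hδ₁, hD, hdec⟩ := P.exists_decomposition h2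
  obtain ⟨δ₂, L, hδ₂, hL, hlow⟩ := A.exists_a_lower P h1 h2 h3
  obtain ⟨K, hK, hKu⟩ := S.exists_nrm_equiv
  obtain ⟨B, hB, hNb⟩ := A.exists_NSum_bound
  obtain ⟨M₁, hM₁, hcor⟩ := A.exists_a_corrected h1
  obtain ⟨M₂, hM₂, hcor₂⟩ := A.exists_a_corrected_corrected h1
  obtain ⟨-, Lb, hLb, hbLip⟩ := h5
  obtain ⟨Kc, hKc, hcoup⟩ := t.coupling
  obtain ⟨Ke, hKe, hjsub⟩ := t.exists_norm_j_sub_le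
  have hK0 : 0 ≤ K := zero_le_one.trans hK
  have hD0 : 0 ≤ D := zero_le_one.trans hD
  have hKn : ∀ θ u, S.nrm θ u ≤ K * ‖u‖ := fun θ u => (hKu θ u).1
  refine ⟨min δ₁ δ₂, (Ke * C + K * (B * C)) + (M₂ * C * L + M₁ * C * (L + B * L) +
    Kc * C * L + C * (K * L) + Kc * (K * D * K) * C + Lb * C * (K * D * K) + K * C * (K * L) +
    K * (B * C) * (K * K) + Ke * L + K * L), by positivity, by positivity,
    fun θ hθ ε hε hε1 f => ?_⟩
  obtain ⟨v, z, hJ, heq, hv, hz, hz1, hz2⟩ := hsol ε hε θ f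
  set T : ℝ := ‖(θ : 𝕍)‖ with hT
  set F : ℝ := ‖f‖ with hF
  have hT0 : 0 ≤ T := norm_nonneg _
  have hF0 : 0 ≤ F := norm_nonneg _
  set N : H := A.NSum θ (P.inclZ z) with hN
  have hNn : ‖N‖ ≤ B * (C * ε * F) := by
    refine (hNb θ (P.inclZ z)).trans ?_
    rw [mul_assoc]
    exact mul_le_mul_of_nonneg_left hz1 hB
  -- The `V_⋆`-part is transferred to `V^⋆_θ`, where `a_θ` vanishes; the `Z`-part gets the corrector
  -- `N`, which cancels the first order of `a_θ`. Test vectors are taken from the dense sum of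
  -- `V^⋆_θ`, `Z` and `W_0`.
  have hmain := t.norm_inv_sub_le hε hε1 θ f (U := t.e θ v + (z + N))
    (y := (A.fibreForm P (ε⁻¹ • (θ : 𝕍))).inv (S.embX (S.V S.o)) f)
    (δ₁ := (Ke * C + K * (B * C)) * (ε * F))
    (δ₂ := (M₂ * C * L + M₁ * C * (L + B * L) +
    Kc * C * L + C * (K * L) + Kc * (K * D * K) * C + Lb * C * (K * D * K) + K * C * (K * L) +
    K * (B * C) * (K * K) + Ke * L + K * L) * (ε * F)) (by positivity)
    ?_ (hdec θ (hθ.trans (min_le_left _ _))).2 ?_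
  · refine hmain.trans (le_of_eq ?_)
    ring
  · rw [hJ]
    have e1 : t.j θ (t.e θ v + (z + N)) - (S.J v + S.J z) =
        (t.j θ z - S.J z) + t.j θ N := by
      rw [map_add, map_add, t.j_e]
      abel
    rw [e1]
    have e2 : ‖t.j θ z - S.J z‖ ≤ Ke * (C * ε * F) := by
      refine (hjsub θ z).trans ?_
      rw [mul_assoc]
      exact mul_le_mul_of_nonneg_left hz1 hKe
    have e3 : ‖t.j θ N‖ ≤ K * (B * (C * ε * F)) :=
      (t.norm_j_le θ N).trans ((S.en_b_le_nrm θ N).trans ((hKn θ N).trans (by gcongr)))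
    calc _ ≤ Ke * (C * ε * F) + K * (B * (C * ε * F)) :=
          (norm_add_le _ _).trans (add_le_add e2 e3)
      _ = _ := by ring
  · rintro _ ⟨v₁', hv₁', z₁', hz₁', w, hw, rfl⟩
    obtain ⟨v₁, rfl⟩ : ∃ v₁ : P.Vs, v₁' = t.e θ v₁ := by
      obtain ⟨v₁, hv₁⟩ := (t.e θ).surjective ⟨v₁', hv₁'⟩
      exact ⟨v₁, (congrArg Subtype.val hv₁).symm⟩
    obtain ⟨z₁, rfl⟩ : ∃ z₁ : P.Z, z₁' = z₁ := ⟨⟨z₁', hz₁'⟩, rfl⟩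
    obtain ⟨d1, d2, -⟩ := (hdec θ (hθ.trans (min_le_left _ _))).1 _ hv₁' z₁ hz₁' w hw
    obtain ⟨l1, l2⟩ := hlow θ (hθ.trans (min_le_right _ _)) z₁ hz₁' w hw
    set 𝓔 := (S.formL ε θ).en ((t.e θ v₁ : H) + z₁ + w) with h𝓔
    have h𝓔0 : 0 ≤ 𝓔 := BForm.en_nonneg _ _
    have hs : ‖(t.e θ v₁ : H) + z₁ + w‖ ≤ K * 𝓔 :=
      (hKu θ _).2.trans (mul_le_mul_of_nonneg_left (S.nrm_le_formL hε θ _ hε1) hK0)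
    have ha : (S.a θ).en ((z₁ : H) + w) ≤ ε * 𝓔 := by
      have h1 : (S.a θ).en ((t.e θ v₁ : H) + z₁ + w) = (S.a θ).en ((z₁ : H) + w) := by
        rw [add_assoc]
        simp only [BForm.en, map_add (S.a θ) (t.e θ v₁ : H), add_apply, t.a_e_left,
          map_add _ (t.e θ v₁ : H), t.a_e_right, zero_add]
      rw [← h1]
      exact S.en_a_le_formL hε θ _
    -- The energy contains `ε⁻² a_θ`, so the transversal quantities `|θ| ‖z₁‖` and `‖w‖` are
    -- `O(ε𝓔)`, whereas `z₁` and `v₁` are only bounded by multiples of `𝓔`.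
    have x1 : T * ‖z₁‖ ≤ L * (ε * 𝓔) := l1.trans (by gcongr)
    have x2 : ‖w‖ ≤ L * (ε * 𝓔) := l2.trans (by gcongr)
    have x3 : ‖z₁‖ ≤ D * (K * 𝓔) := d2.trans (by gcongr)
    have x4 : ‖v₁‖ ≤ K * (D * (K * 𝓔)) := by
      rw [← t.en_b_e θ v₁]
      exact (S.en_b_le_nrm θ _).trans ((hKn θ _).trans (by gcongr; exact d1.trans (by gcongr)))
    set N₁ : H := A.NSum θ (P.inclZ z₁) with hN₁
    have x5 : ‖w - N₁‖ ≤ (L + B * L) * (ε * 𝓔) := by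
      have h1 : ‖N₁‖ ≤ B * (L * (ε * 𝓔)) := by
        refine (hNb θ (P.inclZ z₁)).trans ?_
        rw [mul_assoc]
        exact mul_le_mul_of_nonneg_left x1 hB
      calc _ ≤ L * (ε * 𝓔) + B * (L * (ε * 𝓔)) := (norm_sub_le _ _).trans (add_le_add x2 h1)
        _ = _ := by ring
    -- The test vector is also corrected, `z₁ + w = (z₁ + N₁) + (w - N₁)`, so that `a_θ` can be
    -- compared with the homogenised form; the fibre equation then removes all leading terms.
    have hid : S.formL ε θ (t.e θ v + (z + N)) ((t.e θ v₁ : H) + z₁ + w) -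
        inner ℂ (t.j θ ((t.e θ v₁ : H) + z₁ + w)) f =
        ((ε ^ 2)⁻¹ : ℂ) * (S.a θ (z + N) (z₁ + N₁) - A.ahForm θ (P.inclZ z) (P.inclZ z₁)) +
        ((ε ^ 2)⁻¹ : ℂ) * S.a θ (z + N) (w - N₁) +
        (S.b θ (t.e θ v) z₁ - S.b S.o v z₁) + S.b θ (t.e θ v) w +
        (S.b θ z (t.e θ v₁) - S.b S.o z v₁) + (S.b θ z z₁ - S.b S.o z z₁) + S.b θ z w +
        S.b θ N ((t.e θ v₁ : H) + z₁ + w) - inner ℂ (t.j θ z₁ - S.J z₁) f -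
        inner ℂ (t.j θ w) f := by
      have g1 := heq v₁ z₁
      have g2 : S.a θ (t.e θ v + (z + N)) ((t.e θ v₁ : H) + z₁ + w) =
          S.a θ (z + N) (z₁ + N₁) + S.a θ (z + N) (w - N₁) := by
        rw [map_add (S.a θ) (t.e θ v : H), add_apply, t.a_e_left, zero_add, add_assoc,
          map_add _ (t.e θ v₁ : H), t.a_e_right, zero_add, ← map_add]
        congr 1
        abel
      have g3 : S.b θ (t.e θ v + (z + N)) ((t.e θ v₁ : H) + z₁ + w) =
          S.b S.o v v₁ + S.b θ (t.e θ v) z₁ + S.b θ (t.e θ v) w + S.b θ z (t.e θ v₁) +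
            S.b θ z z₁ + S.b θ z w + S.b θ N ((t.e θ v₁ : H) + z₁ + w) := by
        rw [← t.b_e θ]
        simp only [map_add, add_apply]
        ring
      have g4 : inner ℂ (t.j θ ((t.e θ v₁ : H) + z₁ + w)) f =
          inner ℂ (S.J v₁) f + inner ℂ (t.j θ z₁) f + inner ℂ (t.j θ w) f := by
        rw [map_add, map_add, inner_add_left, inner_add_left, t.j_e]
      rw [formL_apply, g2, g3, g4, inner_sub_left]
      linear_combination g1
    rw [hid]
    have hεc : ‖((ε ^ 2)⁻¹ : ℂ)‖ = (ε ^ 2)⁻¹ := by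
      rw [norm_inv, norm_pow, Complex.norm_real, Real.norm_of_nonneg hε.le]
    -- The factor `ε⁻²` is paid for by splitting `|θ|³` into `|θ|² ‖z‖ = O(ε²)` and `|θ| ‖z₁‖ =
    -- O(ε𝓔)`.
    have y1 : ‖((ε ^ 2)⁻¹ : ℂ) * (S.a θ (z + N) (z₁ + N₁) -
        A.ahForm θ (P.inclZ z) (P.inclZ z₁))‖ ≤ M₂ * C * L * (ε * F) * 𝓔 := by
      rw [norm_mul, hεc]
      calc _ ≤ (ε ^ 2)⁻¹ * (M₂ * T ^ 3 * ‖z‖ * ‖z₁‖) := by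
            gcongr
            exact hcor₂ θ (P.inclZ z) (P.inclZ z₁)
        _ = (ε ^ 2)⁻¹ * (M₂ * ((T ^ 2 * ‖z‖) * (T * ‖z₁‖))) := by ring
        _ ≤ (ε ^ 2)⁻¹ * (M₂ * ((C * ε ^ 2 * F) * (L * (ε * 𝓔)))) := by gcongr
        _ = _ := by field_simp
    have y2 : ‖((ε ^ 2)⁻¹ : ℂ) * S.a θ (z + N) (w - N₁)‖ ≤
        M₁ * C * (L + B * L) * (ε * F) * 𝓔 := by
      rw [norm_mul, hεc]
      calc _ ≤ (ε ^ 2)⁻¹ * (M₁ * T ^ 2 * ‖z‖ * ‖w - N₁‖) := by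
            gcongr
            exact hcor θ (P.inclZ z) (w - N₁)
        _ = (ε ^ 2)⁻¹ * (M₁ * (T ^ 2 * ‖z‖) * ‖w - N₁‖) := by ring
        _ ≤ (ε ^ 2)⁻¹ * (M₁ * (C * ε ^ 2 * F) * ((L + B * L) * (ε * 𝓔))) := by gcongr
        _ = _ := by field_simp
    have y3 : ‖S.b θ (t.e θ v) z₁ - S.b S.o v z₁‖ ≤ Kc * C * L * (ε * F) * 𝓔 := by
      calc _ ≤ Kc * T * ‖v‖ * ‖z₁‖ := hcoup θ v z₁ z₁.2
        _ = Kc * ‖v‖ * (T * ‖z₁‖) := by ring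
        _ ≤ Kc * (C * F) * (L * (ε * 𝓔)) := by gcongr
        _ = _ := by ring
    have y4 : ‖S.b θ (t.e θ v) w‖ ≤ C * (K * L) * (ε * F) * 𝓔 := by
      calc _ ≤ ‖v‖ * (K * ‖w‖) := by
            refine ((S.isNonneg_b θ).norm_le _ _).trans ?_
            rw [t.en_b_e]
            gcongr
            exact (S.en_b_le_nrm θ w).trans (hKn θ w)
        _ ≤ (C * F) * (K * (L * (ε * 𝓔))) := by gcongr
        _ = _ := by ring
    have y5 : ‖S.b θ z (t.e θ v₁) - S.b S.o z v₁‖ ≤ Kc * (K * D * K) * C * (ε * F) * 𝓔 := by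
      rw [(S.isNonneg_b θ).herm, (S.isNonneg_b S.o).herm, ← map_sub, RCLike.norm_conj]
      calc _ ≤ Kc * T * ‖v₁‖ * ‖z‖ := hcoup θ v₁ z z.2
        _ = Kc * ‖v₁‖ * (T * ‖z‖) := by ring
        _ ≤ Kc * (K * (D * (K * 𝓔))) * (C * ε * F) := by gcongr
        _ = _ := by ring
    have y6 : ‖S.b θ z z₁ - S.b S.o z z₁‖ ≤ Lb * C * (K * D * K) * (ε * F) * 𝓔 := by
      have := hbLip θ z (P.Z_le z.2) z₁ (P.Z_le z₁.2)
      rw [S.nrm_zero] at this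
      have g1 : S.nrm θ z₁ ≤ K * (D * (K * 𝓔)) :=
        (hKn θ z₁).trans (mul_le_mul_of_nonneg_left x3 hK0)
      have g2 := S.nrm_nonneg θ (z₁ : H)
      calc _ ≤ Lb * T * ‖z‖ * S.nrm θ z₁ := this
        _ = Lb * (T * ‖z‖) * S.nrm θ z₁ := by ring
        _ ≤ Lb * (C * ε * F) * (K * (D * (K * 𝓔))) := by gcongr
        _ = _ := by ring
    have y7 : ‖S.b θ z w‖ ≤ K * C * (K * L) * (ε * F) * 𝓔 := by
      calc _ ≤ K * ‖z‖ * (K * ‖w‖) := norm_b_le (hKn θ) _ _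
        _ ≤ K * (C * F) * (K * (L * (ε * 𝓔))) := by gcongr
        _ = _ := by ring
    have y8 : ‖S.b θ N ((t.e θ v₁ : H) + z₁ + w)‖ ≤ K * (B * C) * (K * K) * (ε * F) * 𝓔 := by
      calc _ ≤ K * ‖N‖ * (K * ‖(t.e θ v₁ : H) + z₁ + w‖) := norm_b_le (hKn θ) _ _
        _ ≤ K * (B * (C * ε * F)) * (K * (K * 𝓔)) := by gcongr
        _ = _ := by ring
    have y9 : ‖inner ℂ (t.j θ z₁ - S.J z₁) f‖ ≤ Ke * L * (ε * F) * 𝓔 := by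
      calc _ ≤ (Ke * T * ‖z₁‖) * F :=
            (norm_inner_le_norm _ _).trans (mul_le_mul_of_nonneg_right (hjsub θ z₁) hF0)
        _ = (Ke * (T * ‖z₁‖)) * F := by ring
        _ ≤ (Ke * (L * (ε * 𝓔))) * F := by gcongr
        _ = _ := by ring
    have y10 : ‖inner ℂ (t.j θ w) f‖ ≤ K * L * (ε * F) * 𝓔 := by
      calc _ ≤ (K * ‖w‖) * F :=
            (norm_inner_le_norm _ _).trans (mul_le_mul_of_nonneg_right
              ((t.norm_j_le θ w).trans ((S.en_b_le_nrm θ w).trans (hKn θ w))) hF0)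
        _ ≤ (K * (L * (ε * 𝓔))) * F := by gcongr
        _ = _ := by ring
    refine ((norm_sub_le _ _).trans (add_le_add ((norm_sub_le _ _).trans (add_le_add
      ((norm_add_le _ _).trans (add_le_add ((norm_add_le _ _).trans (add_le_add
      ((norm_add_le _ _).trans (add_le_add ((norm_add_le _ _).trans (add_le_add
      ((norm_add_le _ _).trans (add_le_add ((norm_add_le _ _).trans (add_le_add
      ((norm_add_le _ _).trans (add_le_add y1 y2)) y3)) y4)) y5)) y6)) y7)) y8)) y9))
      y10)).trans (le_of_eq ?_)
    ring

/-- The resolvents of `𝓛_{ε,θ}` and `𝕃_{θ/ε}` differ by `O(ε)`. -/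
theorem FibreBound.exists_resolvent_estimate (hc : A.FibreBound P c) (h1 : S.GapCondition)
    (h2 : P.RemovableSingularity) (h3 : S.QuadraticGap) (h5 : S.LipschitzB)
    (t : Transfer P) : ∃ C : ℝ, 0 ≤ C ∧
    ∀ (θ : S.Θ) (ε : ℝ), 0 < ε → ε < 1 → ∀ f : X,
      ‖(S.formL ε θ).inv (t.j θ) f -
        (A.fibreForm P (ε⁻¹ • (θ : 𝕍))).inv (S.embX (S.V S.o)) f‖ ≤ C * ε * ‖f‖ := by
  obtain ⟨δ, C, hδ, hC, hnear⟩ := hc.exists_near_estimate h1 h2 h3 h5 t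
  obtain ⟨C', hC', hfar⟩ := hc.exists_far_estimate h3 t hδ
  refine ⟨max C C', le_max_of_le_left hC, fun θ ε hε hε1 f => ?_⟩
  rcases le_or_gt ‖(θ : 𝕍)‖ δ with h | h
  · exact (hnear θ h ε hε hε1 f).trans (by gcongr; exact le_max_left _ _)
  · exact (hfar θ h ε hε hε1 f).trans (by gcongr; exact le_max_right _ _)

end Expansion

end Setting

/-- An eigenvalue increases the counting function. -/
theorem BForm.specCount_lt {E Y : Type*} [NormedAddCommGroup E] [InnerProductSpace ℂ E]
    [CompleteSpace E] [NormedAddCommGroup Y] [InnerProductSpace ℂ Y] [CompleteSpace Y]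
    {q : BForm E} (hq : q.IsCoerciveHermitian) {j : E →L[ℂ] Y} (hc : IsCompactOperator j)
    {r s t : ℝ} (hrt : r < t) (hts : t ≤ s) (h : pencilEigenspace q (pullInner j) t ≠ ⊥) :
    specCount q (pullInner j) r < specCount q (pullInner j) s := by
  have hfin := finiteDimensional_pencilSpan hq hc s
  refine Submodule.finrank_lt_finrank_of_lt (lt_of_le_of_ne
    (pencilSpan_mono _ _ (hrt.le.trans hts)) fun heq => ?_)
  obtain ⟨e, he, he0⟩ := Submodule.exists_mem_ne_zero_of_ne_bot h
  have h1 := pencilEigenspace_le_pencilSpan _ _ hts he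
  rw [← heq] at h1
  have h2 := re_le_of_mem_pencilSpan hq h1
  have h3 := he e
  have h4 := exists_pos_of_mem_pencilEigenspace hq he0 he
  rw [pullInner_self, ← Complex.ofReal_mul] at h3
  rw [h3, Complex.ofReal_re] at h2
  have h5 : 0 < ‖j e‖ ^ 2 := by
    have := norm_pos_iff.2 h4.1
    positivity
  exact absurd (le_of_mul_le_mul_right h2 h5) hrt.not_ge

/-! ### Counting functions and the location of the spectrum -/

namespace Setting

variable {n : ℕ} {H X : Type*} [NormedAddCommGroup H] [InnerProductSpace ℂ H] [CompleteSpace H]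
  [NormedAddCommGroup X] [InnerProductSpace ℂ X] [CompleteSpace X] {S : Setting n H X}

local notation "𝕍" => EuclideanSpace ℝ (Fin n)

theorem b_self_of_mem {u : H} (hu : u ∈ S.V S.o) : S.b S.o u u = ((‖u‖ ^ 2 : ℝ) : ℂ) := by
  rw [S.b_zero_eq_inner hu, inner_self_eq_norm_sq_to_K]
  simp

theorem b0_coercive {U : Submodule ℂ H} (hU : U ≤ S.V S.o) : (S.b0 U).IsCoerciveHermitian :=
  ⟨fun u w => (S.isNonneg_b S.o).herm u w, 1, one_pos, fun u => by
    change _ ≤ (S.b S.o u u).re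
    rw [S.b_self_of_mem (hU u.2), Complex.ofReal_re, one_mul]
    rfl⟩

/-- The counting function of the operator generated by `b_0` on `U`. -/
def count (S : Setting n H X) (U : Submodule ℂ H) (r : ℝ) : ℕ :=
  specCount (S.b0 U) (pullInner (S.emb U)) r

section Count

variable {U : Submodule ℂ H} [CompleteSpace U] (hU : U ≤ S.V S.o)
include hU

theorem le_count_iff (r : ℝ) (m : ℕ) : m ≤ S.count U r ↔ ∃ F : Submodule ℂ U,
    FiniteDimensional ℂ F ∧ m ≤ Module.finrank ℂ F ∧ ∀ u ∈ F, ‖u‖ ^ 2 ≤ r * ‖S.J u‖ ^ 2 := by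
  rw [count, BForm.le_specCount_iff (S.b0_coercive hU) (S.emb_isCompactOperator U)]
  refine exists_congr fun F => and_congr_right fun _ => and_congr_right fun _ =>
    forall_congr' fun u => forall_congr' fun _ => ?_
  have h1 : (S.b0 U u u).re = ‖u‖ ^ 2 := by
    change (S.b S.o u u).re = _
    rw [S.b_self_of_mem (hU u.2), Complex.ofReal_re]
    rfl
  rw [h1]
  rfl

theorem count_mono {r s : ℝ} (h : r ≤ s) : S.count U r ≤ S.count U s := by
  have := BForm.finiteDimensional_pencilSpan (S.b0_coercive hU) (S.emb_isCompactOperator U) s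
  exact Submodule.finrank_mono (pencilSpan_mono _ _ h)

theorem exists_count_eq_right (r : ℝ) : ∃ s, r < s ∧ S.count U s = S.count U r := by
  obtain ⟨s, hs, h⟩ := BForm.exists_pencilSpan_eq_right (S.b0_coercive hU)
    (S.emb_isCompactOperator U) r
  exact ⟨s, hs, by rw [count, specCount, h]; rfl⟩

theorem nthEigenvalue_opB (m : ℕ) :
    nthEigenvalue (S.opB U) m = sInf {r : ℝ | m ≤ S.count U r} :=
  BForm.nthEigenvalue_formOperator (S.b0_coercive hU) (S.emb_isCompactOperator U)
    (S.emb_denseRange U) (S.emb_injective U) m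

theorem nthEigenvalue_opB_le_iff {m : ℕ} (hm : 1 ≤ m) {F : Submodule ℂ U}
    (hF : FiniteDimensional ℂ F) (hmF : m ≤ Module.finrank ℂ F) (r : ℝ) :
    nthEigenvalue (S.opB U) m ≤ r ↔ m ≤ S.count U r := by
  rw [S.nthEigenvalue_opB hU]
  exact BForm.sInf_le_iff (S.b0_coercive hU) (S.emb_isCompactOperator U) hm
    (BForm.nonempty_of_le_finrank (S.b0_coercive hU) (S.emb_isCompactOperator U)
      (S.emb_injective U) hF hmF) r

end Count

namespace Expansion

variable {A : S.Expansion} {P : S.Splitting} {c : ℝ} (hc : A.FibreBound P c)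

variable (A P) in
/-- The counting function of `𝕃_ξ`. -/
def fibreCount (ξ : 𝕍) (r : ℝ) : ℕ :=
  specCount (A.fibreForm P ξ) (pullInner (S.emb (S.V S.o))) r

include hc
namespace FibreBound

theorem le_fibreCount_iff (ξ : 𝕍) (r : ℝ) (m : ℕ) : m ≤ A.fibreCount P ξ r ↔
    ∃ F : Submodule ℂ (S.V S.o), FiniteDimensional ℂ F ∧ m ≤ Module.finrank ℂ F ∧
      ∀ u ∈ F, (A.fibreForm P ξ u u).re ≤ r * ‖S.J u‖ ^ 2 :=
  BForm.le_specCount_iff (hc.coercive ξ) (S.emb_isCompactOperator _) r m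

theorem norm_sq_le (ξ : 𝕍) (u : S.V S.o) : ‖u‖ ^ 2 ≤ (A.fibreForm P ξ u u).re := by
  have h1 := hc.lower ξ u
  have h2 : 0 ≤ c * ‖ξ‖ ^ 2 * ‖P.projZ u‖ ^ 2 := by
    have := hc.pos
    positivity
  linarith

/-- Min-max: the fibre form dominates `b_0` on `V_0`. -/
theorem fibreCount_le (ξ : 𝕍) (r : ℝ) : A.fibreCount P ξ r ≤ S.count (S.V S.o) r := by
  rw [S.le_count_iff le_rfl]
  obtain ⟨F, hF, hm, h⟩ := (hc.le_fibreCount_iff ξ r _).1 le_rfl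
  exact ⟨F, hF, hm, fun u hu => (hc.norm_sq_le ξ u).trans (h u hu)⟩

/-- Min-max: on `V_⋆` the fibre form is `b_0`, whatever `ξ` is. -/
theorem count_le_fibreCount (ξ : 𝕍) (r : ℝ) : S.count P.Vs r ≤ A.fibreCount P ξ r := by
  rw [hc.le_fibreCount_iff]
  obtain ⟨F, hF, hm, h⟩ := (S.le_count_iff P.Vs_le r _).1 le_rfl
  have hinj : Function.Injective P.inclVs := fun v w h => by
    rw [← P.projVs_inclVs v, h, P.projVs_inclVs]
  refine ⟨F.map P.inclVs.toLinearMap, inferInstance, ?_, ?_⟩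
  · rwa [← (F.equivMapOfInjective P.inclVs.toLinearMap hinj).finrank_eq]
  · rintro _ ⟨v, hv, rfl⟩
    change (A.fibreForm P ξ (P.inclVs v) (P.inclVs v)).re ≤ r * ‖S.J v‖ ^ 2
    rw [fibreForm_apply, P.projZ_inclVs, map_zero, map_zero, zero_add]
    change (S.b S.o v v).re ≤ _
    rw [S.b_self_of_mem (P.Vs_le v.2), Complex.ofReal_re]
    exact h v hv

theorem count_le_count (r : ℝ) : S.count P.Vs r ≤ S.count (S.V S.o) r :=
  (hc.count_le_fibreCount 0 r).trans (hc.fibreCount_le 0 r)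

theorem fibreCount_zero (r : ℝ) : A.fibreCount P 0 r = S.count (S.V S.o) r := by
  have h : A.fibreForm P 0 = S.b0 (S.V S.o) := by
    ext u w
    have h1 := A.ahForm_smul 0 (0 : 𝕍) (P.inclZ (P.projZ u)) (P.inclZ (P.projZ w))
    rw [smul_zero] at h1
    rw [fibreForm_apply, h1]
    simp
    rfl
  rw [fibreCount, h]
  rfl

theorem fibreCount_eq_of_gap {ξ : 𝕍} {r s : ℝ} (hrs : r ≤ s)
    (h : ∀ t ∈ Ioc r s, (t : ℂ) ∉ Sp (A.opLxi P ξ)) :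
    A.fibreCount P ξ s = A.fibreCount P ξ r := by
  rw [fibreCount, specCount, pencilSpan_eq_of_forall _ _ hrs fun t ht => ?_]
  · rfl
  · have := h t ht
    rwa [hc.mem_sp_opLxi_iff, not_not] at this

theorem exists_real_of_mem_sp_opLxi {ξ : 𝕍} {lam : ℂ} (h : lam ∈ Sp (A.opLxi P ξ)) :
    ∃ r : ℝ, 0 < r ∧ lam = r := by
  rw [hc.mem_sp_opLxi_iff] at h
  obtain ⟨e, he, he0⟩ := Submodule.exists_mem_ne_zero_of_ne_bot h
  exact (BForm.exists_pos_of_mem_pencilEigenspace (hc.coercive ξ) he0 he).2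

theorem exists_real_of_mem_sp {lam : ℂ} (h : lam ∈ Sp (A.bivariateOp P)) :
    ∃ r : ℝ, 1 ≤ r ∧ lam = r := by
  have hcl : IsClosed {z : ℂ | z.im = 0 ∧ 1 ≤ z.re} :=
    (isClosed_eq Complex.continuous_im continuous_const).inter
      (isClosed_le continuous_const Complex.continuous_re)
  rw [hc.sp_bivariateOp] at h
  have h1 := closure_minimal (fun z hz => ?_) hcl h
  · exact ⟨lam.re, h1.2, Complex.ext rfl h1.1⟩
  · obtain ⟨ξ, hξ⟩ := mem_iUnion.1 hz
    obtain ⟨r, hr, rfl⟩ := hc.exists_real_of_mem_sp_opLxi hξ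
    have := hc.one_le_norm_of_mem_sp hξ
    rw [Complex.norm_real, Real.norm_of_nonneg hr.le] at this
    exact ⟨Complex.ofReal_im r, this⟩

/-- The fibre forms depend continuously on `ξ`, uniformly in the unit ball. -/
theorem eventually_re_le (ξ : 𝕍) {η : ℝ} (hη : 0 < η) : ∀ᶠ ξ' in 𝓝 ξ, ∀ u,
    (A.fibreForm P ξ' u u).re ≤ (1 + η) * (A.fibreForm P ξ u u).re ∧
    (A.fibreForm P ξ u u).re ≤ (1 + η) * (A.fibreForm P ξ' u u).re := by
  have h1 := (continuous_repr_fibreForm (A := A) (P := P)).continuousAt (x := ξ)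
  filter_upwards [Metric.tendsto_nhds.1 h1 η hη] with ξ' hξ' u
  rw [dist_eq_norm] at hξ'
  have h2 : |(A.fibreForm P ξ' u u).re - (A.fibreForm P ξ u u).re| ≤ η * ‖u‖ ^ 2 := by
    rw [← Complex.sub_re, ← BForm.inner_repr, ← BForm.inner_repr, ← inner_sub_right]
    refine (Complex.abs_re_le_norm _).trans ((norm_inner_le_norm _ _).trans ?_)
    have h3 := ((A.fibreForm P ξ').repr - (A.fibreForm P ξ).repr).le_of_opNorm_le hξ'.le u
    calc _ ≤ ‖u‖ * (η * ‖u‖) := by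
          gcongr
          exact h3
      _ = _ := by ring
  have h3 := abs_le.1 h2
  have h4 := hc.norm_sq_le ξ u
  have h5 := hc.norm_sq_le ξ' u
  constructor <;> nlinarith

/-- Fibre forms at nearby `ξ` differ at most by the factor `s / r`, so the count at `r` for one is
at most the count at `s` for the other, and in a gap these levels have equal counts. The count is
thus locally constant on a connected space, and its value is read off at `ξ = 0`. -/
theorem fibreCount_const_of_gap {r s : ℝ} (hr : 0 < r) (hrs : r < s)
    (h : ∀ (ξ : 𝕍), ∀ t ∈ Ioc r s, (t : ℂ) ∉ Sp (A.opLxi P ξ)) (ξ : 𝕍) :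
    A.fibreCount P ξ r = S.count (S.V S.o) r := by
  have hloc : IsLocallyConstant fun ξ : 𝕍 => A.fibreCount P ξ r := by
    rw [IsLocallyConstant.iff_eventually_eq]
    intro ξ
    have hη : 0 < s / r - 1 := by
      rw [sub_pos, one_lt_div hr]
      exact hrs
    have hηr : (1 + (s / r - 1)) * r = s := by field_simp; ring
    filter_upwards [hc.eventually_re_le ξ hη] with ξ' hξ'
    have key : ∀ ξ₁ ξ₂ : 𝕍, (∀ u, (A.fibreForm P ξ₂ u u).re ≤
        (1 + (s / r - 1)) * (A.fibreForm P ξ₁ u u).re) →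
        A.fibreCount P ξ₁ r ≤ A.fibreCount P ξ₂ r := by
      intro ξ₁ ξ₂ h12
      rw [← hc.fibreCount_eq_of_gap hrs.le (h ξ₂), hc.le_fibreCount_iff]
      obtain ⟨F, hF, hm, hFu⟩ := (hc.le_fibreCount_iff ξ₁ r _).1 le_rfl
      refine ⟨F, hF, hm, fun u hu => (h12 u).trans ?_⟩
      calc _ ≤ (1 + (s / r - 1)) * (r * ‖S.J u‖ ^ 2) :=
            mul_le_mul_of_nonneg_left (hFu u hu) (by linarith)
        _ = _ := by rw [← mul_assoc, hηr]
    exact le_antisymm (key _ _ fun u => (hξ' u).2) (key _ _ fun u => (hξ' u).1)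
  rw [← hc.fibreCount_zero]
  exact hloc.apply_eq_of_preconnectedSpace ξ 0

/-- For large `ξ` the low fibre eigenvalues are controlled by those on `V_⋆`. -/
theorem exists_fibreCount_le_count {r s : ℝ} (hr : 0 < r) (hrs : r < s) : ∃ R : ℝ,
    ∀ ξ : 𝕍, R ≤ ‖ξ‖ → A.fibreCount P ξ r ≤ S.count P.Vs s := by
  have hpos := hc.pos
  have hr' := Real.sqrt_pos.2 hr
  have hs' := Real.sqrt_pos.2 (hr.trans hrs)
  -- `η` small
  obtain ⟨η, hη, hη1, hηs⟩ : ∃ η : ℝ, 0 < η ∧ η < 1 ∧ (1 + η) * √r ≤ √s * (1 - η * √r) := by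
    have hcont : ContinuousAt (fun η : ℝ => √s * (1 - η * √r) - (1 + η) * √r) 0 := by fun_prop
    have h0 : 0 < √s * (1 - 0 * √r) - (1 + 0) * √r := by
      have := Real.sqrt_lt_sqrt hr.le hrs
      linarith
    have h1 := hcont.eventually (lt_mem_nhds h0)
    obtain ⟨d, hd, hball⟩ := Metric.eventually_nhds_iff.1 h1
    refine ⟨min (d / 2) (1 / 2), by positivity, (min_le_right _ _).trans_lt (by norm_num), ?_⟩
    have h2 := hball (y := min (d / 2) (1 / 2)) (by
      rw [Real.dist_0_eq_abs, abs_of_pos (by positivity)]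
      exact (min_le_left _ _).trans_lt (by linarith))
    linarith
  -- Beyond this radius `c |ξ|² η² ≥ r`, which forces `‖P.projZ u‖ ≤ η ‖u‖` on the spectral
  -- subspace. As `η < 1`, projecting it to `V_⋆` loses no dimension, and the quotient rises at most
  -- from `r` to `s`.
  refine ⟨√(r / c) / η, fun ξ hξ => ?_⟩
  obtain ⟨F, hF, hm, hFu⟩ := (hc.le_fibreCount_iff ξ r _).1 le_rfl
  have hξ0 : 0 < ‖ξ‖ := lt_of_lt_of_le (by positivity) hξ
  have hz : ∀ u ∈ F, ‖P.projZ u‖ ≤ η * ‖u‖ := by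
    intro u hu
    have h1 := (hc.lower ξ u).trans (hFu u hu)
    have h2 : ‖S.J u‖ ^ 2 ≤ ‖u‖ ^ 2 := pow_le_pow_left₀ (norm_nonneg _) (S.norm_J_le u) 2
    have h3 : c * ‖ξ‖ ^ 2 * ‖P.projZ u‖ ^ 2 ≤ r * ‖u‖ ^ 2 := by nlinarith [sq_nonneg ‖u‖]
    have h4 : r ≤ c * ‖ξ‖ ^ 2 * η ^ 2 := by
      have h5 : √(r / c) ≤ ‖ξ‖ * η := (div_le_iff₀ hη).1 hξ
      have h6 : r / c ≤ (‖ξ‖ * η) ^ 2 := (Real.sqrt_le_left (by positivity)).1 h5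
      rw [div_le_iff₀ hpos] at h6
      linarith
    have h5 : c * ‖ξ‖ ^ 2 * ‖P.projZ u‖ ^ 2 ≤ c * ‖ξ‖ ^ 2 * (η * ‖u‖) ^ 2 := by
      calc _ ≤ r * ‖u‖ ^ 2 := h3
        _ ≤ (c * ‖ξ‖ ^ 2 * η ^ 2) * ‖u‖ ^ 2 := by gcongr
        _ = _ := by ring
    exact (abs_le_of_sq_le_sq' (le_of_mul_le_mul_left h5 (by positivity)) (by positivity)).2
  have hdecomp : ∀ u : S.V S.o, (u : H) = (P.projVs u : H) + (P.projZ u : H) := fun u =>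
    (P.coe_proj_add u).symm
  have hinj : Function.Injective (P.projVs.toLinearMap.domRestrict F) := by
    rw [← LinearMap.ker_eq_bot, LinearMap.ker_eq_bot']
    rintro ⟨u, hu⟩ h0
    have h1 : P.projVs u = 0 := h0
    have h2 : ‖u‖ = ‖P.projZ u‖ := by
      change ‖(u : H)‖ = ‖(P.projZ u : H)‖
      conv_lhs => rw [hdecomp u, h1]
      simp
    have h3 := hz u hu
    rw [← h2] at h3
    have h4 : ‖u‖ = 0 := by
      have := norm_nonneg u
      nlinarith
    exact Subtype.ext (norm_eq_zero.1 h4)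
  rw [S.le_count_iff P.Vs_le]
  refine ⟨LinearMap.range (P.projVs.toLinearMap.domRestrict F), inferInstance, ?_, ?_⟩
  · rwa [LinearMap.finrank_range_of_inj hinj]
  · rintro _ ⟨⟨u, hu⟩, rfl⟩
    change ‖P.projVs u‖ ^ 2 ≤ s * ‖S.J (P.projVs u)‖ ^ 2
    have h1 : ‖P.projVs u‖ ≤ (1 + η) * ‖u‖ := by
      have : (P.projVs u : H) = u - (P.projZ u : H) := by rw [hdecomp u]; abel
      calc ‖P.projVs u‖ = ‖(u : H) - (P.projZ u : H)‖ := by rw [← this]; rfl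
        _ ≤ ‖u‖ + ‖P.projZ u‖ := norm_sub_le _ _
        _ ≤ _ := by linarith [hz u hu]
    have h2 : ‖S.J u‖ - η * ‖u‖ ≤ ‖S.J (P.projVs u)‖ := by
      have h3 : S.J u = S.J (P.projVs u) + S.J (P.projZ u) := by rw [← map_add, ← hdecomp]
      have h4 : ‖S.J u‖ ≤ ‖S.J (P.projVs u)‖ + ‖S.J (P.projZ u)‖ := by
        rw [h3]
        exact norm_add_le _ _
      have h5 := (S.norm_J_le (P.projZ u)).trans (hz u hu)
      linarith
    have h3 : ‖u‖ ≤ √r * ‖S.J u‖ := by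
      have h4 : ‖u‖ ^ 2 ≤ (√r * ‖S.J u‖) ^ 2 := by
        rw [mul_pow, Real.sq_sqrt hr.le]
        exact (hc.norm_sq_le ξ u).trans (hFu u hu)
      exact (abs_le_of_sq_le_sq' h4 (by positivity)).2
    have h4 : ‖P.projVs u‖ ≤ √s * ‖S.J (P.projVs u)‖ := by
      have h5 : √r * ‖P.projVs u‖ ≤ √r * (√s * ‖S.J (P.projVs u)‖) := by
        calc √r * ‖P.projVs u‖ ≤ √r * ((1 + η) * ‖u‖) := by gcongr
          _ = ((1 + η) * √r) * ‖u‖ := by ring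
          _ ≤ (√s * (1 - η * √r)) * ‖u‖ := by gcongr
          _ = √s * (‖u‖ - √r * (η * ‖u‖)) := by ring
          _ ≤ √s * (√r * ‖S.J u‖ - √r * (η * ‖u‖)) := by gcongr
          _ = √r * (√s * (‖S.J u‖ - η * ‖u‖)) := by ring
          _ ≤ √r * (√s * ‖S.J (P.projVs u)‖) := by gcongr
      exact le_of_mul_le_mul_left h5 hr'
    calc ‖P.projVs u‖ ^ 2 ≤ (√s * ‖S.J (P.projVs u)‖) ^ 2 := by gcongr
      _ = _ := by rw [mul_pow, Real.sq_sqrt (hr.trans hrs).le]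

/-- A real number belongs to the spectrum of the bivariate operator iff it is separated by the
counting functions of `𝐁_⋆` and `𝐁_0`. -/
theorem mem_sp_iff (hn : 1 ≤ n) (lam : ℝ) : (lam : ℂ) ∈ Sp (A.bivariateOp P) ↔
    ∃ m, m ≤ S.count (S.V S.o) lam ∧ ∀ r < lam, ¬ m ≤ S.count P.Vs r := by
  rw [hc.sp_bivariateOp]
  constructor
  · intro hmem
    by_contra! hcon
    obtain ⟨r, hr, hle⟩ := hcon _ le_rfl
    -- The `V_0`-count at `s > lam` is now at most the `V_⋆`-count at `r < lam`. Since every fibre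
    -- count lies between the two, it is constant on `[r, s]`, and no fibre has an eigenvalue in
    -- `(r, s)`.
    obtain ⟨s, hs, hseq⟩ := S.exists_count_eq_right (le_refl (S.V S.o)) lam
    have hgap : ∀ (ξ : 𝕍) (t : ℝ), r < t → t < s → (t : ℂ) ∉ Sp (A.opLxi P ξ) := by
      intro ξ t hrt hts hmem
      rw [hc.mem_sp_opLxi_iff] at hmem
      have hlt : A.fibreCount P ξ r < A.fibreCount P ξ s :=
        BForm.specCount_lt (hc.coercive ξ) (S.emb_isCompactOperator _) hrt hts.le hmem
      have h1 := hc.fibreCount_le ξ s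
      have h2 := hc.count_le_fibreCount ξ r
      omega
    rw [Metric.mem_closure_iff] at hmem
    obtain ⟨z, hz, hd⟩ := hmem (min (lam - r) (s - lam)) (lt_min (by linarith) (by linarith))
    obtain ⟨ξ, hξ⟩ := mem_iUnion.1 hz
    obtain ⟨t, -, rfl⟩ := hc.exists_real_of_mem_sp_opLxi hξ
    rw [Complex.dist_eq, ← Complex.ofReal_sub, Complex.norm_real, Real.norm_eq_abs] at hd
    obtain ⟨h1, h2⟩ := abs_lt.1 hd
    have h3 := min_le_left (lam - r) (s - lam)
    have h4 := min_le_right (lam - r) (s - lam)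
    exact hgap ξ t (by linarith) (by linarith) hξ
  · rintro ⟨m, hm, hlow⟩
    by_contra hmem
    rw [Metric.mem_closure_iff] at hmem
    push Not at hmem
    obtain ⟨δ, hδ, hdist⟩ := hmem
    have hgap : ∀ (ξ : 𝕍) (t : ℝ), |lam - t| < δ → (t : ℂ) ∉ Sp (A.opLxi P ξ) := by
      intro ξ t ht hmem
      have := hdist t (mem_iUnion.2 ⟨ξ, hmem⟩)
      rw [Complex.dist_eq, ← Complex.ofReal_sub, Complex.norm_real, Real.norm_eq_abs] at this
      linarith
    rcases le_or_gt lam 0 with h0 | h0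
    -- At a nonpositive level nothing is counted, so `m = 0`, contradicting the second condition.
    · obtain ⟨F, hF, hmF, hFu⟩ := (S.le_count_iff (le_refl (S.V S.o)) lam m).1 hm
      have hbot : F = ⊥ := by
        rw [Submodule.eq_bot_iff]
        intro u hu
        have h1 := hFu u hu
        have h2 : lam * ‖S.J u‖ ^ 2 ≤ 0 := mul_nonpos_of_nonpos_of_nonneg h0 (sq_nonneg _)
        have h3 : ‖u‖ = 0 := by
          have := norm_nonneg u
          nlinarith
        exact norm_eq_zero.1 h3
      rw [hbot, finrank_bot] at hmF
      exact hlow (lam - 1) (by linarith) (by omega)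
    -- The levels `lam - 2d`, `lam - d`, `lam` are positive and lie in the gap. The `V_0`-count at
    -- `lam` equals the fibre count at `lam - 2d` for every `ξ`, and a large `ξ`, which exists
    -- because `n ≥ 1`, bounds that by the `V_⋆`-count at `lam - d`.
    · set d := min δ lam / 4 with hd
      have hd0 : 0 < d := by positivity
      have hd1 : 4 * d ≤ δ := by rw [hd]; linarith [min_le_left δ lam]
      have hd2 : 4 * d ≤ lam := by rw [hd]; linarith [min_le_right δ lam]
      obtain ⟨R, hR⟩ := hc.exists_fibreCount_le_count (r := lam - 2 * d) (s := lam - d)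
        (by linarith) (by linarith)
      have : Nontrivial 𝕍 := by
        have : NeZero n := ⟨by omega⟩
        exact inferInstance
      obtain ⟨ξ, hξ⟩ := NormedSpace.exists_lt_norm ℝ 𝕍 R
      have hgap' : ∀ (ξ : 𝕍), ∀ t ∈ Ioc (lam - 2 * d) lam, (t : ℂ) ∉ Sp (A.opLxi P ξ) := by
        intro ξ t ht
        refine hgap ξ t ?_
        rw [abs_lt]
        constructor <;> linarith [ht.1, ht.2]
      have e1 := hc.fibreCount_const_of_gap (by linarith) (by linarith) hgap' ξ
      have e2 := hc.fibreCount_eq_of_gap (ξ := 0) (by linarith) (hgap' 0)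
      rw [hc.fibreCount_zero, hc.fibreCount_zero] at e2
      have e3 := hR ξ hξ.le
      exact hlow (lam - d) (by linarith) (by omega)

end FibreBound

end Expansion

end Setting

theorem exists_finiteDimensional_of_le_rank {E : Type*} [AddCommGroup E] [Module ℂ E] {m : ℕ}
    (h : (m : Cardinal) ≤ Module.rank ℂ E) :
    ∃ F : Submodule ℂ E, FiniteDimensional ℂ F ∧ m ≤ Module.finrank ℂ F := by
  obtain ⟨s, hs, hli⟩ := le_rank_iff_exists_linearIndependent_finset.1 h
  refine ⟨Submodule.span ℂ (s : Set E), FiniteDimensional.span_finset ℂ s, ?_⟩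
  have h1 := finrank_span_finset_eq_card hli
  exact (h1.trans hs).ge

/-! ### The band formula -/

namespace Setting

variable {n : ℕ} {H X : Type*} [NormedAddCommGroup H] [InnerProductSpace ℂ H] [CompleteSpace H]
  [NormedAddCommGroup X] [InnerProductSpace ℂ X] [CompleteSpace X] {S : Setting n H X}

local notation "𝕍" => EuclideanSpace ℝ (Fin n)

theorem Splitting.inclVs_injective (P : S.Splitting) : Function.Injective P.inclVs := fun v w h => by
  rw [← P.projVs_inclVs v, h, P.projVs_inclVs]

/-- Extension of a subspace of `V_⋆` by a vector of `V_0` outside `V_⋆`. -/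
theorem Splitting.exists_extend (P : S.Splitting) (F : Submodule ℂ P.Vs) [FiniteDimensional ℂ F]
    {y : S.V S.o} (hy : P.projZ y ≠ 0) : ∃ F' : Submodule ℂ (S.V S.o), FiniteDimensional ℂ F' ∧
      Module.finrank ℂ F' = Module.finrank ℂ F + 1 ∧
      ∀ u ∈ F', ∃ v ∈ F, ∃ c : ℂ, u = P.inclVs v + c • y := by
  let f : (F × ℂ) →ₗ[ℂ] S.V S.o :=
    (P.inclVs.toLinearMap ∘ₗ F.subtype).coprod (LinearMap.toSpanSingleton ℂ _ y)
  have hf : ∀ p : F × ℂ, f p = P.inclVs p.1 + p.2 • y := fun p => rfl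
  have hinj : Function.Injective f := by
    rw [← LinearMap.ker_eq_bot, LinearMap.ker_eq_bot']
    rintro ⟨v, c⟩ h0
    rw [hf] at h0
    have h1 := congrArg P.projZ h0
    rw [map_add, P.projZ_inclVs, map_smul, map_zero, zero_add, smul_eq_zero] at h1
    have hc0 : c = 0 := h1.resolve_right hy
    subst hc0
    rw [zero_smul, add_zero] at h0
    have h2 := P.inclVs_injective (h0.trans (map_zero P.inclVs).symm)
    exact Prod.ext (Subtype.ext h2) rfl
  refine ⟨LinearMap.range f, inferInstance, ?_, ?_⟩
  · rw [LinearMap.finrank_range_of_inj hinj, Module.finrank_prod, Module.finrank_self]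
  · rintro _ ⟨⟨v, c⟩, rfl⟩
    exact ⟨v, v.2, c, hf _⟩

namespace Expansion

variable {A : S.Expansion} {P : S.Splitting} {c : ℝ} (hc : A.FibreBound P c)
include hc
namespace FibreBound

theorem nthEigenvalue_V_le_iff {m : ℕ} (hm : 1 ≤ m) (hrank : (m : Cardinal) ≤ Module.rank ℂ P.Vs)
    (r : ℝ) : nthEigenvalue (S.opB (S.V S.o)) m ≤ r ↔ m ≤ S.count (S.V S.o) r := by
  obtain ⟨F, hF, hmF⟩ := exists_finiteDimensional_of_le_rank hrank
  refine S.nthEigenvalue_opB_le_iff le_rfl hm (F := F.map P.inclVs.toLinearMap) inferInstance ?_ r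
  rwa [← (F.equivMapOfInjective P.inclVs.toLinearMap P.inclVs_injective).finrank_eq]

theorem nthEigenvalue_Vs_le_iff {m : ℕ} (hm : 1 ≤ m)
    (hrank : (m : Cardinal) ≤ Module.rank ℂ P.Vs) (r : ℝ) :
    nthEigenvalue (S.opB P.Vs) m ≤ r ↔ m ≤ S.count P.Vs r := by
  obtain ⟨F, hF, hmF⟩ := exists_finiteDimensional_of_le_rank hrank
  exact S.nthEigenvalue_opB_le_iff P.Vs_le hm hF hmF r

theorem nthEigenvalue_le {m : ℕ} (hm : 1 ≤ m) (hrank : (m : Cardinal) ≤ Module.rank ℂ P.Vs) :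
    nthEigenvalue (S.opB (S.V S.o)) m ≤ nthEigenvalue (S.opB P.Vs) m := by
  rw [hc.nthEigenvalue_V_le_iff hm hrank]
  exact ((hc.nthEigenvalue_Vs_le_iff hm hrank _).1 le_rfl).trans (hc.count_le_count _)

/-- The eigenvalue on `V_⋆` is at least `lam` iff every smaller level counts fewer than `m`. This
matches the separation criterion for the bivariate spectrum band by band. -/
theorem mem_Icc_nthEigenvalue_iff {m : ℕ} (hm : 1 ≤ m)
    (hrank : (m : Cardinal) ≤ Module.rank ℂ P.Vs) (lam : ℝ) :
    lam ∈ Icc (nthEigenvalue (S.opB (S.V S.o)) m) (nthEigenvalue (S.opB P.Vs) m) ↔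
      m ≤ S.count (S.V S.o) lam ∧ ∀ r < lam, ¬ m ≤ S.count P.Vs r := by
  rw [mem_Icc, hc.nthEigenvalue_V_le_iff hm hrank]
  refine and_congr_right fun _ => ?_
  simp only [← hc.nthEigenvalue_Vs_le_iff hm hrank, not_le]
  exact ⟨fun h r hr => hr.trans_le h, fun h => le_of_forall_lt h⟩

theorem sp_eq_of_forall (hn : 1 ≤ n) {B : Set ℝ} (hB : ∀ lam : ℝ, lam ∈ B ↔
    ∃ m, m ≤ S.count (S.V S.o) lam ∧ ∀ r < lam, ¬ m ≤ S.count P.Vs r) :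
    Sp (A.bivariateOp P) = Complex.ofReal '' B := by
  ext z
  constructor
  · intro hz
    obtain ⟨r, -, rfl⟩ := hc.exists_real_of_mem_sp hz
    exact ⟨r, (hB r).2 ((hc.mem_sp_iff hn r).1 hz), rfl⟩
  · rintro ⟨r, hr, rfl⟩
    exact (hc.mem_sp_iff hn r).2 ((hB r).1 hr)

theorem one_le_of_separated {lam : ℝ} {m : ℕ} (h : ∀ r < lam, ¬ m ≤ S.count P.Vs r) : 1 ≤ m := by
  have := h (lam - 1) (by linarith)
  omega

theorem sp_eq_of_infinite (hn : 1 ≤ n) (hinf : ¬ FiniteDimensional ℂ P.Vs) :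
    Sp (A.bivariateOp P) = Complex.ofReal '' ⋃ k ∈ Set.Ici 1,
      Set.Icc (nthEigenvalue (S.opB (S.V S.o)) k) (nthEigenvalue (S.opB P.Vs) k) := by
  have hrank : ∀ m : ℕ, (m : Cardinal) ≤ Module.rank ℂ P.Vs := fun m =>
    (Cardinal.natCast_lt_aleph0).le.trans (not_lt.1 fun h => hinf (Module.rank_lt_aleph0_iff.1 h))
  refine hc.sp_eq_of_forall hn fun lam => ?_
  simp only [mem_iUnion, mem_Ici, exists_prop]
  refine exists_congr fun m => ⟨fun ⟨hm, h⟩ => ?_, fun h => ?_⟩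
  · exact (hc.mem_Icc_nthEigenvalue_iff hm (hrank m) lam).1 h
  · have hm := hc.one_le_of_separated h.2
    exact ⟨hm, (hc.mem_Icc_nthEigenvalue_iff hm (hrank m) lam).2 h⟩

/-- For `m > N` the `V_⋆`-count never reaches `m`, so the band has no upper end, and all such bands
lie in that of `N + 1`. A nonzero vector of `Z` supplies the dimension that makes the eigenvalue `N
+ 1` genuine. -/
theorem sp_eq_of_finite (hn : 1 ≤ n) (hfin : FiniteDimensional ℂ P.Vs) (hZ : P.Z ≠ ⊥) :
    Sp (A.bivariateOp P) = Complex.ofReal ''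
        ((⋃ k ∈ Set.Icc 1 (Module.finrank ℂ P.Vs),
            Set.Icc (nthEigenvalue (S.opB (S.V S.o)) k) (nthEigenvalue (S.opB P.Vs) k)) ∪
          Set.Ici (nthEigenvalue (S.opB (S.V S.o)) (Module.finrank ℂ P.Vs + 1))) := by
  set N := Module.finrank ℂ P.Vs with hN
  have hrank : ∀ m : ℕ, m ≤ N → (m : Cardinal) ≤ Module.rank ℂ P.Vs := fun m hm => by
    rw [← Module.finrank_eq_rank]
    exact_mod_cast hm
  have hcount : ∀ r, S.count P.Vs r ≤ N := fun r => Submodule.finrank_le _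
  obtain ⟨z, hz, hz0⟩ := Submodule.exists_mem_ne_zero_of_ne_bot hZ
  have hy : P.projZ (P.inclZ ⟨z, hz⟩) ≠ 0 := by
    rw [P.projZ_inclZ]
    exact fun h => hz0 (congrArg Subtype.val h)
  obtain ⟨F, hF, hFN, -⟩ := P.exists_extend ⊤ hy
  rw [finrank_top] at hFN
  have hlast := S.nthEigenvalue_opB_le_iff (le_refl (S.V S.o)) (m := N + 1) (by omega) hF hFN.ge
  refine hc.sp_eq_of_forall hn fun lam => ?_
  simp only [mem_union, mem_iUnion, exists_prop]
  constructor
  · rintro (⟨m, hm, h⟩ | h)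
    · exact ⟨m, (hc.mem_Icc_nthEigenvalue_iff hm.1 (hrank m hm.2) lam).1 h⟩
    · refine ⟨N + 1, (hlast lam).1 h, fun r _ hr => ?_⟩
      have := hcount r
      omega
  · rintro ⟨m, h1, h2⟩
    have hm := hc.one_le_of_separated h2
    rcases le_or_gt m N with hmN | hmN
    · exact Or.inl ⟨m, ⟨hm, hmN⟩, (hc.mem_Icc_nthEigenvalue_iff hm (hrank m hmN) lam).2 ⟨h1, h2⟩⟩
    · exact Or.inr ((hlast lam).2 (by omega))

end FibreBound

end Expansion

end Setting

/-- Solvability of the equation of a form off the spectrum. -/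
theorem BForm.exists_sol_of_notMem_sp {E Y : Type*} [NormedAddCommGroup E] [InnerProductSpace ℂ E]
    [CompleteSpace E] [NormedAddCommGroup Y] [InnerProductSpace ℂ Y] [CompleteSpace Y]
    {q : BForm E} (hq : q.IsCoerciveHermitian) {j : E →L[ℂ] Y} (hd : DenseRange j) {lam : ℂ}
    (h : lam ∉ Sp (formOperator (innerForm Y) j.toLinearMap q.toSForm)) (g : Y) :
    ∃ v, ∀ w, q v w - lam * inner ℂ (j w) (j v) = inner ℂ (j w) g := by
  rw [formOperator, sp_toLinearPMap_eq (mem_formGraph_iff hq j) (inv_injective hq j hd)] at h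
  -- The shifted equation is a fixed point problem in `Y` for the bounded inverse; the form solution
  -- with datum `g + lam • y` then has image `y`.
  obtain ⟨y, hy⟩ : ∃ y, y = q.inv j (g + lam • y) := by
    by_cases h0 : lam = 0
    · exact ⟨q.inv j g, by simp [h0]⟩
    · have h1 : lam⁻¹ ∉ spectrum ℂ (q.inv j) := fun h' => h ⟨h0, h'⟩
      rw [spectrum.notMem_iff] at h1
      obtain ⟨y, hy⟩ := (ContinuousLinearMap.isUnit_iff_bijective.1 h1).2 (lam⁻¹ • q.inv j g)
      refine ⟨y, ?_⟩
      have h2 : lam⁻¹ • y - q.inv j y = lam⁻¹ • q.inv j g := hy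
      have h3 := congrArg (fun x => lam • x) h2
      simp only [smul_sub, smul_smul, mul_inv_cancel₀ h0, one_smul] at h3
      rw [map_add, map_smul, ← h3]
      abel
  refine ⟨q.sol j (g + lam • y), fun w => ?_⟩
  have h1 : j (q.sol j (g + lam • y)) = y := hy.symm
  rw [sol_spec hq, h1, inner_add_right, inner_smul_right]
  ring

/-! ### The form `β` as a Schur complement -/

namespace Setting

variable {n : ℕ} {H X : Type*} [NormedAddCommGroup H] [InnerProductSpace ℂ H] [CompleteSpace H]
  [NormedAddCommGroup X] [InnerProductSpace ℂ X] [CompleteSpace X] {S : Setting n H X}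

local notation "𝕍" => EuclideanSpace ℝ (Fin n)

/-- The form `b_0 - lam d_0`. -/
def shifted (S : Setting n H X) (lam : ℝ) (u w : H) : ℂ :=
  S.b S.o u w - (lam : ℂ) * S.d S.o (S.J u) (S.J w)

theorem shifted_add_left (lam : ℝ) (u u' w : H) :
    S.shifted lam (u + u') w = S.shifted lam u w + S.shifted lam u' w := by
  simp only [shifted, map_add, add_apply]
  ring

theorem shifted_add_right (lam : ℝ) (u w w' : H) :
    S.shifted lam u (w + w') = S.shifted lam u w + S.shifted lam u w' := by
  simp only [shifted, map_add]
  ring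

theorem shifted_smul_smul (lam : ℝ) (c : ℂ) (u : H) :
    S.shifted lam (c • u) (c • u) = ((‖c‖ ^ 2 : ℝ) : ℂ) * S.shifted lam u u := by
  have h : (c * starRingEnd ℂ c : ℂ) = ((‖c‖ ^ 2 : ℝ) : ℂ) := by
    rw [RCLike.mul_conj]
    simp
  rw [← h]
  simp only [shifted, map_smulₛₗ, smul_apply, smul_eq_mul, RingHom.id_apply]
  ring

theorem shifted_herm (lam : ℝ) (u w : H) :
    S.shifted lam u w = starRingEnd ℂ (S.shifted lam w u) := by
  simp only [shifted, map_sub, map_mul, Complex.conj_ofReal, ← (S.isNonneg_b S.o).herm,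
    ← (S.isNonneg_d S.o).herm]

theorem shifted_self (lam : ℝ) {u : H} (hu : u ∈ S.V S.o) :
    S.shifted lam u u = ((‖u‖ ^ 2 - lam * ‖S.J u‖ ^ 2 : ℝ) : ℂ) := by
  rw [shifted, S.b_self_of_mem hu, S.d_zero, inner_self_eq_norm_sq_to_K]
  push_cast
  rfl

namespace Splitting

variable {P : S.Splitting} {lam : ℝ}

section

variable (hlam : (lam : ℂ) ∉ Sp (S.opB P.Vs))
include hlam

/-- The right-hand side sees `z` only through the orthogonal projection of `J z` to the closure of
`V_⋆`, so solvability off the spectrum of `𝐁_⋆` applies. -/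
theorem vLam_spec (z : P.Z) : P.vLam lam z ∈ P.Vs ∧ ∀ w ∈ P.Vs,
    S.b S.o (P.vLam lam z) w - (lam : ℂ) * S.d S.o (S.J (P.vLam lam z)) (S.J w) =
      ((lam : ℂ) - 1) * S.d S.o (S.J z) (S.J w) := by
  have hex : ∃ v ∈ P.Vs, ∀ w ∈ P.Vs, S.b S.o v w - (lam : ℂ) * S.d S.o (S.J v) (S.J w) =
      ((lam : ℂ) - 1) * S.d S.o (S.J z) (S.J w) := by
    obtain ⟨v, hv⟩ := BForm.exists_sol_of_notMem_sp (S.b0_coercive P.Vs_le)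
      (S.emb_denseRange P.Vs) hlam
      (((lam : ℂ) - 1) • ContinuousLinearMap.adjoint (S.clos P.Vs).subtypeL (S.J z))
    refine ⟨v, v.2, fun w hw => ?_⟩
    have h1 := hv ⟨w, hw⟩
    rw [inner_smul_right, ContinuousLinearMap.adjoint_inner_right] at h1
    rw [S.d_zero, S.d_zero]
    exact h1
  rw [vLam, dif_pos hex]
  exact hex.choose_spec

theorem eq_zero_of_shifted_eq_zero {v : H} (hv : v ∈ P.Vs)
    (h : ∀ w ∈ P.Vs, S.shifted lam v w = 0) : v = 0 := by
  have h1 : pencilEigenspace (S.b0 P.Vs) (pullInner (S.emb P.Vs)) (lam : ℂ) = ⊥ := by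
    by_contra h0
    exact hlam ((BForm.mem_sp_iff (S.b0_coercive P.Vs_le) (S.emb_isCompactOperator _)
      (S.emb_denseRange _)).2 h0)
  have h2 : (⟨v, hv⟩ : P.Vs) ∈
      pencilEigenspace (S.b0 P.Vs) (pullInner (S.emb P.Vs)) (lam : ℂ) := by
    intro w
    have h3 := h w w.2
    rw [shifted, S.d_zero, sub_eq_zero] at h3
    exact h3
  rw [h1, Submodule.mem_bot] at h2
  exact congrArg Subtype.val h2

theorem eq_vLam_of_forall {z : P.Z} {v : H} (hv : v ∈ P.Vs)
    (h : ∀ w ∈ P.Vs, S.shifted lam v w = ((lam : ℂ) - 1) * S.d S.o (S.J z) (S.J w)) :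
    v = P.vLam lam z := by
  rw [← sub_eq_zero]
  refine eq_zero_of_shifted_eq_zero hlam (P.Vs.sub_mem hv (vLam_spec hlam z).1) fun w hw => ?_
  have h1 := (vLam_spec hlam z).2 w hw
  have h2 := h w hw
  simp only [shifted, map_sub, sub_apply] at h1 h2 ⊢
  linear_combination h2 - h1

variable (hN : P.Normalised)
include hN

/-- The normalisation turns `b_0(z, w) - lam d_0(z, w)` into `(1 - lam) d_0(z, w)`, exactly what
`v_lam(z)` was built to cancel. Hence `v_lam(z) + z` is orthogonal to `V_⋆` for the shifted form. -/
theorem shifted_vLam_left (z : P.Z) {w : H} (hw : w ∈ P.Vs) :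
    S.shifted lam (P.vLam lam z + z) w = 0 := by
  have h1 := (vLam_spec hlam z).2 w hw
  have h2 := hN z z.2 w hw
  rw [shifted_add_left]
  simp only [shifted]
  rw [h1, h2]
  ring

theorem shifted_vLam_right (z : P.Z) {w : H} (hw : w ∈ P.Vs) :
    S.shifted lam w (P.vLam lam z + z) = 0 := by
  rw [shifted_herm, shifted_vLam_left hlam hN z hw, map_zero]

theorem betaForm_self (z : P.Z) :
    P.betaForm lam z z = -S.shifted lam (P.vLam lam z + z) (P.vLam lam z + z) := by
  have hv := (vLam_spec hlam z).1
  have h2 : S.b S.o (P.vLam lam z) z = S.d S.o (S.J (P.vLam lam z)) (S.J z) := by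
    rw [(S.isNonneg_b S.o).herm, hN z z.2 _ hv, ← (S.isNonneg_d S.o).herm]
  rw [shifted_add_right, shifted_vLam_left hlam hN z hv, zero_add, shifted_add_left]
  simp only [shifted, betaForm]
  rw [h2]
  ring

theorem nonneg_betaForm_iff (z : P.Z) : 0 ≤ P.betaForm lam z z ↔
    ‖P.vLam lam z + z‖ ^ 2 ≤ lam * ‖S.J (P.vLam lam z + z)‖ ^ 2 := by
  have hv := P.Vs_le (vLam_spec hlam z).1
  rw [betaForm_self hlam hN, S.shifted_self lam ((S.V S.o).add_mem hv (P.Z_le z.2)),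
    ← Complex.ofReal_neg, Complex.zero_le_real]
  constructor <;> intro h <;> linarith

/-- The counting functions of `𝐁_⋆` and `𝐁_0` differ at `lam` iff `β_lam` is somewhere
non-negative. -/
theorem count_lt_count_iff : S.count P.Vs lam < S.count (S.V S.o) lam ↔
    ∃ z : P.Z, z ≠ 0 ∧ 0 ≤ P.betaForm lam z z := by
  constructor
  · intro hlt
    by_contra! hcon
    obtain ⟨F, hF, hm, hFu⟩ := (S.le_count_iff (le_refl (S.V S.o)) lam _).1 hlt
    let vL : P.Z →ₗ[ℂ] P.Vs :=
      { toFun := fun z => ⟨P.vLam lam z, (vLam_spec hlam z).1⟩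
        map_add' := fun z z' => Subtype.ext (eq_vLam_of_forall hlam
          (P.Vs.add_mem (vLam_spec hlam z).1 (vLam_spec hlam z').1) fun w hw => by
            have h1 := (vLam_spec hlam z).2 w hw
            have h2 := (vLam_spec hlam z').2 w hw
            rw [shifted_add_left]
            simp only [shifted, Submodule.coe_add, map_add, add_apply] at h1 h2 ⊢
            linear_combination h1 + h2).symm
        map_smul' := fun a z => Subtype.ext (eq_vLam_of_forall hlam
          (P.Vs.smul_mem a (vLam_spec hlam z).1) fun w hw => by
            have h1 := (vLam_spec hlam z).2 w hw
            simp only [shifted, Submodule.coe_smul, map_smul, smul_apply, smul_eq_mul]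
              at h1 ⊢
            linear_combination a * h1).symm }
    -- `f u` is the `V_⋆`-component in the block-diagonalising coordinates `u = f u + (v_lam(z) +
    -- z)`. If `β_lam` is nowhere non-negative off zero, the second block is positive, so `f` is
    -- injective on `F` and its image is too large for the `V_⋆`-count.
    let f : S.V S.o →ₗ[ℂ] P.Vs := P.projVs.toLinearMap - vL ∘ₗ P.projZ.toLinearMap
    have hdecomp : ∀ u : S.V S.o, (u : H) = (f u : H) +
        (P.vLam lam (P.projZ u) + (P.projZ u : H)) := by
      intro u
      conv_lhs => rw [← P.coe_proj_add u]
      change _ = ((P.projVs u : H) - P.vLam lam (P.projZ u)) + _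
      abel
    have hQ : ∀ u ∈ F, ‖f u‖ ^ 2 - lam * ‖S.J (f u)‖ ^ 2 +
        (‖P.vLam lam (P.projZ u) + (P.projZ u : H)‖ ^ 2 -
          lam * ‖S.J (P.vLam lam (P.projZ u) + (P.projZ u : H))‖ ^ 2) ≤ 0 := by
      intro u hu
      have h1 := S.shifted_self lam u.2
      have hvz := (S.V S.o).add_mem (P.Vs_le (vLam_spec hlam (P.projZ u)).1)
        (P.Z_le (P.projZ u).2)
      have h2 : S.shifted lam u u = S.shifted lam (f u) (f u) +
          S.shifted lam (P.vLam lam (P.projZ u) + (P.projZ u : H))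
            (P.vLam lam (P.projZ u) + (P.projZ u : H)) := by
        conv_lhs => rw [hdecomp u]
        rw [shifted_add_left, shifted_add_right lam (f u : H) (f u : H),
          shifted_add_right lam (P.vLam lam (P.projZ u) + (P.projZ u : H)) (f u : H),
          shifted_vLam_left hlam hN _ (f u).2, shifted_vLam_right hlam hN _ (f u).2]
        ring
      rw [h2, S.shifted_self lam (P.Vs_le (f u).2), S.shifted_self lam hvz,
        ← Complex.ofReal_add] at h1
      have h3 := Complex.ofReal_injective h1
      have h4 := hFu u hu
      have h5 : ‖(u : H)‖ = ‖u‖ := rfl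
      have h6 : ‖(f u : H)‖ = ‖f u‖ := rfl
      rw [h5, h6] at h3
      linarith
    have hpos : ∀ z : P.Z, z ≠ 0 → 0 < ‖P.vLam lam z + (z : H)‖ ^ 2 -
        lam * ‖S.J (P.vLam lam z + (z : H))‖ ^ 2 := by
      intro z hz
      by_contra! h
      refine hcon z hz ((nonneg_betaForm_iff hlam hN z).2 (by linarith))
    have hvL0 : P.vLam lam 0 = 0 := congrArg Subtype.val (map_zero vL)
    have hinj : Function.Injective (f.domRestrict F) := by
      rw [← LinearMap.ker_eq_bot, LinearMap.ker_eq_bot']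
      rintro ⟨u, hu⟩ h0
      have h1 : f u = 0 := h0
      have h2 := hQ u hu
      rw [h1] at h2
      have h3 : P.projZ u = 0 := by
        by_contra h
        have := hpos _ h
        simp only [norm_zero, ZeroMemClass.coe_zero, map_zero] at h2
        linarith
      have h4 := hdecomp u
      rw [h1, h3, hvL0] at h4
      exact Subtype.ext (Subtype.ext (by simpa using h4))
    have hle : S.count P.Vs lam + 1 ≤ S.count P.Vs lam := by
      rw [S.le_count_iff P.Vs_le]
      refine ⟨LinearMap.range (f.domRestrict F), inferInstance, ?_, ?_⟩
      · rw [LinearMap.finrank_range_of_inj hinj]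
        exact hm
      · rintro _ ⟨⟨u, hu⟩, rfl⟩
        change ‖f u‖ ^ 2 ≤ lam * ‖S.J (f u)‖ ^ 2
        have h2 := hQ u hu
        by_cases h : P.projZ u = 0
        · rw [h, hvL0] at h2
          simp only [ZeroMemClass.coe_zero, add_zero, norm_zero, map_zero] at h2
          linarith
        · have := hpos _ h
          linarith
    omega
  · rintro ⟨z, hz, hβ⟩
    rw [nonneg_betaForm_iff hlam hN] at hβ
    obtain ⟨F, hF, hm, hFu⟩ := (S.le_count_iff P.Vs_le lam _).1 le_rfl
    set v : P.Vs := ⟨P.vLam lam z, (vLam_spec hlam z).1⟩ with hv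
    set y : S.V S.o := P.inclVs v + P.inclZ z with hy
    have hyH : (y : H) = P.vLam lam z + z := rfl
    -- The vector `y = v_lam(z) + z` is orthogonal to `V_⋆` for the shifted form and has nonpositive
    -- shifted energy, so it enlarges the spectral subspace of `𝐁_⋆` by one dimension.
    obtain ⟨F', hF', hFN, hFu'⟩ := P.exists_extend F (y := y) (by rwa [hy, P.projZ_add])
    refine Nat.lt_of_succ_le ((S.le_count_iff (le_refl (S.V S.o)) lam _).2
      ⟨F', hF', by omega, fun u hu => ?_⟩)
    obtain ⟨v', hv', a, rfl⟩ := hFu' u hu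
    have h1 := S.shifted_self lam (P.inclVs v' + a • y).2
    have h2 : S.shifted lam (P.inclVs v' + a • y : S.V S.o) (P.inclVs v' + a • y : S.V S.o) =
        S.shifted lam v' v' + ((‖a‖ ^ 2 : ℝ) : ℂ) * S.shifted lam y y := by
      have h3 : ((P.inclVs v' + a • y : S.V S.o) : H) = (v' : H) + a • (y : H) := rfl
      have h4 : S.shifted lam v' (a • (y : H)) = 0 := by
        have := shifted_vLam_right hlam hN z v'.2
        rw [← hyH] at this
        simp only [shifted, map_smulₛₗ, smul_eq_mul] at this ⊢
        linear_combination (starRingEnd ℂ a) * this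
      have h5 : S.shifted lam (a • (y : H)) v' = 0 := by
        rw [shifted_herm, h4, map_zero]
      rw [h3, shifted_add_left, shifted_add_right, shifted_add_right, h4, h5, shifted_smul_smul]
      ring
    rw [h2, S.shifted_self lam (P.Vs_le v'.2), S.shifted_self lam y.2, ← Complex.ofReal_mul,
      ← Complex.ofReal_add] at h1
    have h3 := Complex.ofReal_injective h1
    have h4 := hFu v' hv'
    have h5 : ‖(v' : H)‖ = ‖v'‖ := rfl
    rw [h5] at h3
    rw [← hyH] at hβ
    have h6 : ‖a‖ ^ 2 * (‖(y : H)‖ ^ 2 - lam * ‖S.J y‖ ^ 2) ≤ 0 :=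
      mul_nonpos_of_nonneg_of_nonpos (sq_nonneg _) (by linarith)
    have h7 : ‖((P.inclVs v' + a • y : S.V S.o) : H)‖ = ‖P.inclVs v' + a • y‖ := rfl
    rw [h7] at h3
    linarith

end

end Splitting

namespace Expansion

variable {A : S.Expansion} {P : S.Splitting} {c : ℝ}

theorem FibreBound.sp_eq_of_normalised (hc : A.FibreBound P c) (hn : 1 ≤ n) (hN : P.Normalised) :
    Sp (A.bivariateOp P) =
      Complex.ofReal '' {lam : ℝ | (lam : ℂ) ∉ Sp (S.opB P.Vs) ∧
        ∃ z : P.Z, z ≠ 0 ∧ 0 ≤ P.betaForm lam z z} ∪ Sp (S.opB P.Vs) := by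
  have hco := S.b0_coercive P.Vs_le
  have hcp := S.emb_isCompactOperator P.Vs
  have hsp : ∀ z : ℂ, z ∈ Sp (S.opB P.Vs) ↔
      pencilEigenspace (S.b0 P.Vs) (pullInner (S.emb P.Vs)) z ≠ ⊥ := fun z =>
    BForm.mem_sp_iff hco hcp (S.emb_denseRange _)
  -- At an eigenvalue of `𝐁_⋆` its count jumps, so the criterion holds with the `V_⋆`-count at
  -- `lam`.
  have hstar : ∀ lam : ℝ, (lam : ℂ) ∈ Sp (S.opB P.Vs) → (lam : ℂ) ∈ Sp (A.bivariateOp P) := by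
    intro lam h
    rw [hc.mem_sp_iff hn]
    refine ⟨S.count P.Vs lam, hc.count_le_count lam, fun r hr => not_le.2 ?_⟩
    exact BForm.specCount_lt hco hcp hr le_rfl ((hsp lam).1 h)
  have hnot : ∀ lam : ℝ, (lam : ℂ) ∉ Sp (S.opB P.Vs) → ((lam : ℂ) ∈ Sp (A.bivariateOp P) ↔
      S.count P.Vs lam < S.count (S.V S.o) lam) := by
    intro lam h
    rw [hc.mem_sp_iff hn]
    constructor
    · rintro ⟨m, hm, hr⟩
      -- Off the spectrum of `𝐁_⋆` its count is left continuous at `lam`, which reduces separation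
      -- to a strict inequality of counts.
      obtain ⟨s, hs, hle⟩ := BForm.exists_pencilSpan_le_left hco hcp lam
      have h1 : S.count P.Vs lam = S.count P.Vs s := by
        have h2 := pencilSpan_eq_of_forall (S.b0 P.Vs) (pullInner (S.emb P.Vs)) hs.le
          fun t ht => ?_
        · rw [count, specCount, h2]
          rfl
        · by_contra hne
          rcases ht.2.lt_or_eq with h3 | h3
          · have h4 := BForm.specCount_lt hco hcp ht.1 le_rfl hne
            have hfin := BForm.finiteDimensional_pencilSpan hco hcp s
            exact absurd (Submodule.finrank_mono (hle t h3)) (not_le.2 h4)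
          · rw [h3] at hne
            exact h ((hsp lam).2 hne)
      have h2 := hr s hs
      omega
    · intro hlt
      refine ⟨_, le_rfl, fun r hr hle => ?_⟩
      have := S.count_mono P.Vs_le hr.le
      omega
  ext z
  constructor
  · intro hz
    obtain ⟨r, -, rfl⟩ := hc.exists_real_of_mem_sp hz
    by_cases h : (r : ℂ) ∈ Sp (S.opB P.Vs)
    · exact Or.inr h
    · exact Or.inl ⟨r, ⟨h, (Splitting.count_lt_count_iff h hN).1 ((hnot r h).1 hz)⟩, rfl⟩
  · rintro (⟨r, ⟨h, hβ⟩, rfl⟩ | h)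
    · exact (hnot r h).2 ((Splitting.count_lt_count_iff h hN).2 hβ)
    · obtain ⟨e, he, he0⟩ := Submodule.exists_mem_ne_zero_of_ne_bot ((hsp z).1 h)
      obtain ⟨-, r, -, rfl⟩ := BForm.exists_pos_of_mem_pencilEigenspace hco he0 he
      exact hstar r h

end Expansion

end Setting

/-! ### From resolvent estimates to distances of spectra -/

theorem IsSelfAdjoint.exists_mem_spectrum_near {Y : Type*} [NormedAddCommGroup Y]
    [InnerProductSpace ℂ Y] [CompleteSpace Y] {B B' : Y →L[ℂ] Y} (hB : IsSelfAdjoint B)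
    (hB' : IsSelfAdjoint B') {δ : ℝ} (hδ : 0 < δ) (h : ∀ x, ‖B x - B' x‖ ≤ δ * ‖x‖) {ν : ℂ}
    (hν : ν ∈ spectrum ℂ B) : ∃ ν' ∈ spectrum ℂ B', ‖ν' - ν‖ ≤ 2 * δ := by
  -- An approximate eigenvector of `B` with error `δ` is one of `B'` with error `2δ`.
  obtain ⟨x, hx0, hx⟩ := hB.exists_norm_le_of_mem_spectrum hν hδ
  refine hB'.exists_mem_spectrum_of_norm_le hx0 ?_
  have h1 : B' x - ν • x = (B x - ν • x) - (B x - B' x) := by abel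
  rw [h1]
  refine (norm_sub_le _ _).trans ?_
  linarith [h x]

/-- From `lam - ν⁻¹ = lam ν⁻¹ (ν - lam⁻¹)` and `‖ν⁻¹‖ ≤ 2 ‖lam‖`. This is the source of the
quadratic growth of the constants. -/
theorem norm_sub_inv_le {lam ν : ℂ} {κ : ℝ} (h0 : lam ≠ 0) (h : ‖ν - lam⁻¹‖ ≤ κ)
    (hsmall : 2 * κ * ‖lam‖ < 1) : ν ≠ 0 ∧ ‖lam - ν⁻¹‖ ≤ 2 * κ * ‖lam‖ ^ 2 := by
  have hl : 0 < ‖lam‖ := norm_pos_iff.2 h0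
  have h1 : ‖lam‖⁻¹ - κ ≤ ‖ν‖ := by
    have := norm_sub_norm_le lam⁻¹ ν
    rw [norm_inv, norm_sub_rev] at this
    linarith
  have h2 : κ ≤ ‖lam‖⁻¹ / 2 := by
    have h3 : κ * ‖lam‖ ≤ 1 / 2 := by linarith
    have h4 : κ ≤ (1 / 2) / ‖lam‖ := (le_div_iff₀ hl).2 h3
    calc κ ≤ _ := h4
      _ = _ := by ring
  have h3 : ‖lam‖⁻¹ / 2 ≤ ‖ν‖ := by linarith
  have hν : 0 < ‖ν‖ := lt_of_lt_of_le (by positivity) h3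
  have hν0 : ν ≠ 0 := norm_pos_iff.1 hν
  refine ⟨hν0, ?_⟩
  have h4 : lam - ν⁻¹ = lam * ν⁻¹ * (ν - lam⁻¹) := by field_simp
  have h5 : ‖ν‖⁻¹ ≤ 2 * ‖lam‖ := by
    rw [inv_le_comm₀ hν (by positivity), mul_inv]
    linarith
  rw [h4, norm_mul, norm_mul, norm_inv]
  calc ‖lam‖ * ‖ν‖⁻¹ * ‖ν - lam⁻¹‖ ≤ ‖lam‖ * (2 * ‖lam‖) * κ := by gcongr
    _ = _ := by ring

/-- Points of `closure A` are close to `B`, if those of `A` are. -/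
theorem infDist_le_of_mem_closure {A B : Set ℂ} {K ε : ℝ}
    (h : ∀ x ∈ A, 1 ≤ K * ε * ‖x‖ ∨ ∃ y ∈ B, ‖x - y‖ ≤ K * ε * ‖x‖ ^ 2) {x : ℂ}
    (hx : x ∈ closure A) : 1 ≤ K * ε * ‖x‖ ∨
      (B.Nonempty ∧ Metric.infDist x (closure B) ≤ K * ε * ‖x‖ ^ 2) := by
  -- For empty `B` the value of `infDist` is `0` by default and carries no information; hence
  -- non-emptiness is kept in the second alternative.
  rcases B.eq_empty_or_nonempty with rfl | hB
  · left
    refine closure_minimal (t := {x : ℂ | 1 ≤ K * ε * ‖x‖}) (fun x hx => ?_)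
      (isClosed_le continuous_const (by fun_prop)) hx
    exact (h x hx).resolve_right (by simp)
  · have h1 : x ∈ {x : ℂ | 1 ≤ K * ε * ‖x‖} ∪
        {x : ℂ | Metric.infDist x (closure B) ≤ K * ε * ‖x‖ ^ 2} := by
      refine closure_minimal (fun x hx => ?_) (IsClosed.union
        (isClosed_le continuous_const (by fun_prop))
        (isClosed_le (Metric.continuous_infDist_pt _) (by fun_prop))) hx
      refine (h x hx).imp id ?_
      rintro ⟨y, hy, hxy⟩
      refine (Metric.infDist_le_dist_of_mem (subset_closure hy)).trans ?_
      rwa [dist_eq_norm]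
    exact h1.imp id fun h => ⟨hB, h⟩

/-- The distance of `closure A` to `closure B` on a bounded interval. -/
theorem oneSidedDist_le {A B : Set ℂ} {K ε r₀ : ℝ} (hK : 0 ≤ K) (hε : 0 < ε) (hr₀ : 0 ≤ r₀)
    (h : ∀ x ∈ A, 1 ≤ K * ε * ‖x‖ ∨ ∃ y ∈ B, ‖x - y‖ ≤ K * ε * ‖x‖ ^ 2)
    (hA : ∀ x ∈ closure A, 1 ≤ ‖x‖ ∧ 0 ≤ x.re)
    (hB : A.Nonempty → B.Nonempty → ∃ y ∈ B, ‖y‖ ≤ r₀) (s t : ℝ) :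
    oneSidedDist (realIcc s t ∩ closure A) (closure B) ≤
      ENNReal.ofReal (K * (1 + r₀) * (1 + t ^ 2) * ε) := by
  refine iSup₂_le fun x hx => ENNReal.ofReal_le_ofReal ?_
  obtain ⟨⟨r, hr, rfl⟩, hxA⟩ := hx
  obtain ⟨h1, h2⟩ := hA _ hxA
  rw [Complex.ofReal_re] at h2
  rw [Complex.norm_real, Real.norm_of_nonneg h2] at h1
  have hrt : r ≤ t := hr.2
  have ht1 : t ≤ 1 + t ^ 2 := by nlinarith
  rcases infDist_le_of_mem_closure h hxA with h3 | ⟨-, h3⟩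
  · rw [Complex.norm_real, Real.norm_of_nonneg h2] at h3
    rcases B.eq_empty_or_nonempty with rfl | hBne
    · rw [closure_empty, Metric.infDist_empty]
      positivity
    · obtain ⟨y, hy, hyr⟩ := hB (closure_nonempty_iff.1 ⟨_, hxA⟩) hBne
      have h4 : Metric.infDist (r : ℂ) (closure B) ≤ t + r₀ := by
        refine (Metric.infDist_le_dist_of_mem (subset_closure hy)).trans ?_
        rw [dist_eq_norm]
        refine (norm_sub_le _ _).trans (add_le_add ?_ hyr)
        rwa [Complex.norm_real, Real.norm_of_nonneg h2]
      -- Where inversion gives no control, `K ε t ≥ 1`, and the crude distance `t + r₀` may be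
      -- multiplied by this factor.
      have h5 : 1 ≤ K * ε * t := h3.trans (by gcongr)
      calc _ ≤ t + r₀ := h4
        _ ≤ (t + r₀) * (K * ε * t) := le_mul_of_one_le_right (by linarith) h5
        _ = K * (t ^ 2 + r₀ * t) * ε := by ring
        _ ≤ K * ((1 + t ^ 2) + r₀ * (1 + t ^ 2)) * ε := by
          gcongr
          linarith
        _ = _ := by ring
  · rw [Complex.norm_real, Real.norm_of_nonneg h2] at h3
    calc _ ≤ K * ε * r ^ 2 := h3
      _ ≤ K * ε * ((1 + r₀) * (1 + t ^ 2)) := by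
        gcongr
        nlinarith [pow_le_pow_left₀ h2 hrt 2, sq_nonneg t]
      _ = _ := by ring

/-- Gaps persist. -/
theorem realIcc_inter_closure_eq_empty {A B : Set ℂ} {K C ε : ℝ} (hK : 0 < K) (hKC : K < C)
    (hε : 0 < ε) (h : ∀ x ∈ A, 1 ≤ K * ε * ‖x‖ ∨ ∃ y ∈ B, ‖x - y‖ ≤ K * ε * ‖x‖ ^ 2)
    (hA : ∀ x ∈ closure A, 1 ≤ ‖x‖ ∧ 0 ≤ x.re) (hB : ∀ y ∈ closure B, ∃ r : ℝ, y = r) {s t : ℝ}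
    (hgap : Complex.ofReal '' Set.Ioo s t ∩ closure B = ∅) :
    realIcc (s + C * (1 + t ^ 2) * ε) (t - C * (1 + t ^ 2) * ε) ∩ closure A = ∅ := by
  rw [Set.eq_empty_iff_forall_notMem]
  rintro _ ⟨⟨r, ⟨hr1, hr2⟩, rfl⟩, hxA⟩
  obtain ⟨h1, h2⟩ := hA _ hxA
  rw [Complex.ofReal_re] at h2
  rw [Complex.norm_real, Real.norm_of_nonneg h2] at h1
  have hC : 0 < C := hK.trans hKC
  have hpos : 0 < C * (1 + t ^ 2) * ε := by positivity
  have hrt : r ≤ t := by linarith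
  rcases infDist_le_of_mem_closure h hxA with h3 | ⟨hne, h3⟩
  · rw [Complex.norm_real, Real.norm_of_nonneg h2] at h3
    have h4 : K * (1 + t ^ 2) * ε ≤ C * (1 + t ^ 2) * ε := by gcongr
    -- Impossible: with `κ = K ε` the right side is `κt - κ²t² - κ²`, which is less than `1`.
    have h5 : 1 ≤ K * ε * (t - K * (1 + t ^ 2) * ε) := h3.trans (by gcongr; linarith)
    nlinarith [sq_nonneg (K * ε * t - 1), sq_nonneg (K * ε), mul_pos hK hε]
  · rw [Complex.norm_real, Real.norm_of_nonneg h2] at h3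
    -- The inequality is strict, so some point of `closure B` is this close to `r`, hence inside the
    -- gap `(s, t)`.
    have h4 : Metric.infDist (r : ℂ) (closure B) < C * (1 + t ^ 2) * ε := by
      calc _ ≤ K * ε * r ^ 2 := h3
        _ ≤ K * ε * t ^ 2 := by gcongr
        _ < C * ε * (1 + t ^ 2) := by
          have : K * ε * t ^ 2 ≤ C * ε * t ^ 2 := by gcongr
          nlinarith [mul_pos hC hε]
        _ = _ := by ring
    obtain ⟨y, hy, hxy⟩ := (Metric.infDist_lt_iff hne.closure).1 h4
    obtain ⟨r', rfl⟩ := hB y hy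
    rw [Complex.dist_eq, ← Complex.ofReal_sub, Complex.norm_real, Real.norm_eq_abs, abs_lt] at hxy
    have : (r' : ℂ) ∈ Complex.ofReal '' Set.Ioo s t ∩ closure B :=
      ⟨⟨r', ⟨by linarith, by linarith⟩, rfl⟩, hy⟩
    rw [hgap] at this
    exact this

/-! ### The spectra of `𝓛_{ε,θ}` and comparison of fibre resolvents -/

namespace Setting

variable {n : ℕ} {H X : Type*} [NormedAddCommGroup H] [InnerProductSpace ℂ H] [CompleteSpace H]
  [NormedAddCommGroup X] [InnerProductSpace ℂ X] [CompleteSpace X] {S : Setting n H X}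

local notation "𝕍" => EuclideanSpace ℝ (Fin n)

section

variable {P : S.Splitting} (t : Transfer P) {ε : ℝ} (hε : 0 < ε) (hε1 : ε < 1)
include t hε hε1

theorem Transfer.mem_sp_opL_iff (θ : S.Θ) {lam : ℂ} : lam ∈ Sp (S.opL ε θ) ↔
    pencilEigenspace (S.formL ε θ) (pullInner (t.j θ)) lam ≠ ⊥ := by
  have hq := S.formL_coercive hε θ hε1
  rw [t.sp_opL hε hε1]
  constructor
  · rintro ⟨h0, h⟩
    exact (BForm.mem_spectrum_inv_iff hq (t.j_compact θ) h0).1 h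
  · intro h
    obtain ⟨e, he, he0⟩ := Submodule.exists_mem_ne_zero_of_ne_bot h
    obtain ⟨-, r, hr, rfl⟩ := BForm.exists_pos_of_mem_pencilEigenspace hq he0 he
    have h0 : (r : ℂ) ≠ 0 := Complex.ofReal_ne_zero.2 hr.ne'
    exact ⟨h0, (BForm.mem_spectrum_inv_iff hq (t.j_compact θ) h0).2 h⟩

theorem Transfer.exists_real_of_mem_sp_opL (θ : S.Θ) {lam : ℂ} (h : lam ∈ Sp (S.opL ε θ)) :
    ∃ r : ℝ, 1 ≤ r ∧ lam = r := by
  have hq := S.formL_coercive hε θ hε1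
  rw [t.mem_sp_opL_iff hε hε1] at h
  obtain ⟨e, he, he0⟩ := Submodule.exists_mem_ne_zero_of_ne_bot h
  obtain ⟨hj, r, hr, rfl⟩ := BForm.exists_pos_of_mem_pencilEigenspace hq he0 he
  refine ⟨r, ?_, rfl⟩
  have h1 := he e
  rw [pullInner_self, ← Complex.ofReal_mul] at h1
  have h2 : (S.formL ε θ e e).re = r * ‖t.j θ e‖ ^ 2 := by rw [h1, Complex.ofReal_re]
  rw [← (S.isNonneg_formL ε θ).en_sq] at h2
  have h3 := pow_le_pow_left₀ (norm_nonneg _)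
    ((t.norm_j_le θ e).trans (S.en_b_le_formL (ε := ε) θ e)) 2
  rw [h2] at h3
  have h4 : 0 < ‖t.j θ e‖ ^ 2 := by
    have := norm_pos_iff.2 hj
    positivity
  exact (le_mul_iff_one_le_left h4).1 h3

/-- If `V_0 ≠ 0`, the operators `𝓛_{ε,0}` have a uniformly bounded eigenvalue. -/
theorem Transfer.exists_mem_sp_opL_le {v : S.V S.o} (hv : v ≠ 0) :
    ∃ lam ∈ Sp (S.opL ε S.o), ‖lam‖ ≤ ‖v‖ ^ 2 / ‖S.J v‖ ^ 2 := by
  have hq := S.formL_coercive hε S.o hε1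
  set r₀ := ‖v‖ ^ 2 / ‖S.J v‖ ^ 2 with hr₀
  have hv' : (v : H) ≠ 0 := fun h => hv (Subtype.ext h)
  have hJ : 0 < ‖S.J v‖ :=
    norm_pos_iff.2 fun h => hv' (S.J_injective (h.trans (map_zero S.J).symm))
  have h1 : 1 ≤ specCount (S.formL ε S.o) (pullInner (t.j S.o)) r₀ := by
    rw [BForm.le_specCount_iff hq (t.j_compact S.o)]
    -- On `V_0` the form `a_0` vanishes, so the Rayleigh quotient of `v` does not depend on `ε`.
    refine ⟨ℂ ∙ (v : H), inferInstance, (finrank_span_singleton hv').ge, fun u hu => ?_⟩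
    obtain ⟨a, rfl⟩ := Submodule.mem_span_singleton.1 hu
    have h2 : ‖t.j S.o (a • (v : H))‖ = ‖a‖ * ‖S.J v‖ := by
      rw [t.j_apply, t.norm_E_symm, S.en_d_zero, map_smul, norm_smul]
    have hav := (S.V S.o).smul_mem a v.2
    rw [h2, formL_apply, S.a_left_V hav, mul_zero, zero_add, S.b_self_of_mem hav,
      Complex.ofReal_re, norm_smul, hr₀]
    have h3 : ‖(v : H)‖ = ‖v‖ := rfl
    rw [h3]
    apply le_of_eq
    field_simp
  have h2 : pencilSpan (S.formL ε S.o) (pullInner (t.j S.o)) r₀ ≠ ⊥ := by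
    intro h
    rw [specCount, h, finrank_bot] at h1
    omega
  obtain ⟨s, hs, hne⟩ : ∃ s ∈ Iic r₀,
      pencilEigenspace (S.formL ε S.o) (pullInner (t.j S.o)) (s : ℂ) ≠ ⊥ := by
    by_contra! hcon
    exact h2 (le_bot_iff.1 (iSup₂_le fun s hs => (hcon s hs).le))
  have hmem := (t.mem_sp_opL_iff hε hε1 S.o).2 hne
  refine ⟨s, hmem, ?_⟩
  obtain ⟨r, hr, hsr⟩ := t.exists_real_of_mem_sp_opL hε hε1 S.o hmem
  rw [Complex.ofReal_inj] at hsr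
  rw [Complex.norm_real, Real.norm_of_nonneg (by linarith)]
  exact hs

end

namespace Expansion

variable {A : S.Expansion} {P : S.Splitting} {c : ℝ} (hc : A.FibreBound P c)
include hc

namespace FibreBound

/-- The fibre resolvents vary little for large `ξ`. -/
theorem exists_fibre_far {ρ : ℝ} (hρ : 0 < ρ) : ∃ C : ℝ, 0 ≤ C ∧ ∀ ε : ℝ, 0 < ε → ε < 1 →
    ∀ ξ ξ' : 𝕍, ρ / ε ≤ ‖ξ‖ → ρ / ε ≤ ‖ξ'‖ → ∀ f : X,
      ‖(A.fibreForm P ξ).inv (S.embX (S.V S.o)) f -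
        (A.fibreForm P ξ').inv (S.embX (S.V S.o)) f‖ ≤ C * ε * ‖f‖ := by
  have hpos := hc.pos
  refine ⟨2 * (2 / (c * ρ ^ 2)), by positivity, fun ε hε hε1 ξ ξ' hξ hξ' f => ?_⟩
  have hz : ∀ ξ : 𝕍, ρ / ε ≤ ‖ξ‖ →
      ‖P.projZ ((A.fibreForm P ξ).sol (S.embX (S.V S.o)) f)‖ ≤ 2 / (c * ρ ^ 2) * (ε * ‖f‖) := by
    intro ξ hξ
    set s := (A.fibreForm P ξ).sol (S.embX (S.V S.o)) f with hs
    obtain ⟨-, b2⟩ := hc.sol_bound (ξ := ξ) (s := s) (norm_nonneg f) fun w => by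
      rw [hs, BForm.sol_spec (hc.coercive ξ)]
      refine (norm_inner_le_norm _ _).trans ?_
      rw [mul_comm]
      gcongr
      exact S.norm_J_le w
    have h1 : c * (ρ / ε) ^ 2 * ‖P.projZ s‖ ≤ 2 * ‖f‖ := le_trans (by gcongr) b2
    have h2 : ‖P.projZ s‖ = ε ^ 2 / (c * ρ ^ 2) * (c * (ρ / ε) ^ 2 * ‖P.projZ s‖) := by
      field_simp
    rw [h2]
    calc _ ≤ ε ^ 2 / (c * ρ ^ 2) * (2 * ‖f‖) := by gcongr
      _ = 2 / (c * ρ ^ 2) * (ε ^ 2 * ‖f‖) := by ring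
      _ ≤ _ := by
        gcongr
        nlinarith
  set s := (A.fibreForm P ξ).sol (S.embX (S.V S.o)) f with hs
  set s' := (A.fibreForm P ξ').sol (S.embX (S.V S.o)) f with hs'
  have hb : ∀ ξ : 𝕍, ∀ v : P.Vs, S.b S.o ((A.fibreForm P ξ).sol (S.embX (S.V S.o)) f) v =
      inner ℂ (S.J v) f := by
    intro ξ v
    have h1 := BForm.sol_spec (hc.coercive ξ) (S.embX (S.V S.o)) f (P.inclVs v)
    rw [fibreForm_apply, P.projZ_inclVs, map_zero, map_zero, zero_add] at h1
    exact h1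
  -- Tested against `V_⋆` the fibre equation does not involve `ξ`. The difference of the solutions
  -- is therefore orthogonal to `V_⋆` and bounded by its `Z`-part, which is `O(ε)` for both.
  have hd : ∀ v : P.Vs, S.b S.o ((s - s' : S.V S.o) : H) v = 0 := by
    intro v
    rw [Submodule.coe_sub, map_sub, sub_apply, hb, hb, sub_self]
  have hdz : ‖s - s'‖ ≤ ‖P.projZ (s - s')‖ := by
    have h1 : S.b S.o ((s - s' : S.V S.o) : H) (s - s' : S.V S.o) =
        S.b S.o ((s - s' : S.V S.o) : H) (P.projZ (s - s') : H) := by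
      conv_lhs => rw [← P.coe_proj_add (s - s'), map_add, P.coe_proj_add, hd, zero_add]
    have h2 : ‖s - s'‖ * ‖s - s'‖ ≤ ‖P.projZ (s - s')‖ * ‖s - s'‖ := by
      have h3 := S.b_self_of_mem (s - s').2
      rw [h1, S.b_zero_eq_inner (s - s').2] at h3
      have h4 := norm_inner_le_norm (𝕜 := ℂ) (P.projZ (s - s') : H) ((s - s' : S.V S.o) : H)
      rw [h3, Complex.norm_real, Real.norm_of_nonneg (by positivity), sq] at h4
      exact h4
    rcases (norm_nonneg (s - s')).eq_or_lt with h0 | h0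
    · rw [← h0]
      positivity
    · exact le_of_mul_le_mul_right h2 h0
  change ‖S.J s - S.J s'‖ ≤ _
  rw [← map_sub]
  calc _ ≤ ‖s - s'‖ := S.norm_J_le (s - s' : S.V S.o)
    _ ≤ ‖P.projZ s - P.projZ s'‖ := by rw [← map_sub]; exact hdz
    _ ≤ 2 / (c * ρ ^ 2) * (ε * ‖f‖) + 2 / (c * ρ ^ 2) * (ε * ‖f‖) :=
      (norm_sub_le _ _).trans (add_le_add (hz ξ hξ) (hz ξ' hξ'))
    _ = _ := by ring

/-- Every fibre resolvent is close to some resolvent `𝓛_{ε,θ}⁻¹`. -/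
theorem exists_fibre_near_opL (t : Transfer P) {C : ℝ} (hC : 0 ≤ C)
    (hest : ∀ (θ : S.Θ) (ε : ℝ), 0 < ε → ε < 1 → ∀ f : X,
      ‖(S.formL ε θ).inv (t.j θ) f -
        (A.fibreForm P (ε⁻¹ • (θ : 𝕍))).inv (S.embX (S.V S.o)) f‖ ≤ C * ε * ‖f‖) :
    ∃ C' : ℝ, 0 ≤ C' ∧ ∀ ε : ℝ, 0 < ε → ε < 1 → ∀ ξ : 𝕍, ∃ θ : S.Θ, ∀ f : X,
      ‖(A.fibreForm P ξ).inv (S.embX (S.V S.o)) f - (S.formL ε θ).inv (t.j θ) f‖ ≤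
        C' * ε * ‖f‖ := by
  obtain ⟨r, hr, hball⟩ := A.exists_ball
  obtain ⟨C₂, hC₂, hfar⟩ := hc.exists_fibre_far (half_pos hr)
  refine ⟨C₂ + C, by positivity, fun ε hε hε1 ξ => ?_⟩
  rcases lt_or_ge ‖ε • ξ‖ r with h | h
  · refine ⟨⟨ε • ξ, hball _ h⟩, fun f => ?_⟩
    have h1 := hest ⟨ε • ξ, hball _ h⟩ ε hε hε1 f
    simp only [smul_smul, inv_mul_cancel₀ hε.ne', one_smul] at h1
    rw [norm_sub_rev]
    refine h1.trans ?_
    gcongr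
    linarith
  · have hξ : r / ε ≤ ‖ξ‖ := by
      rw [norm_smul, Real.norm_of_nonneg hε.le] at h
      rw [div_le_iff₀ hε]
      linarith
    have hξ0 : 0 < ‖ξ‖ := lt_of_lt_of_le (by positivity) hξ
    -- If `εξ` is outside the ball contained in `Θ`, a `θ` in the same direction with `|θ| = r / 2`
    -- serves: both `ξ` and `θ/ε` have norm at least `r / (2ε)`, where fibre inverses differ by
    -- `O(ε)`.
    set θ : 𝕍 := (r / 2 / ‖ξ‖) • ξ with hθ
    have hθn : ‖θ‖ = r / 2 := by
      rw [hθ, norm_smul, Real.norm_of_nonneg (by positivity)]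
      field_simp
    have hmem : θ ∈ S.Θ := hball _ (by rw [hθn]; linarith)
    refine ⟨⟨θ, hmem⟩, fun f => ?_⟩
    have h1 := hest ⟨θ, hmem⟩ ε hε hε1 f
    have h2 := hfar ε hε hε1 ξ (ε⁻¹ • θ) (le_trans (by gcongr; linarith) hξ) (by
      rw [norm_smul, norm_inv, Real.norm_of_nonneg hε.le, hθn]
      apply le_of_eq
      ring) f
    have h3 := (norm_sub_le_norm_sub_add_norm_sub _ _ _).trans (add_le_add h2
      ((norm_sub_rev _ _).trans_le h1))
    refine h3.trans (le_of_eq ?_)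
    ring

end FibreBound

end Expansion

end Setting

/-- The first alternative collects the points so large that the error in the inverse is comparable
with `lam⁻¹` itself. -/
theorem IsSelfAdjoint.exists_inv_mem_spectrum_near {Y : Type*} [NormedAddCommGroup Y]
    [InnerProductSpace ℂ Y] [CompleteSpace Y] {B B' : Y →L[ℂ] Y} (hB : IsSelfAdjoint B)
    (hB' : IsSelfAdjoint B') {δ : ℝ} (hδ : 0 < δ) (h : ∀ x, ‖B x - B' x‖ ≤ δ * ‖x‖) {lam : ℂ}
    (h0 : lam ≠ 0) (hlam : lam⁻¹ ∈ spectrum ℂ B) : 1 ≤ 4 * δ * ‖lam‖ ∨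
      ∃ mu : ℂ, mu ≠ 0 ∧ mu⁻¹ ∈ spectrum ℂ B' ∧ ‖lam - mu‖ ≤ 4 * δ * ‖lam‖ ^ 2 := by
  obtain ⟨ν, hν, hνlam⟩ := hB.exists_mem_spectrum_near hB' hδ h hlam
  have h4 : 2 * (2 * δ) = 4 * δ := by ring
  rcases lt_or_ge (2 * (2 * δ) * ‖lam‖) 1 with hs | hs
  · obtain ⟨hν0, hle⟩ := norm_sub_inv_le h0 hνlam hs
    rw [h4] at hle
    exact Or.inr ⟨ν⁻¹, inv_ne_zero hν0, by rwa [inv_inv], hle⟩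
  · rw [h4] at hs
    exact Or.inl hs

/-! ### Convergence of the collective spectrum -/

namespace Setting.Expansion.FibreBound

variable {n : ℕ} {H X : Type*} [NormedAddCommGroup H] [InnerProductSpace ℂ H] [CompleteSpace H]
  [NormedAddCommGroup X] [InnerProductSpace ℂ X] [CompleteSpace X] {S : Setting n H X}
  {A : S.Expansion} {P : S.Splitting} {c : ℝ} (hc : A.FibreBound P c)
include hc

/-- The collective spectrum and the union of the fibre spectra are close to each other. -/
theorem exists_spectra_near (h1 : S.GapCondition) (h2 : P.RemovableSingularity)
    (h3 : S.QuadraticGap) (h5 : S.LipschitzB) (t : Transfer P) :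
    ∃ K : ℝ, 0 < K ∧ ∀ ε : ℝ, 0 < ε → ε < 1 →
      (∀ x ∈ ⋃ θ, Sp (S.opL ε θ), 1 ≤ K * ε * ‖x‖ ∨
        ∃ y ∈ ⋃ ξ, Sp (A.opLxi P ξ), ‖x - y‖ ≤ K * ε * ‖x‖ ^ 2) ∧
      ∀ x ∈ ⋃ ξ, Sp (A.opLxi P ξ), 1 ≤ K * ε * ‖x‖ ∨
        ∃ y ∈ ⋃ θ, Sp (S.opL ε θ), ‖x - y‖ ≤ K * ε * ‖x‖ ^ 2 := by
  obtain ⟨C, hC, hest⟩ := hc.exists_resolvent_estimate h1 h2 h3 h5 t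
  obtain ⟨C', hC', hest'⟩ := hc.exists_fibre_near_opL t hC hest
  have hsaX : ∀ ξ, IsSelfAdjoint ((A.fibreForm P ξ).inv (S.embX (S.V S.o))) := fun ξ =>
    BForm.isSelfAdjoint_inv (hc.coercive ξ) _
  refine ⟨4 * (C + C' + 1), by positivity, fun ε hε hε1 => ?_⟩
  have hsaL : ∀ θ, IsSelfAdjoint ((S.formL ε θ).inv (t.j θ)) := fun θ =>
    BForm.isSelfAdjoint_inv (S.formL_coercive hε θ hε1) _
  have hδ : 0 < (C + C' + 1) * ε := by positivity
  rw [show 4 * (C + C' + 1) * ε = 4 * ((C + C' + 1) * ε) by ring]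
  constructor
  · intro x hx
    obtain ⟨θ, hx⟩ := mem_iUnion.1 hx
    rw [t.sp_opL hε hε1] at hx
    refine ((hsaL θ).exists_inv_mem_spectrum_near (hsaX _) hδ
      (fun f => (hest θ ε hε hε1 f).trans ?_) hx.1 hx.2).imp id ?_
    · gcongr
      linarith
    · rintro ⟨y, hy0, hy, hle⟩
      exact ⟨y, mem_iUnion.2 ⟨_, (hc.mem_sp_opLxi_iff_spectrum hy0).2 hy⟩, hle⟩
  · intro x hx
    obtain ⟨ξ, hx⟩ := mem_iUnion.1 hx
    have hx0 : x ≠ 0 := by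
      have := hc.one_le_norm_of_mem_sp hx
      exact norm_pos_iff.1 (by linarith)
    rw [hc.mem_sp_opLxi_iff_spectrum hx0] at hx
    obtain ⟨θ, hθ⟩ := hest' ε hε hε1 ξ
    refine ((hsaX ξ).exists_inv_mem_spectrum_near (hsaL θ) hδ
      (fun f => (hθ f).trans ?_) hx0 hx).imp id ?_
    · gcongr
      linarith
    · rintro ⟨y, hy0, hy, hle⟩
      refine ⟨y, mem_iUnion.2 ⟨θ, ?_⟩, hle⟩
      rw [t.sp_opL hε hε1]
      exact ⟨hy0, hy⟩

/-- The lowest parts of the spectra stay bounded. -/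
theorem exists_bounded_mem (t : Transfer P) : ∃ r : ℝ, 0 ≤ r ∧
    ((⋃ ξ, Sp (A.opLxi P ξ)).Nonempty → (∃ y ∈ ⋃ ξ, Sp (A.opLxi P ξ), ‖y‖ ≤ r) ∧
      ∀ ε : ℝ, 0 < ε → ε < 1 → ∃ y ∈ ⋃ θ, Sp (S.opL ε θ), ‖y‖ ≤ r) := by
  by_cases hne : (⋃ ξ, Sp (A.opLxi P ξ)).Nonempty
  · obtain ⟨y, hy⟩ := hne
    obtain ⟨ξ, hξ⟩ := mem_iUnion.1 hy
    -- A point of a fibre spectrum provides a nonzero vector of `V_0`, whose Rayleigh quotient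
    -- bounds an eigenvalue of `𝓛_{ε,0}` for every `ε`.
    obtain ⟨v, -, hv⟩ := Submodule.exists_mem_ne_zero_of_ne_bot (hc.mem_sp_opLxi_iff.1 hξ)
    refine ⟨max ‖y‖ (‖v‖ ^ 2 / ‖S.J v‖ ^ 2), le_max_of_le_left (norm_nonneg y), fun _ =>
      ⟨⟨y, hy, le_max_left _ _⟩, fun ε hε hε1 => ?_⟩⟩
    obtain ⟨lam, hlam, hle⟩ := t.exists_mem_sp_opL_le hε hε1 hv
    exact ⟨lam, mem_iUnion.2 ⟨_, hlam⟩, hle.trans (le_max_right _ _)⟩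
  · exact ⟨0, le_rfl, fun h => absurd h hne⟩

/-- The rate of convergence of the collective spectrum, and the persistence of gaps. -/
theorem exists_distOn_le (h1 : S.GapCondition) (h2 : P.RemovableSingularity)
    (h3 : S.QuadraticGap) (h5 : S.LipschitzB) (tr : Transfer P) :
    ∃ (C : ℝ) (Cb : ℝ → ℝ), (∀ t, 0 ≤ Cb t ∧ Cb t ≤ C * (1 + t ^ 2)) ∧
      ∀ s t ε : ℝ, 0 < ε → ε < 1 →
        distOn s t (S.collectiveSp ε) (Sp (A.bivariateOp P)) ≤ ENNReal.ofReal (Cb t * ε) ∧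
        (Complex.ofReal '' Set.Ioo s t ∩ Sp (A.bivariateOp P) = ∅ → 2 * Cb t * ε < t - s →
          realIcc (s + Cb t * ε) (t - Cb t * ε) ∩ S.collectiveSp ε = ∅) := by
  obtain ⟨K, hK, hnear⟩ := hc.exists_spectra_near h1 h2 h3 h5 tr
  obtain ⟨r, hr, hbdd⟩ := hc.exists_bounded_mem tr
  -- The factor `1 + r` serves the distance estimate; the extra `1` makes the constant strictly
  -- larger than `K`, as the gap argument requires.
  refine ⟨K * (1 + r) + 1, fun t => (K * (1 + r) + 1) * (1 + t ^ 2),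
    fun t => ⟨by positivity, le_rfl⟩, fun s t ε hε hε1 => ?_⟩
  obtain ⟨hAB, hBA⟩ := hnear ε hε hε1
  have hcl : IsClosed {x : ℂ | 1 ≤ ‖x‖ ∧ 0 ≤ x.re} :=
    (isClosed_le continuous_const continuous_norm).inter
      (isClosed_le continuous_const Complex.continuous_re)
  have hA : ∀ x ∈ closure (⋃ θ, Sp (S.opL ε θ)), 1 ≤ ‖x‖ ∧ 0 ≤ x.re := by
    refine fun x hx => closure_minimal (fun y hy => ?_) hcl hx
    obtain ⟨θ, hy⟩ := mem_iUnion.1 hy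
    obtain ⟨ρ, hρ, rfl⟩ := tr.exists_real_of_mem_sp_opL hε hε1 θ hy
    have hρ0 : (0 : ℝ) ≤ ρ := by linarith
    exact ⟨by rwa [Complex.norm_real, Real.norm_of_nonneg hρ0], hρ0⟩
  have hB : ∀ x ∈ closure (⋃ ξ, Sp (A.opLxi P ξ)), ∃ ρ : ℝ, 1 ≤ ρ ∧ x = ρ := by
    rw [← hc.sp_bivariateOp]
    exact fun x => hc.exists_real_of_mem_sp
  have hB' : ∀ x ∈ closure (⋃ ξ, Sp (A.opLxi P ξ)), 1 ≤ ‖x‖ ∧ 0 ≤ x.re := by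
    intro x hx
    obtain ⟨ρ, hρ, rfl⟩ := hB x hx
    have hρ0 : (0 : ℝ) ≤ ρ := by linarith
    exact ⟨by rwa [Complex.norm_real, Real.norm_of_nonneg hρ0], hρ0⟩
  rw [hc.sp_bivariateOp, collectiveSp]
  constructor
  · have hle : ENNReal.ofReal (K * (1 + r) * (1 + t ^ 2) * ε) ≤
        ENNReal.ofReal ((K * (1 + r) + 1) * (1 + t ^ 2) * ε) := by
      apply ENNReal.ofReal_le_ofReal
      gcongr
      linarith
    exact max_le
      ((oneSidedDist_le hK.le hε hr hAB hA (fun _ h => (hbdd h).1) s t).trans hle)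
      ((oneSidedDist_le hK.le hε hr hBA hB' (fun h _ => (hbdd h).2 ε hε hε1) s t).trans hle)
  · intro hgap _
    refine realIcc_inter_closure_eq_empty hK (by nlinarith) hε hAB hA (fun y hy => ?_) hgap
    obtain ⟨ρ, -, h⟩ := hB y hy
    exact ⟨ρ, h⟩

end Setting.Expansion.FibreBound

end

theorem mainTheorem3 {n : ℕ} (hn : 1 ≤ n) {H X : Type*}
    [NormedAddCommGroup H] [InnerProductSpace ℂ H] [CompleteSpace H]
    [TopologicalSpace.SeparableSpace H]
    [NormedAddCommGroup X] [InnerProductSpace ℂ X] [CompleteSpace X]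
    [TopologicalSpace.SeparableSpace X]
    (S : Setting n H X) (P : S.Splitting) (A : S.Expansion)
    (h1 : S.GapCondition) (h2 : P.RemovableSingularity) (h3 : S.QuadraticGap)
    (h5 : S.LipschitzB) (h6 : P.TransferCondition) :
    -- the spectrum of the bivariate operator is the closed union of the fibre spectra
    Sp (A.bivariateOp P) = closure (⋃ ξ : EuclideanSpace ℝ (Fin n), Sp (A.opLxi P ξ)) ∧
    -- the band formula
    (∀ k : ℕ, 1 ≤ k → (k : Cardinal) ≤ Module.rank ℂ P.Vs →
      nthEigenvalue (S.opB (S.V S.o)) k ≤ nthEigenvalue (S.opB P.Vs) k) ∧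
    (¬ FiniteDimensional ℂ P.Vs →
      Sp (A.bivariateOp P) = Complex.ofReal '' ⋃ k ∈ Set.Ici 1,
        Set.Icc (nthEigenvalue (S.opB (S.V S.o)) k) (nthEigenvalue (S.opB P.Vs) k)) ∧
    (FiniteDimensional ℂ P.Vs → P.Z ≠ ⊥ →
      Sp (A.bivariateOp P) = Complex.ofReal ''
        ((⋃ k ∈ Set.Icc 1 (Module.finrank ℂ P.Vs),
            Set.Icc (nthEigenvalue (S.opB (S.V S.o)) k) (nthEigenvalue (S.opB P.Vs) k)) ∪
          Set.Ici (nthEigenvalue (S.opB (S.V S.o)) (Module.finrank ℂ P.Vs + 1)))) ∧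
    -- the characterisation by the form `β`
    (P.Normalised →
      Sp (A.bivariateOp P) =
        Complex.ofReal '' {lam : ℝ | (lam : ℂ) ∉ Sp (S.opB P.Vs) ∧
          ∃ z : P.Z, z ≠ 0 ∧ 0 ≤ P.betaForm lam z z} ∪ Sp (S.opB P.Vs)) ∧
    -- the distance to the collective spectrum, and the persistence of gaps
    ∃ (C : ℝ) (Cb : ℝ → ℝ), (∀ t, 0 ≤ Cb t ∧ Cb t ≤ C * (1 + t ^ 2)) ∧
      ∀ s t ε : ℝ, 0 < ε → ε < 1 →
        distOn s t (S.collectiveSp ε) (Sp (A.bivariateOp P)) ≤ ENNReal.ofReal (Cb t * ε) ∧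
        (Complex.ofReal '' Set.Ioo s t ∩ Sp (A.bivariateOp P) = ∅ → 2 * Cb t * ε < t - s →
          realIcc (s + Cb t * ε) (t - Cb t * ε) ∩ S.collectiveSp ε = ∅) := by
  obtain ⟨c, hc⟩ := A.exists_fibreBound P h1 h2 h3
  obtain ⟨t⟩ := h6.nonempty_transfer
  exact ⟨hc.sp_bivariateOp, fun k hk hrank => hc.nthEigenvalue_le hk hrank,
    hc.sp_eq_of_infinite hn, hc.sp_eq_of_finite hn, hc.sp_eq_of_normalised hn,
    hc.exists_distOn_le h1 h2 h3 h5 t⟩
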